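/- **Setting.** Consider a many-sorted first-order language with the basic sorts $\mathit{int}$, $\mathit{bool}$ and algebraic data type (ADT) sorts given by constructors. A *constraint* is a quantifier-free formula over linear integer arithmetic and booleans; $\mathbb D$ is its standard interpretation, ADT sorts being interpreted by finite constructor trees, and constraint entailment $\models$ refers to $\mathbb D$. A *clause* is $H\leftarrow c,G$ with $c$ a constraint, $G$ a conjunction of atoms and $H$ an atom (*definite clause*) or $\mathit{false}$ (*goal*). $M(P)$ is the least $\mathbb D$-model of a set $P$ of definite clauses; a set of clauses is *satisfiable* if it has a $\mathbb D$-model. **Input.** $P$ is a set of definite clauses defining two disjoint kinds of predicates. *Program predicates* are defined by arbitrary definite clauses whose body contains program atoms only, each with distinct variables as arguments. *Catamorphisms* $h(X,T,\mathit{Res})$, with $X$, $\mathit{Res}$ tuples of basic sort and $T$ of ADT sort, are defined by structural recursion: for each constructor $k$ of the sort of $T$ there is exactly one clause $h(X,k(y_1,\dots,y_m),\mathit{Res})\leftarrow g,f_1(X_1,y_{i_1},R_1),\dots,f_r(X_r,y_{i_r},R_r)$, where the $f_j$ are catamorphisms (possibly $h$) on ADT components, the variables of each $X_j$ are among those of $X$,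 the variables $X,y_1,\dots,y_m,\mathit{Res},R_1,\dots,R_r$ are distinct, and $g$ is a constraint (possibly with local variables) defining $\mathit{Res}$ as a total function of $X$, the $y_i$ and the $R_j$ (for lists and binary trees these are the usual schemata with base and combine functions given by constraints). $\mathit{Cns}$ contains exactly one contract for each program predicate. A *contract* $K$ is $\mathit{pred}(Z)\rightarrow c,\mathit{cata}_1(X_1,T_1,Y_1),\dots,\mathit{cata}_n(X_n,T_n,Y_n)\rightarrow d$, where $Z$ is a tuple of distinct variables, the $X_i,Y_i$ are pairwise disjoint tuples of distinct variables of basic sort, no variable of $Y_i$ is in $Z$, each $T_i$ is an ADT variable in $Z$, $c$ is a constraint on the variables $X_1,\dots,X_n,Z$, and $d$ a constraint on $X_1,\dots,X_n,Y_1,\dots,Y_n,Z$. $K$ is *valid* with respect to $P$ if $M(P)\models\forall(\mathit{pred}(Z)\wedge c\wedge\bigwedge_i\mathit{cata}_i(X_i,T_i,Y_i)\rightarrow d)$, and $\gamma(K)$ is the goal $\mathit{false}\leftarrow\neg d,c,\mathit{pred}(Z),\mathit{cata}_1(X_1,T_1,Y_1),\dots,\mathit{cata}_n(X_n,T_n,Y_n)$.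 **Algorithm $\mathcal T_{\mathit{cata}}$** (nondeterministic in the order of processing and in the choice of names, unifiers, projections and generalizations). A *definition* is a clause $\mathit{newp}(U)\leftarrow c,A,B$ with $\mathit{newp}$ a new predicate, $A$ a program atom, $B$ a conjunction of catamorphism atoms and $U$ the tuple of all variables of basic sort in $c,A,B$. For a program atom $A$ in the body of $C\colon H\leftarrow c,G$, let $\mathit{Catas}_A$ be the conjunction of the catamorphism atoms of $G$ that share an ADT variable with $A$. $A$ is *foldable in $C$* by $D$ if a variant $\mathit{newp}(U)\leftarrow d,A,B$ of $D$ has $\mathit{Catas}_A\subseteq B$ and $c\models d$, its variables outside $A$ and $\mathit{Catas}_A$ not occurring in $C$. $C$ is foldable with respect to $\mathit{Defs}$ if each of its program atoms is foldable by some definition in $\mathit{Defs}$. A definition for $p$ in $\mathit{Defs}$ is *maximal* if every definition in $\mathit{Defs}$ for $p$ has a variant with the same program atom, with catamorphism atoms and head variables among those of it, and whose constraint entails its constraint. Start with $\mathit{InCls}=\mathit{OutCls}=\{\gamma(K)\mid K\in\mathit{Cns}\}$ and $\mathit{Defs}=\emptyset$. While $\mathit{InCls}\ne\emptyset$, do the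 following. 1. *Define*: for each clause $C\colon H\leftarrow c,G$ in $\mathit{InCls}$ and each program atom $A$ in $G$: if $A$ is foldable in $C$ by a definition in $\mathit{Defs}$, skip; else, if $\mathit{Defs}$ has a maximal definition for the predicate of $A$, with variant $\mathit{newp}(U)\leftarrow d,A,B$ (whose variables outside $A$ and the atoms common to $B$ and $\mathit{Catas}_A$ do not occur in $C$), add to $\mathit{Defs}$ a definition with body $g,A,B\cup\mathit{Catas}_A$ where $d\models g$ and $c\models g$; else, if $\mathit{Defs}$ has no definition for the predicate of $A$, add one with body $g,A,\mathit{Catas}_A$, where $c\models g$ and $g$ is a constraint on the input variables of basic sort of $A,\mathit{Catas}_A$. $\mathit{NewDefs}$ is the set of the definitions added in this iteration. 2. *Unfold*: in each definition in $\mathit{NewDefs}$ unfold the program atom using $P$ (with most general unifiers, keeping the resolvents with satisfiable constraint); then unfold catamorphism atoms with a non-variable ADT argument as long as there are any; then, as long as possible, replace two atoms $h(V,T,Y),h(V,T,Z)$ of a body by $h(V,T,Y)$ and the constraint $Y=Z$. 3. *Apply-Contracts*: in each resulting clause $H\leftarrow e,G$, for each program atom $A$ of $G$ in turn, take an instance $A\rightarrow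 c,\mathit{cata}_1(X_1,T_1,Y_1),\dots\rightarrow d$ of the contract for its predicate, in which each $\mathit{cata}_i(X_i,T_i,Y_i)$ either is an atom already in the body or has distinct fresh variables for $Y_i$ and for the variables of $X_i$ not in $Z$; add to $G$ each $\mathit{cata}_i(X_i,T_i,Y_i)$ such that the body has no atom $\mathit{cata}_i(V,T_i,W)$. Let $E\colon H\leftarrow e,G'$ be the resulting clause, $c_1,\dots,c_k$ and $d_1,\dots,d_k$ the constraints $c$ and $d$ of the instances, and $Z'$ the variables of $c_1,\dots,c_k$ not occurring in $E$. If $\mathbb D\models\forall(e\rightarrow\exists Z'.\,c_1\wedge\dots\wedge c_k)$, the result is $H\leftarrow e,c_1,\dots,c_k,d_1,\dots,d_k,G'$; otherwise it is $E$. $\mathit{RCls}$ is the set of the results. 4. $\mathit{InCls}$ becomes the set of the clauses of $\mathit{RCls}$ that are not foldable with respect to $\mathit{Defs}$, and $\mathit{OutCls}$ becomes $\mathit{OutCls}\cup\mathit{RCls}$. Finally, *Fold*: $\mathit{TransfCls}$ is obtained from the clauses of $\mathit{OutCls}$ with head $\mathit{false}$ or with the head predicate of a maximal definition, by replacing each program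 atom $A$ of the body by the head $\mathit{newp}(U)$ of a variant of a maximal definition by which $A$ is foldable (distinct program atoms using distinct fresh variables), and then removing all catamorphism atoms. **Theorem (Soundness of Algorithm $\mathcal T_{\mathit{cata}}$).** Let $P$ and $\mathit{Cns}$ be as above and let $\mathit{TransfCls}$ be an output of Algorithm $\mathcal T_{\mathit{cata}}$ on them. Then every clause in $\mathit{TransfCls}$ has basic sort (all its terms and variables are of basic sort), and if $\mathit{TransfCls}$ is satisfiable, then every contract in $\mathit{Cns}$ is valid with respect to $P$. -/

import Mathlib

namespace TCata

/-- Basic sorts: integers and booleans. -/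
inductive BSort : Type
  | int
  | bool

/-- Sorts: basic sorts and algebraic data types (ADTs), the latter named by `α`. -/
inductive Srt (α : Type) : Type
  | bas (b : BSort)
  | adt (a : α)

/-- `Srt.IsBasic s` says that `s` is a basic sort. -/
def Srt.IsBasic {α : Type} : Srt α → Prop
  | .bas _ => True
  | .adt _ => False

/-- A many-sorted language over `LIA ∪ Bool`: ADT sorts with their constructors, program predicates
with the sorts of their arguments, and catamorphism predicates, each with the basic sorts of its
parameters, the ADT sort it recurs on, and the basic sorts of its outputs. -/
structure Sig where
  Adt : Type
  Con : Type
  res : Con → Adt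
  args : Con → List (Srt Adt)
  Prog : Type
  arity : Prog → List (Srt Adt)
  Cat : Type
  par : Cat → List BSort
  dom : Cat → Adt
  out : Cat → List BSort

abbrev Sig.Sort' (S : Sig) : Type := Srt S.Adt

variable {S : Sig}

/-! ### Terms, constraints, clauses -/

/-- A sorted variable. There are infinitely many variables of each sort. -/
abbrev PVar (S : Sig) : Type := S.Sort' × ℕ

/-- Terms. Those of sort `int` are the linear integer terms, those of sort `bool` are
the quantifier-free constraints over `LIA ∪ Bool` (boolean variables included), and those
of an ADT sort are variables and constructor terms. -/
inductive Term (S : Sig) : S.Sort' → Type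
  | var (s : S.Sort') (n : ℕ) : Term S s
  | lit (z : ℤ) : Term S (.bas .int)
  | add (t₁ t₂ : Term S (.bas .int)) : Term S (.bas .int)
  | smul (z : ℤ) (t : Term S (.bas .int)) : Term S (.bas .int)
  | eq (t₁ t₂ : Term S (.bas .int)) : Term S (.bas .bool)
  | ge (t₁ t₂ : Term S (.bas .int)) : Term S (.bas .bool)
  | gt (t₁ t₂ : Term S (.bas .int)) : Term S (.bas .bool)
  | le (t₁ t₂ : Term S (.bas .int)) : Term S (.bas .bool)
  | lt (t₁ t₂ : Term S (.bas .int)) : Term S (.bas .bool)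
  | tru : Term S (.bas .bool)
  | fls : Term S (.bas .bool)
  | neg (c : Term S (.bas .bool)) : Term S (.bas .bool)
  | and (c₁ c₂ : Term S (.bas .bool)) : Term S (.bas .bool)
  | or (c₁ c₂ : Term S (.bas .bool)) : Term S (.bas .bool)
  | imp (c₁ c₂ : Term S (.bas .bool)) : Term S (.bas .bool)
  | iff (c₁ c₂ : Term S (.bas .bool)) : Term S (.bas .bool)
  | ite (c c₁ c₂ : Term S (.bas .bool)) : Term S (.bas .bool)
  | eqIte (t : Term S (.bas .int)) (c : Term S (.bas .bool)) (t₁ t₂ : Term S (.bas .int)) :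
      Term S (.bas .bool)
  | con (k : S.Con) (ts : ∀ i : Fin (S.args k).length, Term S ((S.args k).get i)) :
      Term S (.adt (S.res k))

/-- Constraints. -/
abbrev Constr (S : Sig) : Type := Term S (.bas .bool)

/-- A term together with its sort. -/
abbrev STerm (S : Sig) : Type := Σ s : S.Sort', Term S s

/-- A variable, as a term. -/
def PVar.tm (x : PVar S) : STerm S := ⟨x.1, .var x.1 x.2⟩

/-- Substitutions (they respect sorts). -/
abbrev Subst (S : Sig) : Type := ∀ s : S.Sort', ℕ → Term S s

def Term.subst (θ : Subst S) : ∀ {s : S.Sort'}, Term S s → Term S s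
  | _, .var s n => θ s n
  | _, .lit z => .lit z
  | _, .add t₁ t₂ => .add (t₁.subst θ) (t₂.subst θ)
  | _, .smul z t => .smul z (t.subst θ)
  | _, .eq t₁ t₂ => .eq (t₁.subst θ) (t₂.subst θ)
  | _, .ge t₁ t₂ => .ge (t₁.subst θ) (t₂.subst θ)
  | _, .gt t₁ t₂ => .gt (t₁.subst θ) (t₂.subst θ)
  | _, .le t₁ t₂ => .le (t₁.subst θ) (t₂.subst θ)
  | _, .lt t₁ t₂ => .lt (t₁.subst θ) (t₂.subst θ)
  | _, .tru => .tru
  | _, .fls => .fls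
  | _, .neg c => .neg (c.subst θ)
  | _, .and c₁ c₂ => .and (c₁.subst θ) (c₂.subst θ)
  | _, .or c₁ c₂ => .or (c₁.subst θ) (c₂.subst θ)
  | _, .imp c₁ c₂ => .imp (c₁.subst θ) (c₂.subst θ)
  | _, .iff c₁ c₂ => .iff (c₁.subst θ) (c₂.subst θ)
  | _, .ite c c₁ c₂ => .ite (c.subst θ) (c₁.subst θ) (c₂.subst θ)
  | _, .eqIte t c t₁ t₂ => .eqIte (t.subst θ) (c.subst θ) (t₁.subst θ) (t₂.subst θ)
  | _, .con k ts => .con k (fun i => (ts i).subst θ)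

/-- The set of variables of a term. -/
def Term.vars : ∀ {s : S.Sort'}, Term S s → Set (PVar S)
  | _, .var s n => {(s, n)}
  | _, .lit _ => ∅
  | _, .add t₁ t₂ => t₁.vars ∪ t₂.vars
  | _, .smul _ t => t.vars
  | _, .eq t₁ t₂ => t₁.vars ∪ t₂.vars
  | _, .ge t₁ t₂ => t₁.vars ∪ t₂.vars
  | _, .gt t₁ t₂ => t₁.vars ∪ t₂.vars
  | _, .le t₁ t₂ => t₁.vars ∪ t₂.vars
  | _, .lt t₁ t₂ => t₁.vars ∪ t₂.vars
  | _, .tru => ∅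
  | _, .fls => ∅
  | _, .neg c => c.vars
  | _, .and c₁ c₂ => c₁.vars ∪ c₂.vars
  | _, .or c₁ c₂ => c₁.vars ∪ c₂.vars
  | _, .imp c₁ c₂ => c₁.vars ∪ c₂.vars
  | _, .iff c₁ c₂ => c₁.vars ∪ c₂.vars
  | _, .ite c c₁ c₂ => c.vars ∪ c₁.vars ∪ c₂.vars
  | _, .eqIte t c t₁ t₂ => t.vars ∪ c.vars ∪ t₁.vars ∪ t₂.vars
  | _, .con _ ts => ⋃ i, (ts i).vars

def STerm.subst (θ : Subst S) (t : STerm S) : STerm S := ⟨t.1, t.2.subst θ⟩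

/-- The variables of a list of terms. -/
def listVars (ts : List (STerm S)) : Set (PVar S) := {x | ∃ t ∈ ts, x ∈ t.2.vars}

/-- Atoms: program atoms, catamorphism atoms `h(params, t, outs)` where `t` is the ADT argument,
and atoms whose predicate is one of the new predicate symbols (named by natural numbers). -/
inductive Atom (S : Sig) : Type
  | prog (p : S.Prog) (ts : List (STerm S))
  | cata (h : S.Cat) (params : List (STerm S)) (t : STerm S) (outs : List (STerm S))
  | new (n : ℕ) (ts : List (STerm S))

/-- All the arguments of an atom. -/
def Atom.args : Atom S → List (STerm S)
  | .prog _ ts => ts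
  | .cata _ params t outs => params ++ t :: outs
  | .new _ ts => ts

def Atom.vars (A : Atom S) : Set (PVar S) := listVars A.args

def Atom.subst (θ : Subst S) : Atom S → Atom S
  | .prog p ts => .prog p (ts.map (STerm.subst θ))
  | .cata h params t outs =>
      .cata h (params.map (STerm.subst θ)) (t.subst θ) (outs.map (STerm.subst θ))
  | .new n ts => .new n (ts.map (STerm.subst θ))

/-- Program atoms. -/
def Atom.isProg : Atom S → Bool
  | .prog _ _ => true
  | _ => false

/-- Catamorphism atoms. -/
def Atom.isCata : Atom S → Bool
  | .cata _ _ _ _ => true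
  | _ => false

/-- A constrained Horn clause `head ← constr, body`; the head `none` stands for `false`. -/
structure Clause (S : Sig) where
  head : Option (Atom S)
  constr : Constr S
  body : List (Atom S)

def bodyVars (G : List (Atom S)) : Set (PVar S) := {x | ∃ A ∈ G, x ∈ A.vars}

def headVars (H : Option (Atom S)) : Set (PVar S) := {x | ∃ A ∈ H, x ∈ A.vars}

def Clause.vars (C : Clause S) : Set (PVar S) :=
  headVars C.head ∪ C.constr.vars ∪ bodyVars C.body

def Clause.subst (θ : Subst S) (C : Clause S) : Clause S :=
  ⟨C.head.map (Atom.subst θ), C.constr.subst θ, C.body.map (Atom.subst θ)⟩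

/-- All terms and all variables of the clause have a basic sort. -/
def Clause.IsBasic (C : Clause S) : Prop :=
  (∀ A ∈ C.head, ∀ t ∈ A.args, t.1.IsBasic) ∧
  (∀ A ∈ C.body, ∀ t ∈ A.args, t.1.IsBasic) ∧
  ∀ x ∈ C.vars, x.1.IsBasic

/-- The conjunction of a list of constraints. -/
def conj : List (Constr S) → Constr S
  | [] => .tru
  | c :: cs => .and c (conj cs)

/-- The equality of two terms of the same basic sort, as a constraint. -/
def eqTerm : STerm S → STerm S → Constr S
  | ⟨.bas .int, t₁⟩, ⟨.bas .int, t₂⟩ => .eq t₁ t₂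
  | ⟨.bas .bool, t₁⟩, ⟨.bas .bool, t₂⟩ => .iff t₁ t₂
  | _, _ => .fls

/-- The equality of two tuples of terms of basic sorts, as a constraint. -/
def eqTuple : List (STerm S) → List (STerm S) → Constr S
  | [], [] => .tru
  | t₁ :: l₁, t₂ :: l₂ => .and (eqTerm t₁ t₂) (eqTuple l₁ l₂)
  | _, _ => .fls

/-- Renamings of variables (sort-preserving permutations). -/
abbrev Ren (S : Sig) : Type := S.Sort' → Equiv.Perm ℕ

def Ren.subst (ρ : Ren S) : Subst S := fun s n => .var s (ρ s n)

def Ren.app (ρ : Ren S) (x : PVar S) : PVar S := (x.1, ρ x.1 x.2)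

/-! ### Semantics -/

/-- The standard domain: integers, booleans, and finite constructor trees. -/
inductive Val (S : Sig) : S.Sort' → Type
  | int (z : ℤ) : Val S (.bas .int)
  | bool (b : Bool) : Val S (.bas .bool)
  | con (k : S.Con) (vs : ∀ i : Fin (S.args k).length, Val S ((S.args k).get i)) :
      Val S (.adt (S.res k))

def Val.toInt : Val S (.bas .int) → ℤ
  | .int z => z

def Val.toBool : Val S (.bas .bool) → Bool
  | .bool b => b

/-- Valuations of the variables. -/
abbrev Valn (S : Sig) : Type := ∀ s : S.Sort', ℕ → Val S s

def Term.eval (v : Valn S) : ∀ {s : S.Sort'}, Term S s → Val S s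
  | _, .var s n => v s n
  | _, .lit z => .int z
  | _, .add t₁ t₂ => .int ((t₁.eval v).toInt + (t₂.eval v).toInt)
  | _, .smul z t => .int (z * (t.eval v).toInt)
  | _, .eq t₁ t₂ => .bool (decide ((t₁.eval v).toInt = (t₂.eval v).toInt))
  | _, .ge t₁ t₂ => .bool (decide ((t₁.eval v).toInt ≥ (t₂.eval v).toInt))
  | _, .gt t₁ t₂ => .bool (decide ((t₁.eval v).toInt > (t₂.eval v).toInt))
  | _, .le t₁ t₂ => .bool (decide ((t₁.eval v).toInt ≤ (t₂.eval v).toInt))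
  | _, .lt t₁ t₂ => .bool (decide ((t₁.eval v).toInt < (t₂.eval v).toInt))
  | _, .tru => .bool true
  | _, .fls => .bool false
  | _, .neg c => .bool (!(c.eval v).toBool)
  | _, .and c₁ c₂ => .bool ((c₁.eval v).toBool && (c₂.eval v).toBool)
  | _, .or c₁ c₂ => .bool ((c₁.eval v).toBool || (c₂.eval v).toBool)
  | _, .imp c₁ c₂ => .bool (!(c₁.eval v).toBool || (c₂.eval v).toBool)
  | _, .iff c₁ c₂ => .bool ((c₁.eval v).toBool == (c₂.eval v).toBool)
  | _, .ite c c₁ c₂ => .bool (bif (c.eval v).toBool then (c₁.eval v).toBool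
      else (c₂.eval v).toBool)
  | _, .eqIte t c t₁ t₂ => .bool (decide ((t.eval v).toInt =
      bif (c.eval v).toBool then (t₁.eval v).toInt else (t₂.eval v).toInt))
  | _, .con k ts => .con k (fun i => (ts i).eval v)

/-- The constraint `c` is true under `v`. -/
def Sat (v : Valn S) (c : Constr S) : Prop := (c.eval v).toBool = true

/-- `𝔻 ⊨ ∀ (c → d)`. -/
def Entails (c d : Constr S) : Prop := ∀ v : Valn S, Sat v c → Sat v d

/-- A value together with its sort. -/
abbrev SVal (S : Sig) : Type := Σ s : S.Sort', Val S s

def STerm.eval (v : Valn S) (t : STerm S) : SVal S := ⟨t.1, t.2.eval v⟩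

/-- Ground atoms: predicates applied to elements of the domain. -/
inductive GAtom (S : Sig) : Type
  | prog (p : S.Prog) (vs : List (SVal S))
  | cata (h : S.Cat) (params : List (SVal S)) (t : SVal S) (outs : List (SVal S))
  | new (n : ℕ) (vs : List (SVal S))

def Atom.eval (v : Valn S) : Atom S → GAtom S
  | .prog p ts => .prog p (ts.map (STerm.eval v))
  | .cata h params t outs =>
      .cata h (params.map (STerm.eval v)) (t.eval v) (outs.map (STerm.eval v))
  | .new n ts => .new n (ts.map (STerm.eval v))

/-- A clause is true in the `𝔻`-interpretation whose true ground atoms are those of `I`. -/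
def Clause.TrueIn (C : Clause S) (I : Set (GAtom S)) : Prop :=
  ∀ v : Valn S, Sat v C.constr → (∀ A ∈ C.body, A.eval v ∈ I) → ∃ A ∈ C.head, A.eval v ∈ I

/-- `I` is a `𝔻`-model of the set `Cls` of clauses. -/
def IsModel (Cls : Set (Clause S)) (I : Set (GAtom S)) : Prop := ∀ C ∈ Cls, C.TrueIn I

/-- Satisfiability of a set of clauses. -/
def Satisfiable (Cls : Set (Clause S)) : Prop := ∃ I : Set (GAtom S), IsModel Cls I

/-- The least `𝔻`-model of a set of definite clauses. -/
def leastModel (P : Set (Clause S)) : Set (GAtom S) := {a | ∀ I, IsModel P I → a ∈ I}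

theorem leastModel_subset {P : Set (Clause S)} {I : Set (GAtom S)} (hI : IsModel P I) :
    leastModel P ⊆ I := fun _ ha => ha I hI

theorem leastModel_isModel {P : Set (Clause S)} (hP : ∀ C ∈ P, C.head ≠ none) :
    IsModel P (leastModel P) := by
  intro C hC v hc hb
  rcases hh : C.head with _ | A
  · exact absurd hh (hP C hC)
  · refine ⟨A, rfl, fun I hI => ?_⟩
    obtain ⟨B, hB, hBI⟩ := hI C hC v hc (fun A' hA' => hb A' hA' I hI)
    rw [hh] at hB
    cases hB
    exact hBI

/-! ### Programs, catamorphisms, contracts -/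

/-- Definite clauses for program predicates: well sorted, no catamorphisms, and every atom in the
body has distinct variables as arguments. -/
def IsProgClause (C : Clause S) : Prop :=
  (∃ p ts, C.head = some (.prog p ts) ∧ ts.map Sigma.fst = S.arity p) ∧
  ∀ A ∈ C.body, ∃ (p : S.Prog) (xs : List (PVar S)),
    A = .prog p (xs.map PVar.tm) ∧ xs.Nodup ∧ xs.map Prod.fst = S.arity p

/-- A (recursive or auxiliary) catamorphism call `fn(params, yᵢ, outs)` in the body of the clause
of a catamorphism for a constructor `k`; `yᵢ` is the `i`-th argument of `k`. -/
structure Call (S : Sig) (k : S.Con) where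
  fn : S.Cat
  params : List (PVar S)
  idx : Fin (S.args k).length
  outs : List (PVar S)

/-- The constraint `g` defines a total function from the variables `ins` to the variables `outs`
(the other variables of `g` are local, that is, existentially quantified). -/
def DefinesFun (g : Constr S) (ins outs : List (PVar S)) : Prop :=
  (∀ v : Valn S, ∃ w : Valn S, (∀ x ∈ ins, w x.1 x.2 = v x.1 x.2) ∧ Sat w g) ∧
  ∀ v w : Valn S, (∀ x ∈ ins, v x.1 x.2 = w x.1 x.2) → Sat v g → Sat w g →
    ∀ x ∈ outs, v x.1 x.2 = w x.1 x.2

/-- `C` is the clause of the catamorphism `h` for the constructor `k`: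
`h(X, k(y₁,…,yₘ), Res) ← g, f₁(X₁, y_{i₁}, R₁), …, fₙ(Xₙ, y_{iₙ}, Rₙ)`, where the `fⱼ` are
catamorphisms (possibly `h` itself) applied to immediate ADT components, the variables of `Xⱼ` are
among those of `X`, and the base or combine function is given by a constraint `g` that
defines `Res` as a total function of the other variables. -/
def IsCataClause (h : S.Cat) (k : S.Con) (C : Clause S) : Prop :=
  S.res k = S.dom h ∧
  ∃ (X : List (PVar S)) (y : Fin (S.args k).length → ℕ) (Res : List (PVar S))
    (calls : List (Call S k)) (g : Constr S),
    X.map Prod.fst = (S.par h).map Srt.bas ∧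
    Res.map Prod.fst = (S.out h).map Srt.bas ∧
    (∀ f ∈ calls, f.params ⊆ X ∧ f.params.map Prod.fst = (S.par f.fn).map Srt.bas ∧
      (S.args k).get f.idx = .adt (S.dom f.fn) ∧
      f.outs.map Prod.fst = (S.out f.fn).map Srt.bas) ∧
    (X ++ List.ofFn (fun i => ((S.args k).get i, y i)) ++ Res ++
      calls.flatMap Call.outs).Nodup ∧
    DefinesFun g (X ++ List.ofFn (fun i => ((S.args k).get i, y i)) ++ calls.flatMap Call.outs)
      Res ∧
    C = ⟨some (.cata h (X.map PVar.tm) ⟨.adt (S.res k), .con k (fun i => .var _ (y i))⟩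
          (Res.map PVar.tm)),
        g,
        calls.map (fun f => .cata f.fn (f.params.map PVar.tm)
          (PVar.tm ((S.args k).get f.idx, y f.idx)) (f.outs.map PVar.tm))⟩

/-- The admissible sets of definite clauses: they consist of clauses for the program predicates and
of the clauses of the catamorphisms, exactly one for each catamorphism and each constructor of
the ADT that it recurs on. -/
structure IsProgram (P : Set (Clause S)) : Prop where
  clauses : ∀ C ∈ P, IsProgClause C ∨ ∃ h k, IsCataClause h k C
  catas : ∀ (h : S.Cat) (k : S.Con), S.res k = S.dom h → ∃! C, C ∈ P ∧ IsCataClause h k C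

/-- A catamorphism atom `cata(X, T, Y)` of a contract. -/
structure CataSpec (S : Sig) where
  cat : S.Cat
  X : List (PVar S)
  T : PVar S
  Y : List (PVar S)

def CataSpec.atom (F : CataSpec S) : Atom S :=
  .cata F.cat (F.X.map PVar.tm) F.T.tm (F.Y.map PVar.tm)

/-- A contract `pred(Z) → pre, cata₁(X₁,T₁,Y₁), …, cataₙ(Xₙ,Tₙ,Yₙ) → post`. -/
structure Contract (S : Sig) where
  pred : S.Prog
  Z : List (PVar S)
  pre : Constr S
  catas : List (CataSpec S)
  post : Constr S

/-- Well-formedness of contracts. -/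
structure Contract.WF (K : Contract S) : Prop where
  nodupZ : K.Z.Nodup
  sortZ : K.Z.map Prod.fst = S.arity K.pred
  sortX : ∀ F ∈ K.catas, F.X.map Prod.fst = (S.par F.cat).map Srt.bas
  sortT : ∀ F ∈ K.catas, F.T ∈ K.Z ∧ F.T.1 = .adt (S.dom F.cat)
  sortY : ∀ F ∈ K.catas, F.Y.map Prod.fst = (S.out F.cat).map Srt.bas
  nodupXY : (K.catas.flatMap CataSpec.X ++ K.catas.flatMap CataSpec.Y).Nodup
  disjYZ : ∀ F ∈ K.catas, ∀ y ∈ F.Y, y ∉ K.Z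
  varsPre : ∀ x ∈ K.pre.vars, x ∈ K.Z ∨ ∃ F ∈ K.catas, x ∈ F.X
  varsPost : ∀ x ∈ K.post.vars, x ∈ K.Z ∨ ∃ F ∈ K.catas, x ∈ F.X ∨ x ∈ F.Y

/-- Validity of a contract with respect to `P`. -/
def Contract.Valid (K : Contract S) (P : Set (Clause S)) : Prop :=
  ∀ v : Valn S, (Atom.prog K.pred (K.Z.map PVar.tm)).eval v ∈ leastModel P → Sat v K.pre →
    (∀ F ∈ K.catas, F.atom.eval v ∈ leastModel P) → Sat v K.post

/-- The goal `false ← ¬ post, pre, pred(Z), cata₁(X₁,T₁,Y₁), …, cataₙ(Xₙ,Tₙ,Yₙ)`. -/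
def Contract.goal (K : Contract S) : Clause S :=
  ⟨none, .and (.neg K.post) K.pre,
    .prog K.pred (K.Z.map PVar.tm) :: K.catas.map CataSpec.atom⟩

/-- Admissible sets of contracts: well-formed ones, exactly one for each program predicate. -/
structure IsContractSet (Cns : Set (Contract S)) : Prop where
  wf : ∀ K ∈ Cns, K.WF
  one : ∀ p : S.Prog, ∃! K, K ∈ Cns ∧ K.pred = p

/-! ### Definitions of new predicates -/

/-- A definition `name(U) ← c, A, catas`. -/
structure Defn (S : Sig) where
  name : ℕ
  U : List (PVar S)
  c : Constr S
  A : Atom S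
  catas : List (Atom S)

def Defn.toClause (D : Defn S) : Clause S :=
  ⟨some (.new D.name (D.U.map PVar.tm)), D.c, D.A :: D.catas⟩

/-- The variant of a definition obtained by a renaming. -/
def Defn.rename (ρ : Ren S) (D : Defn S) : Defn S :=
  ⟨D.name, D.U.map ρ.app, D.c.subst ρ.subst, D.A.subst ρ.subst,
    D.catas.map (Atom.subst ρ.subst)⟩

def Defn.IsVariant (D' D : Defn S) : Prop := ∃ ρ : Ren S, D' = D.rename ρ

/-- `U` is the tuple of the variables of basic sort of `c, A, catas`. -/
def IsBvars (U : List (PVar S)) (c : Constr S) (A : Atom S) (catas : List (Atom S)) : Prop :=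
  U.Nodup ∧ ∀ x : PVar S, x ∈ U ↔ x.1.IsBasic ∧ (x ∈ c.vars ∨ x ∈ bodyVars (A :: catas))

/-- `A` is an atom of the program predicate `p`. -/
def Atom.HasPred (A : Atom S) (p : S.Prog) : Prop := ∃ ts, A = .prog p ts

/-- `F` is one of the catamorphism atoms in the body of `C` that share an ADT variable with `A`. -/
def CatasOf (C : Clause S) (A F : Atom S) : Prop :=
  F ∈ C.body ∧ F.isCata = true ∧ ∃ x : PVar S, ¬ x.1.IsBasic ∧ x ∈ A.vars ∧ x ∈ F.vars

/-- `D` has been renamed so that its program atom is the atom `A` in the body of `C`. Apart from the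
variables of `A` and of the catamorphism atoms that `D` shares with `C`, its variables do not
occur in `C`. -/
def Aligned (C : Clause S) (A : Atom S) (D : Defn S) : Prop :=
  D.A = A ∧ ∀ x ∈ D.toClause.vars, x ∈ C.vars →
    x ∈ A.vars ∨ ∃ F ∈ D.catas, CatasOf C A F ∧ x ∈ F.vars

/-- The program atom `A` in the body of `C`, together with the catamorphism atoms that share
ADT variables with it, can be folded by `D` (already renamed). -/
def Folds (C : Clause S) (A : Atom S) (D : Defn S) : Prop :=
  Aligned C A D ∧ (∀ F, CatasOf C A F → F ∈ D.catas) ∧ Entails C.constr D.c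

/-- The same, for some definition in `Defs`. -/
def FoldableAtom (Defs : Set (Defn S)) (C : Clause S) (A : Atom S) : Prop :=
  ∃ D ∈ Defs, ∃ D', Defn.IsVariant D' D ∧ Folds C A D'

/-- `C` is foldable with respect to `Defs`. -/
def Foldable (Defs : Set (Defn S)) (C : Clause S) : Prop :=
  ∀ A ∈ C.body, A.isProg = true → FoldableAtom Defs C A

/-- `D` is a maximal definition in `Defs` for the program predicate `p`. -/
def IsMaximal (Defs : Set (Defn S)) (p : S.Prog) (D : Defn S) : Prop :=
  D ∈ Defs ∧ D.A.HasPred p ∧ ∀ E ∈ Defs, E.A.HasPred p → ∃ E', Defn.IsVariant E' E ∧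
    E'.A = D.A ∧ E'.catas ⊆ D.catas ∧ Entails E'.c D.c ∧ E'.U ⊆ D.U

/-- `g` is a projection of the constraint `c` onto the set `V` of variables. -/
def IsProjection (c : Constr S) (V : Set (PVar S)) (g : Constr S) : Prop :=
  g.vars ⊆ V ∧ Entails c g

/-- `g` is a generalization of the constraints `c₁` and `c₂`. -/
def IsGeneralization (c₁ c₂ g : Constr S) : Prop := Entails c₁ g ∧ Entails c₂ g

/-- The variables of basic sort occurring in `A` or among the parameters of the catamorphism atoms
on ADT variables of `A`. A projection onto only some of these variables (such as those in
designated input positions of `A`) is also a projection onto all of them. -/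
def inputVars (C : Clause S) (A : Atom S) : Set (PVar S) :=
  {x | x.1.IsBasic ∧ (x ∈ A.vars ∨
    ∃ h params t outs, CatasOf C A (.cata h params t outs) ∧ x ∈ listVars params)}

/-! ### The procedures of the transformation algorithm

Every procedure is given as the relation between its inputs and its possible outputs, since it may
choose an order of processing, names of variables and new predicates, projections and
generalizations. -/

/-- `E` is a definition with body `g, A, B` where the conjunction `B` consists of the atoms
satisfying `Q`, and with a predicate symbol that is new with respect to `Defs`. -/
def IsNewDefn (Defs : Set (Defn S)) (g : Constr S) (A : Atom S) (Q : Atom S → Prop)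
    (E : Defn S) : Prop :=
  (∀ D ∈ Defs, D.name ≠ E.name) ∧ E.c = g ∧ E.A = A ∧ E.catas.Nodup ∧
    (∀ F, F ∈ E.catas ↔ Q F) ∧ IsBvars E.U E.c E.A E.catas

/-- The loop of the procedure Define, over a list of clauses, each with a program atom of its body:
`DefineLoop work Defs New Defs' New'`. -/
inductive DefineLoop : List (Clause S × Atom S) → Set (Defn S) → Set (Defn S) →
    Set (Defn S) → Set (Defn S) → Prop
  | done (Defs New : Set (Defn S)) : DefineLoop [] Defs New Defs New
  | skip {C : Clause S} {A : Atom S} {l : List (Clause S × Atom S)}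
      {Defs New Defs' New' : Set (Defn S)}
      (hf : FoldableAtom Defs C A) (hl : DefineLoop l Defs New Defs' New') :
      DefineLoop ((C, A) :: l) Defs New Defs' New'
  | extend {C : Clause S} {A : Atom S} {l : List (Clause S × Atom S)}
      {Defs New Defs' New' : Set (Defn S)} {p : S.Prog} {D D' E : Defn S} {g : Constr S}
      (hf : ¬ FoldableAtom Defs C A) (hp : A.HasPred p) (hD : IsMaximal Defs p D)
      (hD' : Defn.IsVariant D' D) (hal : Aligned C A D')
      (hg : IsGeneralization D'.c C.constr g)
      (hE : IsNewDefn Defs g A (fun F => F ∈ D'.catas ∨ CatasOf C A F) E)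
      (hl : DefineLoop l (insert E Defs) (insert E New) Defs' New') :
      DefineLoop ((C, A) :: l) Defs New Defs' New'
  | project {C : Clause S} {A : Atom S} {l : List (Clause S × Atom S)}
      {Defs New Defs' New' : Set (Defn S)} {p : S.Prog} {E : Defn S} {g : Constr S}
      (hf : ¬ FoldableAtom Defs C A) (hp : A.HasPred p)
      (hno : ∀ D ∈ Defs, ¬ D.A.HasPred p)
      (hg : IsProjection C.constr (inputVars C A) g)
      (hE : IsNewDefn Defs g A (CatasOf C A) E)
      (hl : DefineLoop l (insert E Defs) (insert E New) Defs' New') :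
      DefineLoop ((C, A) :: l) Defs New Defs' New'

/-- The procedure Define; `Defs'` is the updated set of definitions. -/
def Define (InCls : Set (Clause S)) (Defs Defs' NewDefs : Set (Defn S)) : Prop :=
  ∃ l : List (Clause S × Atom S),
    (∀ C A, (C, A) ∈ l ↔ C ∈ InCls ∧ A ∈ C.body ∧ A.isProg = true) ∧
    DefineLoop l Defs ∅ Defs' NewDefs

/-- `θ` is a most general unifier of `A` and `B`. -/
def IsMGU (θ : Subst S) (A B : Atom S) : Prop :=
  A.subst θ = B.subst θ ∧
  ∀ τ : Subst S, A.subst τ = B.subst τ → ∃ η : Subst S, ∀ s n, τ s n = (θ s n).subst η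

/-- `R` is obtained from the clause `H ← c, L, A, M` by unfolding `A` with (a variant, with fresh
variables, of) the clause `K`. -/
def Resolvent (H : Option (Atom S)) (c : Constr S) (L : List (Atom S)) (A : Atom S)
    (M : List (Atom S)) (K R : Clause S) : Prop :=
  ∃ (ρ : Ren S) (B : Atom S) (θ : Subst S),
    Disjoint (Clause.vars ⟨H, c, L ++ A :: M⟩) (K.subst ρ.subst).vars ∧
    (K.subst ρ.subst).head = some B ∧ IsMGU θ A B ∧
    (∃ v : Valn S, Sat v ((Term.and c (K.subst ρ.subst).constr).subst θ)) ∧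
    R = Clause.subst θ ⟨H, .and c (K.subst ρ.subst).constr, L ++ (K.subst ρ.subst).body ++ M⟩

/-- `Rs` is the set of clauses obtained by unfolding the atom `A` of `H ← c, L, A, M` using `P`. -/
def IsUnf (P : Set (Clause S)) (H : Option (Atom S)) (c : Constr S) (L : List (Atom S))
    (A : Atom S) (M : List (Atom S)) (Rs : Set (Clause S)) : Prop :=
  (∀ R ∈ Rs, ∃ K ∈ P, Resolvent H c L A M K R) ∧
  ∀ K ∈ P, (∃ R, Resolvent H c L A M K R) → ∃ R ∈ Rs, Resolvent H c L A M K R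

/-- One unfolding of a catamorphism atom whose ADT argument is not a variable. -/
def UnfoldCataStep (P : Set (Clause S)) (Cls Cls' : Set (Clause S)) : Prop :=
  ∃ (C : Clause S) (L M : List (Atom S)) (h : S.Cat) (params : List (STerm S)) (t : STerm S)
    (outs : List (STerm S)) (Rs : Set (Clause S)),
    C ∈ Cls ∧ C.body = L ++ .cata h params t outs :: M ∧ (¬ ∃ x : PVar S, t = x.tm) ∧
    IsUnf P C.head C.constr L (.cata h params t outs) M Rs ∧ Cls' = (Cls \ {C}) ∪ Rs

/-- One application of the functionality property. -/
def FunctionalityStep (Cls Cls' : Set (Clause S)) : Prop :=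
  ∃ (C : Clause S) (L M N : List (Atom S)) (h : S.Cat) (params : List (STerm S)) (t : STerm S)
    (Y Z : List (STerm S)),
    C ∈ Cls ∧ C.body = L ++ .cata h params t Y :: M ++ .cata h params t Z :: N ∧
    Cls' = (Cls \ {C}) ∪
      {⟨C.head, .and C.constr (eqTuple Y Z), L ++ .cata h params t Y :: M ++ N⟩}

/-- The procedure Unfold. -/
def Unfold (P : Set (Clause S)) (NewDefs : Set (Defn S)) (UnfCls : Set (Clause S)) : Prop :=
  ∃ (f : Defn S → Set (Clause S)) (Cls : Set (Clause S)),
    (∀ D ∈ NewDefs, IsUnf P D.toClause.head D.c [] D.A D.catas (f D)) ∧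
    Relation.ReflTransGen (UnfoldCataStep P) (⋃ D ∈ NewDefs, f D) Cls ∧
    (¬ ∃ Cls', UnfoldCataStep P Cls Cls') ∧
    Relation.ReflTransGen FunctionalityStep Cls UnfCls ∧
    ¬ ∃ Cls', FunctionalityStep UnfCls Cls'

/-- Addition to the conjunction `G` of those atoms of a list whose catamorphism does not yet occur
in `G` with the same ADT argument: `AddCatas l G G'`. -/
inductive AddCatas : List (Atom S) → List (Atom S) → List (Atom S) → Prop
  | done (G : List (Atom S)) : AddCatas [] G G
  | present {h : S.Cat} {X Y : List (STerm S)} {t : STerm S} {l G G' : List (Atom S)}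
      (hin : ∃ V W, Atom.cata h V t W ∈ G) (hl : AddCatas l G G') :
      AddCatas (.cata h X t Y :: l) G G'
  | add {h : S.Cat} {X Y : List (STerm S)} {t : STerm S} {l G G' : List (Atom S)}
      (hin : ¬ ∃ V W, Atom.cata h V t W ∈ G) (hl : AddCatas l (G ++ [.cata h X t Y]) G') :
      AddCatas (.cata h X t Y :: l) G G'

/-- `σ` instantiates the contract `K` so that it applies to the atom `A`, in a clause with body `G`
where the variables in `used` are not available. The catamorphism atoms in the set `M` are
identified with atoms already occurring in `G`; the parameters (not in `Z`) and the outputs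
of the other ones become distinct fresh variables. -/
def IsInstance (K : Contract S) (A : Atom S) (G : List (Atom S)) (used : Set (PVar S))
    (σ : Subst S) : Prop :=
  A = (Atom.prog K.pred (K.Z.map PVar.tm)).subst σ ∧
  ∃ M : Set (CataSpec S),
    (∀ F ∈ K.catas, F ∈ M → F.atom.subst σ ∈ G) ∧
    (∀ F ∈ K.catas, F ∉ M → ∀ x : PVar S, (x ∈ F.X ∧ x ∉ K.Z) ∨ x ∈ F.Y →
      ∃ n : ℕ, σ x.1 x.2 = .var x.1 n ∧ (x.1, n) ∉ used) ∧
    ∀ F ∈ K.catas, F ∉ M → ∀ F' ∈ K.catas, F' ∉ M → ∀ x x' : PVar S,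
      (x ∈ F.X ∧ x ∉ K.Z) ∨ x ∈ F.Y → (x' ∈ F'.X ∧ x' ∉ K.Z) ∨ x' ∈ F'.Y →
      x.tm.subst σ = x'.tm.subst σ → x = x'

/-- Catamorphism addition, for a list of program atoms of the clause `H ← e, G`; the instantiated
preconditions `cs` and postconditions `ds` of the contracts used are collected:
`AddContracts Cns H e As G cs ds G' cs' ds'`. -/
inductive AddContracts (Cns : Set (Contract S)) (H : Option (Atom S)) (e : Constr S) :
    List (Atom S) → List (Atom S) → List (Constr S) → List (Constr S) →
    List (Atom S) → List (Constr S) → List (Constr S) → Prop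
  | done (G : List (Atom S)) (cs ds : List (Constr S)) : AddContracts Cns H e [] G cs ds G cs ds
  | step {A : Atom S} {As G G₁ G' : List (Atom S)} {cs ds cs' ds' : List (Constr S)}
      {K : Contract S} {σ : Subst S}
      (hK : K ∈ Cns)
      (hσ : IsInstance K A G (Clause.vars ⟨H, .and e (.and (conj cs) (conj ds)), G⟩) σ)
      (hG : AddCatas (K.catas.map (fun F => F.atom.subst σ)) G G₁)
      (hl : AddContracts Cns H e As G₁ (cs ++ [K.pre.subst σ]) (ds ++ [K.post.subst σ])
        G' cs' ds') :
      AddContracts Cns H e (A :: As) G cs ds G' cs' ds'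

/-- `𝔻 ⊨ ∀ (e → ∃ Z. c)` where `Z` are the variables of `c` that do not occur in `E`. -/
def EntailsEx (E : Clause S) (c : Constr S) : Prop :=
  ∀ v : Valn S, Sat v E.constr → ∃ w : Valn S, (∀ x ∈ E.vars, w x.1 x.2 = v x.1 x.2) ∧ Sat w c

/-- The application of contracts to the clause `C`, with result `R`: catamorphism addition, then
addition of the pre- and postconditions if the former are entailed. -/
def ApplyTo (Cns : Set (Contract S)) (C R : Clause S) : Prop :=
  ∃ (G' : List (Atom S)) (cs ds : List (Constr S)),
    AddContracts Cns C.head C.constr (C.body.filter Atom.isProg) C.body [] [] G' cs ds ∧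
    ((EntailsEx ⟨C.head, C.constr, G'⟩ (conj cs) ∧
        R = ⟨C.head, .and C.constr (.and (conj cs) (conj ds)), G'⟩) ∨
      (¬ EntailsEx ⟨C.head, C.constr, G'⟩ (conj cs) ∧ R = ⟨C.head, C.constr, G'⟩))

/-- The procedure Apply-Contracts. -/
def ApplyContracts (Cns : Set (Contract S)) (UnfCls RCls : Set (Clause S)) : Prop :=
  (∀ C ∈ UnfCls, ∃ R ∈ RCls, ApplyTo Cns C R) ∧ ∀ R ∈ RCls, ∃ C ∈ UnfCls, ApplyTo Cns C R

/-- The **while** loop: `Loop P Cns InCls Defs OutCls Defs' OutCls'`, where `Defs'` and `OutCls'`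
are the values when the loop is left. The clauses that are not foldable yet are processed further,
and all the clauses derived belong to `OutCls`. -/
inductive Loop (P : Set (Clause S)) (Cns : Set (Contract S)) :
    Set (Clause S) → Set (Defn S) → Set (Clause S) → Set (Defn S) → Set (Clause S) → Prop
  | done (Defs : Set (Defn S)) (OutCls : Set (Clause S)) : Loop P Cns ∅ Defs OutCls Defs OutCls
  | iter {InCls UnfCls RCls OutCls OutCls' : Set (Clause S)}
      {Defs Defs₁ NewDefs Defs' : Set (Defn S)}
      (hne : InCls.Nonempty)
      (hdef : Define InCls Defs Defs₁ NewDefs)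
      (hunf : Unfold P NewDefs UnfCls)
      (happ : ApplyContracts Cns UnfCls RCls)
      (hl : Loop P Cns {C ∈ RCls | ¬ Foldable Defs₁ C} Defs₁ (OutCls ∪ RCls) Defs' OutCls') :
      Loop P Cns InCls Defs OutCls Defs' OutCls'

/-- Folding of the body atoms of the clause `C` by means of maximal definitions: each program
atom is replaced by an atom of a new predicate, and the catamorphism atoms are removed.
The set `used` holds the variables of the definitions used for the previous atoms. -/
inductive FoldBody (MDefs : Set (Defn S)) (C : Clause S) :
    Set (PVar S) → List (Atom S) → List (Atom S) → Prop
  | done (used : Set (PVar S)) : FoldBody MDefs C used [] []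
  | cata {used : Set (PVar S)} {F : Atom S} {l l' : List (Atom S)} (hF : F.isCata = true)
      (hl : FoldBody MDefs C used l l') : FoldBody MDefs C used (F :: l) l'
  | prog {used : Set (PVar S)} {A : Atom S} {l l' : List (Atom S)} {D D' : Defn S}
      (hA : A.isProg = true) (hD : D ∈ MDefs) (hD' : Defn.IsVariant D' D) (hf : Folds C A D')
      (hu : ∀ x ∈ D'.toClause.vars, x ∈ used → x ∈ C.vars)
      (hl : FoldBody MDefs C (used ∪ D'.toClause.vars) l l') :
      FoldBody MDefs C used (A :: l) (.new D'.name (D'.U.map PVar.tm) :: l')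

/-- The clause `R` is obtained from `C` by folding. -/
def FoldsTo (MDefs : Set (Defn S)) (C R : Clause S) : Prop :=
  ∃ G, FoldBody MDefs C ∅ C.body G ∧ R = ⟨C.head, C.constr, G⟩

/-- The maximal definitions in `Defs`. -/
def maxDefs (Defs : Set (Defn S)) : Set (Defn S) := {D | ∃ p, IsMaximal Defs p D}

/-- The clauses to be folded: those with head `false` or whose head predicate is defined
by a maximal definition. -/
def toBeFolded (OutCls : Set (Clause S)) (Defs : Set (Defn S)) : Set (Clause S) :=
  {C ∈ OutCls | C.head = none ∨ ∃ D ∈ maxDefs Defs, ∃ ts, C.head = some (.new D.name ts)}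

/-- The procedure Fold. -/
def Fold (OutCls : Set (Clause S)) (Defs : Set (Defn S)) (TransfCls : Set (Clause S)) : Prop :=
  (∀ C ∈ toBeFolded OutCls Defs, ∃ R ∈ TransfCls, FoldsTo (maxDefs Defs) C R) ∧
  ∀ R ∈ TransfCls, ∃ C ∈ toBeFolded OutCls Defs, FoldsTo (maxDefs Defs) C R

/-- The transformation algorithm: `TransfCls` is a possible output for the inputs `P` and `Cns`. -/
def Tcata (P : Set (Clause S)) (Cns : Set (Contract S)) (TransfCls : Set (Clause S)) : Prop :=
  ∃ (Defs : Set (Defn S)) (OutCls : Set (Clause S)),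
    Loop P Cns (Contract.goal '' Cns) ∅ (Contract.goal '' Cns) Defs OutCls ∧
    Fold OutCls Defs TransfCls

end TCata

namespace TCata

variable {S : Sig}

/-! ### Terms and substitutions -/

/-! The difficulty is circularity: contracts are applied to body atoms before they are known to be
valid. The circle is broken by induction on the derivation of program atoms, carried out as a
fixpoint argument.

Let `I` be a model of the output. Let `J` be the part of M(P) that contains all true catamorphism
atoms and those true program atoms `a` at which every maximal definition is sound for `I`
(`Defn.HoldsAt`) and every contract holds (`Contract.HoldsAt`). If `J` is a model of `P`, then M(P)
is contained in `J`, so all contracts are valid (`Tcata.valid`).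

To see that `J` is a model, take an instance of a clause of `P` whose body is true in `J` and whose
head is `a`. A ground instance of a maximal definition for `a` survives each operation: unfolding
with that very clause (`Unfold.ok`), application of contracts, which hold for the body atoms because
these lie in `J` (`ApplyTo.exists_valn`), and folding, since definitions are sound at the body atoms
(`FoldsTo.exists_head`). The folded clause is true in `I`, so the head of the definition is true in
`I`. With the definitions sound at `a`, a contract failing at `a` would make the body of its folded
goal true in `I`, which is impossible.

Two semantic facts make the manipulation of catamorphism atoms harmless: they denote total
(`cata_total`) and functional (`cata_functional`) relations. Totality allows atoms to be added,
provided that their outputs can be given values independently. This is the role of the invariant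
`BodyOK`: outputs are distinct variables occurring in no other atom. Its preservation by resolution
with an arbitrary most general unifier is reduced to explicit unifiers (`Matcher`), from which any
other differs by a renaming.

Basic sort follows because heads of definitions carry only basic variables, while folding replaces
the program atoms and drops the catamorphism atoms. -/

theorem Term.eval_subst (θ : Subst S) (v : Valn S) {s : S.Sort'} (t : Term S s) :
    (t.subst θ).eval v = t.eval (fun s n => (θ s n).eval v) := by
  induction t <;> simp_all [Term.subst, Term.eval]

theorem Term.subst_subst (θ η : Subst S) {s : S.Sort'} (t : Term S s) :
    (t.subst θ).subst η = t.subst (fun s n => (θ s n).subst η) := by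
  induction t <;> simp_all [Term.subst]

theorem Term.eval_congr {v w : Valn S} {s : S.Sort'} (t : Term S s)
    (h : ∀ x ∈ t.vars, v x.1 x.2 = w x.1 x.2) : t.eval v = t.eval w := by
  induction t <;> simp_all [Term.eval, Term.vars]
  rename_i ih
  funext i
  exact ih i fun a b hab => h a b i hab

theorem Term.subst_congr {θ η : Subst S} {s : S.Sort'} (t : Term S s)
    (h : ∀ x ∈ t.vars, θ x.1 x.2 = η x.1 x.2) : t.subst θ = t.subst η := by
  induction t <;> simp_all [Term.subst, Term.vars]
  rename_i ih
  funext i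
  exact ih i fun a b hab => h a b i hab

theorem Term.subst_var {s : S.Sort'} (t : Term S s) : t.subst (fun s n => .var s n) = t := by
  induction t <;> simp_all [Term.subst]

theorem Term.mem_vars_subst {θ : Subst S} {s : S.Sort'} (t : Term S s) {x : PVar S} :
    x ∈ (t.subst θ).vars ↔ ∃ y ∈ t.vars, x ∈ (θ y.1 y.2).vars := by
  induction t with
  | var s n => simp [Term.subst, Term.vars]
  | con k ts ih =>
    simp only [Term.subst, Term.vars, Set.mem_iUnion, ih]
    constructor
    · rintro ⟨i, y, hy, hx⟩; exact ⟨y, ⟨i, hy⟩, hx⟩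
    · rintro ⟨y, ⟨i, hy⟩, hx⟩; exact ⟨i, y, hy, hx⟩
  | _ => simp_all [Term.subst, Term.vars, or_and_right, exists_or]

theorem Term.finite_vars {s : S.Sort'} (t : Term S s) : t.vars.Finite := by
  induction t with
  | con k ts ih => exact Set.finite_iUnion ih
  | _ => simp_all [Term.vars]

/-- Only constructor terms can have ADT subterms, and they have ADT sort themselves. -/
theorem Term.isBasic_vars {s : S.Sort'} (t : Term S s) (hs : s.IsBasic) :
    ∀ x ∈ t.vars, x.1.IsBasic := by
  induction t with
  | con k ts ih => exact hs.elim
  | _ => simp_all [Term.vars, Srt.IsBasic]; try grind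

theorem Term.eq_var_of_subst {η : Subst S} {s : S.Sort'} (t : Term S s) {n : ℕ}
    (h : t.subst η = .var s n) : ∃ m, t = .var s m := by
  cases t <;> simp_all [Term.subst]

theorem Sat.congr {v w : Valn S} {c : Constr S} (h : ∀ x ∈ c.vars, v x.1 x.2 = w x.1 x.2)
    (hc : Sat v c) : Sat w c := by
  unfold Sat at *; rwa [← Term.eval_congr c h]

theorem sat_subst {θ : Subst S} {v : Valn S} {c : Constr S} :
    Sat v (c.subst θ) ↔ Sat (fun s n => (θ s n).eval v) c := by
  unfold Sat; rw [Term.eval_subst]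

theorem sat_and {v : Valn S} {c d : Constr S} : Sat v (.and c d) ↔ Sat v c ∧ Sat v d := by
  simp [Sat, Term.eval, Val.toBool]

theorem sat_neg {v : Valn S} {c : Constr S} : Sat v (.neg c) ↔ ¬ Sat v c := by
  simp [Sat, Term.eval, Val.toBool]

theorem sat_conj {v : Valn S} {cs : List (Constr S)} : Sat v (conj cs) ↔ ∀ c ∈ cs, Sat v c := by
  induction cs with
  | nil => simp [conj, Sat, Term.eval, Val.toBool]
  | cons c cs ih => simp [conj, sat_and, ih]

theorem mem_vars_conj {cs : List (Constr S)} {x : PVar S} :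
    x ∈ (conj cs).vars ↔ ∃ c ∈ cs, x ∈ c.vars := by
  induction cs with
  | nil => simp [conj, Term.vars]
  | cons c cs ih => simp [conj, Term.vars, ih]

/-! ### Lists of terms and atoms -/

theorem STerm.eval_subst (θ : Subst S) (v : Valn S) (t : STerm S) :
    (t.subst θ).eval v = t.eval (fun s n => (θ s n).eval v) := by
  simp [STerm.eval, STerm.subst, Term.eval_subst]

theorem STerm.subst_subst (θ η : Subst S) (t : STerm S) :
    (t.subst θ).subst η = t.subst (fun s n => (θ s n).subst η) := by
  simp [STerm.subst, Term.subst_subst]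

theorem STerm.eval_congr {v w : Valn S} (t : STerm S)
    (h : ∀ x ∈ t.2.vars, v x.1 x.2 = w x.1 x.2) : t.eval v = t.eval w := by
  simp [STerm.eval, Term.eval_congr t.2 h]

theorem STerm.subst_congr {θ η : Subst S} (t : STerm S)
    (h : ∀ x ∈ t.2.vars, θ x.1 x.2 = η x.1 x.2) : t.subst θ = t.subst η := by
  simp [STerm.subst, Term.subst_congr t.2 h]

@[simp] theorem STerm.subst_fst (θ : Subst S) (t : STerm S) : (t.subst θ).1 = t.1 := rfl

@[simp] theorem STerm.eval_fst (v : Valn S) (t : STerm S) : (t.eval v).1 = t.1 := rfl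

@[simp] theorem PVar.tm_fst (x : PVar S) : x.tm.1 = x.1 := rfl

@[simp] theorem PVar.vars_tm (x : PVar S) : x.tm.2.vars = {x} := rfl

@[simp] theorem PVar.eval_tm (v : Valn S) (x : PVar S) : x.tm.eval v = ⟨x.1, v x.1 x.2⟩ := rfl

@[simp] theorem PVar.subst_tm (θ : Subst S) (x : PVar S) : x.tm.subst θ = ⟨x.1, θ x.1 x.2⟩ := rfl

@[simp] theorem map_fst_subst (θ : Subst S) (l : List (STerm S)) :
    (l.map (STerm.subst θ)).map Sigma.fst = l.map Sigma.fst := by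
  simp [Function.comp_def]

@[simp] theorem map_fst_eval (v : Valn S) (l : List (STerm S)) :
    (l.map (STerm.eval v)).map Sigma.fst = l.map Sigma.fst := by
  simp [Function.comp_def]

@[simp] theorem map_fst_tm (l : List (PVar S)) :
    (l.map PVar.tm).map Sigma.fst = l.map Prod.fst := by
  simp [Function.comp_def]

theorem mem_listVars_subst {θ : Subst S} {l : List (STerm S)} {x : PVar S} :
    x ∈ listVars (l.map (STerm.subst θ)) ↔ ∃ y ∈ listVars l, x ∈ (θ y.1 y.2).vars := by
  simp only [listVars, List.mem_map, Set.mem_ofPred_eq]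
  constructor
  · rintro ⟨_, ⟨t, ht, rfl⟩, hx⟩
    obtain ⟨y, hy, hxy⟩ := (Term.mem_vars_subst t.2).1 hx
    exact ⟨y, ⟨t, ht, hy⟩, hxy⟩
  · rintro ⟨y, ⟨t, ht, hy⟩, hxy⟩
    exact ⟨_, ⟨t, ht, rfl⟩, (Term.mem_vars_subst t.2).2 ⟨y, hy, hxy⟩⟩

@[simp] theorem listVars_tm (l : List (PVar S)) : listVars (l.map PVar.tm) = {x | x ∈ l} := by
  ext x
  simp only [listVars, List.mem_map, Set.mem_ofPred_eq]
  constructor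
  · rintro ⟨_, ⟨y, hy, rfl⟩, hx⟩
    obtain rfl : x = y := hx
    exact hy
  · exact fun hx => ⟨_, ⟨x, hx, rfl⟩, rfl⟩

theorem listVars_append (l l' : List (STerm S)) :
    listVars (l ++ l') = listVars l ∪ listVars l' := by
  ext x; simp [listVars, or_and_right, exists_or]

theorem listVars_cons (t : STerm S) (l : List (STerm S)) :
    listVars (t :: l) = t.2.vars ∪ listVars l := by
  ext x; simp [listVars]

theorem finite_listVars (l : List (STerm S)) : (listVars l).Finite := by
  have : listVars l = ⋃ t ∈ {t | t ∈ l}, t.2.vars := by ext x; simp [listVars]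
  rw [this]
  exact (List.finite_toSet l).biUnion fun t _ => t.2.finite_vars

theorem map_eval_congr {v w : Valn S} {l : List (STerm S)}
    (h : ∀ x ∈ listVars l, v x.1 x.2 = w x.1 x.2) :
    l.map (STerm.eval v) = l.map (STerm.eval w) :=
  List.map_congr_left fun t ht => t.eval_congr fun x hx => h x ⟨t, ht, hx⟩

theorem map_subst_congr {θ η : Subst S} {l : List (STerm S)}
    (h : ∀ x ∈ listVars l, θ x.1 x.2 = η x.1 x.2) :
    l.map (STerm.subst θ) = l.map (STerm.subst η) :=
  List.map_congr_left fun t ht => t.subst_congr fun x hx => h x ⟨t, ht, hx⟩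

theorem Atom.args_subst (θ : Subst S) (A : Atom S) :
    (A.subst θ).args = A.args.map (STerm.subst θ) := by
  cases A <;> simp [Atom.subst, Atom.args]

theorem Atom.mem_vars_subst {θ : Subst S} (A : Atom S) {x : PVar S} :
    x ∈ (A.subst θ).vars ↔ ∃ y ∈ A.vars, x ∈ (θ y.1 y.2).vars := by
  rw [Atom.vars, Atom.args_subst, mem_listVars_subst]; rfl

theorem Atom.finite_vars (A : Atom S) : A.vars.Finite := finite_listVars _

theorem Atom.eval_subst (θ : Subst S) (v : Valn S) (A : Atom S) :
    (A.subst θ).eval v = A.eval (fun s n => (θ s n).eval v) := by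
  cases A <;> simp [Atom.subst, Atom.eval, STerm.eval_subst, Function.comp_def]

theorem Atom.subst_subst (θ η : Subst S) (A : Atom S) :
    (A.subst θ).subst η = A.subst (fun s n => (θ s n).subst η) := by
  cases A <;> simp [Atom.subst, STerm.subst_subst, Function.comp_def]

theorem Atom.eval_congr {v w : Valn S} (A : Atom S)
    (h : ∀ x ∈ A.vars, v x.1 x.2 = w x.1 x.2) : A.eval v = A.eval w := by
  have key : ∀ l : List (STerm S), l ⊆ A.args → l.map (STerm.eval v) = l.map (STerm.eval w) :=
    fun l hl => map_eval_congr fun x ⟨t, ht, hx⟩ => h x ⟨t, hl ht, hx⟩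
  cases A with
  | prog p ts => simpa [Atom.eval] using key ts fun t ht => ht
  | new n ts => simpa [Atom.eval] using key ts fun t ht => ht
  | cata f ps t os =>
    have h₁ := key ps (by simp [Atom.args])
    have h₂ := key [t] (by simp [Atom.args])
    have h₃ := key os (by intro t; simp +contextual [Atom.args])
    simp only [List.map_cons, List.map_nil, List.cons.injEq, and_true] at h₂
    simp only [Atom.eval, h₁, h₂, h₃]

theorem Atom.subst_congr {θ η : Subst S} (A : Atom S)
    (h : ∀ x ∈ A.vars, θ x.1 x.2 = η x.1 x.2) : A.subst θ = A.subst η := by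
  have key : ∀ l : List (STerm S), l ⊆ A.args → l.map (STerm.subst θ) = l.map (STerm.subst η) :=
    fun l hl => map_subst_congr fun x ⟨t, ht, hx⟩ => h x ⟨t, hl ht, hx⟩
  cases A with
  | prog p ts => simpa [Atom.subst] using key ts fun t ht => ht
  | new n ts => simpa [Atom.subst] using key ts fun t ht => ht
  | cata f ps t os =>
    have h₁ := key ps (by simp [Atom.args])
    have h₂ := key [t] (by simp [Atom.args])
    have h₃ := key os (by intro t; simp +contextual [Atom.args])
    simp only [List.map_cons, List.map_nil, List.cons.injEq, and_true] at h₂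
    simp only [Atom.subst, h₁, h₂, h₃]

theorem Atom.subst_var (A : Atom S) : A.subst (fun s n => .var s n) = A := by
  have h : STerm.subst (S := S) (fun s n => .var s n) = id := by
    funext t; simp [STerm.subst, Term.subst_var]
  cases A <;> simp [Atom.subst, h]

theorem Atom.subst_eq_self {θ : Subst S} (A : Atom S)
    (h : ∀ x ∈ A.vars, θ x.1 x.2 = .var x.1 x.2) : A.subst θ = A :=
  (A.subst_congr h).trans A.subst_var

theorem mem_bodyVars {G : List (Atom S)} {x : PVar S} : x ∈ bodyVars G ↔ ∃ A ∈ G, x ∈ A.vars :=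
  Iff.rfl

theorem Clause.finite_vars (C : Clause S) : C.vars.Finite := by
  have h₁ : headVars C.head = ⋃ A ∈ {A | A ∈ C.head}, A.vars := by ext x; simp [headVars]
  have h₂ : bodyVars C.body = ⋃ A ∈ {A | A ∈ C.body}, A.vars := by ext x; simp [bodyVars]
  refine (Set.Finite.union ?_ (Term.finite_vars _)).union ?_
  · rw [h₁]
    refine Set.Finite.biUnion ?_ fun A _ => A.finite_vars
    cases C.head <;> simp
  · rw [h₂]
    exact (List.finite_toSet C.body).biUnion fun A _ => A.finite_vars

/-! ### Assignment of a tuple -/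

/-- The update of a sorted family at distinct variables. -/
theorem exists_assign {T : S.Sort' → Type} (f : ∀ s, ℕ → T s) (xs : List (PVar S))
    (hxs : xs.Nodup) (ts : List (Σ s, T s)) (h : ts.map Sigma.fst = xs.map Prod.fst) :
    ∃ g : ∀ s, ℕ → T s, (∀ x : PVar S, x ∉ xs → g x.1 x.2 = f x.1 x.2) ∧
      xs.map (fun x => (⟨x.1, g x.1 x.2⟩ : Σ s, T s)) = ts := by
  classical
  induction xs generalizing ts with
  | nil =>
    refine ⟨f, fun _ _ => rfl, ?_⟩
    simpa using h.symm
  | cons x xs ih =>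
    match ts, h with
    | t :: ts, h =>
      simp only [List.map_cons, List.cons.injEq] at h
      obtain ⟨h₁, h₂⟩ := h
      rw [List.nodup_cons] at hxs
      obtain ⟨g, hg₁, hg₂⟩ := ih hxs.2 ts h₂
      refine ⟨fun s n => if e : (s, n) = x then (by rw [show s = t.1 from by rw [h₁, ← e]]; exact t.2)
        else g s n, ?_, ?_⟩
      · intro z hz
        simp only [List.mem_cons, not_or] at hz
        simp [hz.1, hg₁ z hz.2]
      · obtain ⟨s, n⟩ := x
        obtain ⟨s', t⟩ := t
        obtain rfl : s' = s := h₁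
        simp only [List.map_cons, List.cons.injEq]
        refine ⟨by simp, ?_⟩
        rw [← hg₂]
        refine List.map_congr_left fun z hz => ?_
        have : z ≠ (s', n) := fun e => hxs.1 (e ▸ hz)
        simp [this]

/-! ### The least model: inversion, and catamorphisms as total functions -/

theorem IsProgram.head_ne_none {P : Set (Clause S)} (hP : IsProgram P) :
    ∀ C ∈ P, C.head ≠ none := by
  intro C hC
  rcases hP.clauses C hC with ⟨⟨p, ts, h, _⟩, _⟩ | ⟨h, k, _, X, y, Res, calls, g, _, _, _, _, _, rfl⟩
  · simp [h]
  · simp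

/-- The set of one-step consequences of the least model is contained in it, hence is itself a model;
leastness gives the other inclusion. -/
theorem leastModel_inversion {P : Set (Clause S)} (hP : ∀ C ∈ P, C.head ≠ none) {a : GAtom S}
    (ha : a ∈ leastModel P) :
    ∃ C ∈ P, ∃ v : Valn S, ∃ A, C.head = some A ∧ A.eval v = a ∧ Sat v C.constr ∧
      ∀ B ∈ C.body, B.eval v ∈ leastModel P := by
  refine ha {a | ∃ C ∈ P, ∃ v : Valn S, ∃ A, C.head = some A ∧ A.eval v = a ∧ Sat v C.constr ∧
      ∀ B ∈ C.body, B.eval v ∈ leastModel P} ?_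
  intro C hC v hc hb
  rcases hh : C.head with _ | A
  · exact absurd hh (hP C hC)
  · refine ⟨A, rfl, C, hC, v, A, hh, rfl, hc, fun B hB => ?_⟩
    obtain ⟨C', hC', v', A', hA', e, hc', hb'⟩ := hb B hB
    obtain ⟨A'', hA'', hm⟩ := leastModel_isModel hP C' hC' v' hc' hb'
    rw [hA'] at hA''
    cases hA''
    exact e ▸ hm

/-- Valuations that make single atoms true on pairwise separated sets of variables `V F` can be
merged into one valuation. -/
theorem exists_merge (M : Set (GAtom S)) (l G : Set (Atom S)) (V : Atom S → Set (PVar S))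
    (w : Valn S) (hG : ∀ F ∈ l, F ∈ G → F.eval w ∈ M)
    (hV : ∀ F ∈ l, F ∉ G → ∀ y ∈ V F, ∀ F' ∈ l, y ∈ F'.vars → F' = F)
    (hu : ∀ F ∈ l, F ∉ G → ∃ u : Valn S, (∀ x : PVar S, x ∉ V F → u x.1 x.2 = w x.1 x.2) ∧
      F.eval u ∈ M) :
    ∃ w' : Valn S, (∀ x : PVar S, (∀ F ∈ l, F ∉ G → x ∉ V F) → w' x.1 x.2 = w x.1 x.2) ∧
      ∀ F ∈ l, F.eval w' ∈ M := by
  classical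
  have : Nonempty (Valn S) := ⟨w⟩
  choose! u hu₁ hu₂ using hu
  -- The atom chosen here matters only for variables that occur in some atom of `l`, and for these
  -- `hV` makes it unique.
  refine ⟨fun s n => if h : ∃ F ∈ l, F ∉ G ∧ (s, n) ∈ V F then u h.choose s n else w s n,
    fun x hx => ?_, fun F hF => ?_⟩
  · exact dif_neg fun ⟨F, h₁, h₂, h₃⟩ => hx F h₁ h₂ h₃
  · by_cases hFG : F ∈ G
    · convert hG F hF hFG using 1
      refine F.eval_congr fun x hx => dif_neg ?_
      rintro ⟨F', h₁, h₂, h₃⟩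
      exact h₂ (hV F' h₁ h₂ x h₃ F hF hx ▸ hFG)
    · convert hu₂ F hF hFG using 1
      refine F.eval_congr fun x hx => ?_
      by_cases h : ∃ F ∈ l, F ∉ G ∧ (x.1, x.2) ∈ V F
      · have hs := h.choose_spec
        have e : h.choose = F := (hV _ hs.1 hs.2.1 x hs.2.2 F hF hx).symm
        simp only [dif_pos h, e]
      · simp only [dif_neg h]
        exact (hu₁ F hF hFG x fun hxF => h ⟨F, hF, hFG, hxF⟩).symm

theorem mem_flatMap_unique {α β : Type*} {l : List α} {f : α → List β} (h : (l.flatMap f).Nodup)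
    {a b : α} (ha : a ∈ l) (hb : b ∈ l) {x : β} (hxa : x ∈ f a) (hxb : x ∈ f b) : a = b := by
  by_contra hne
  rw [List.nodup_flatMap] at h
  have : Std.Symm (Function.onFun List.Disjoint f) := ⟨fun _ _ hd => hd.symm⟩
  exact h.2.forall ha hb hne hxa hxb

theorem Call.mem_listVars {k : S.Con} {f : Call S k} {y : Fin (S.args k).length → ℕ} {x : PVar S} :
    x ∈ (Atom.cata f.fn (f.params.map PVar.tm) (PVar.tm ((S.args k).get f.idx, y f.idx))
      (f.outs.map PVar.tm)).vars ↔
      x ∈ f.params ∨ x = ((S.args k).get f.idx, y f.idx) ∨ x ∈ f.outs := by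
  simp only [Atom.vars, Atom.args, listVars_append, listVars_cons, listVars_tm, PVar.vars_tm]
  rfl

theorem map_tm_eval_eq_iff {v w : Valn S} {xs : List (PVar S)} :
    (xs.map PVar.tm).map (STerm.eval v) = (xs.map PVar.tm).map (STerm.eval w) ↔
      ∀ x ∈ xs, v x.1 x.2 = w x.1 x.2 := by
  simp

/-- The output arguments of a catamorphism atom. -/
def Atom.outs : Atom S → List (STerm S)
  | .cata _ _ _ outs => outs
  | _ => []

/-- The parameters and the ADT argument of a catamorphism atom. -/
def Atom.ins : Atom S → List (STerm S)
  | .cata _ params t _ => t :: params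
  | _ => []

theorem Atom.outs_subset_vars (F : Atom S) : listVars F.outs ⊆ F.vars := by
  cases F with
  | cata h ps t os =>
    simp only [Atom.vars, Atom.args, Atom.outs, listVars_append, listVars_cons]
    exact fun x hx => Or.inr (Or.inr hx)
  | _ => simp [Atom.outs, listVars]

theorem Atom.mem_vars_cata {F : Atom S} (hF : F.isCata = true) {x : PVar S} :
    x ∈ F.vars ↔ x ∈ listVars F.ins ∨ x ∈ listVars F.outs := by
  cases F with
  | cata h ps t os =>
    simp only [Atom.vars, Atom.args, Atom.outs, Atom.ins, listVars_append, listVars_cons,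
      Set.mem_union]
    tauto
  | _ => simp [Atom.isCata] at hF

/-- The atom of a call in the clause of a catamorphism. -/
def Call.atom {k : S.Con} (y : Fin (S.args k).length → ℕ) (f : Call S k) : Atom S :=
  .cata f.fn (f.params.map PVar.tm) (PVar.tm ((S.args k).get f.idx, y f.idx)) (f.outs.map PVar.tm)

/-- Completion of a valuation on the output variables of one catamorphism atom. -/
theorem exists_outs {M : Set (GAtom S)} (h : S.Cat) (ps : List (STerm S)) (t : STerm S)
    (ys : List (PVar S)) (w : Valn S) (hys : ys.Nodup)
    (hs : ys.map Prod.fst = (S.out h).map Srt.bas)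
    (hin : ∀ y ∈ ys, y ∉ listVars (t :: ps))
    (hM : ∃ os : List (SVal S), os.map Sigma.fst = (S.out h).map Srt.bas ∧
      GAtom.cata h (ps.map (STerm.eval w)) (t.eval w) os ∈ M) :
    ∃ u : Valn S, (∀ x : PVar S, x ∉ ys → u x.1 x.2 = w x.1 x.2) ∧
      (Atom.cata h ps t (ys.map PVar.tm)).eval u ∈ M := by
  obtain ⟨os, hos, hM⟩ := hM
  obtain ⟨u, hu, hu'⟩ := exists_assign w ys hys os (hos.trans hs.symm)
  refine ⟨u, hu, ?_⟩
  have e : (t :: ps).map (STerm.eval u) = (t :: ps).map (STerm.eval w) :=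
    map_eval_congr fun x hx => hu x fun hxy => hin x hxy hx
  simp only [List.map_cons, List.cons.injEq] at e
  simp only [Atom.eval, e.1, e.2, List.map_map]
  convert hM using 2
  exact hu'

/-- Catamorphisms are total. -/
theorem cata_total {P : Set (Clause S)} (hP : IsProgram P) (w : Valn S) {s : S.Sort'}
    (t : Val S s) :
    ∀ (h : S.Cat), s = .adt (S.dom h) → ∀ ps : List (SVal S),
      ps.map Sigma.fst = (S.par h).map Srt.bas → ∃ os : List (SVal S),
        os.map Sigma.fst = (S.out h).map Srt.bas ∧ GAtom.cata h ps ⟨s, t⟩ os ∈ leastModel P := by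
  -- Structural induction on the tree, for all catamorphisms at once, since a call may be to another
  -- catamorphism.
  induction t with
  | int z => intro h e; cases e
  | bool z => intro h e; cases e
  | con k vs ih =>
    intro h e ps hps
    obtain ⟨C, ⟨hCP, -, X, y, Res, calls, g, hX, hRes, hcalls, hnd, ⟨hg, -⟩, rfl⟩, -⟩ :=
      hP.catas h k (by injection e)
    set Y : List (PVar S) := List.ofFn (fun i => ((S.args k).get i, y i)) with hY
    simp only [List.nodup_append, List.mem_append] at hnd
    have hXY : (X ++ Y).Nodup := by
      rw [List.nodup_append]; exact ⟨hnd.1.1.1, hnd.1.1.2.1, hnd.1.1.2.2⟩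
    -- The valuation of the clause body is built in three stages: inputs (`v`), outputs of the calls
    -- by induction (`v₁`), and then a solution of the constraint `g` (`v₂`), which fixes `Res`.
    obtain ⟨v, -, hv⟩ := exists_assign w (X ++ Y) hXY
      (ps ++ List.ofFn fun i => (⟨(S.args k).get i, vs i⟩ : SVal S))
      (by simp [hps, hX, hY, Function.comp_def])
    rw [List.map_append] at hv
    obtain ⟨hvX, hvY⟩ := List.append_inj hv (by simpa using congrArg List.length (hX.trans hps.symm))
    have hvy : ∀ i, v ((S.args k).get i) (y i) = vs i := by
      intro i
      simp only [hY, List.map_ofFn] at hvY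
      simpa using congrFun (List.ofFn_injective hvY) i
    have hout : ∀ f ∈ calls, ∀ x ∈ f.outs, x ∉ X ∧ x ∉ Y ∧ x ∉ Res := by
      intro f hf x hx
      have hx' : x ∈ calls.flatMap Call.outs := List.mem_flatMap.2 ⟨f, hf, hx⟩
      exact ⟨fun h => hnd.2.2 x (.inl (.inl h)) x hx' rfl, fun h => hnd.2.2 x (.inl (.inr h)) x hx' rfl,
        fun h => hnd.2.2 x (.inr h) x hx' rfl⟩
    have hyY : ∀ i, ((S.args k).get i, y i) ∈ Y := fun i => by
      rw [hY, List.mem_ofFn]; exact ⟨i, rfl⟩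
    obtain ⟨v₁, hv₁, hcall⟩ := exists_merge (leastModel P) {F | ∃ f ∈ calls, F = f.atom y} ∅
      (fun F => listVars F.outs) v (by simp)
      (by
        rintro _ ⟨f, hf, rfl⟩ - x hx _ ⟨f', hf', rfl⟩ hx'
        simp only [Call.atom, Atom.outs, listVars_tm] at hx
        obtain ⟨h₁, h₂, -⟩ := hout f hf x hx
        rcases Call.mem_listVars.1 hx' with h | h | h
        · exact (h₁ ((hcalls f' hf').1 h)).elim
        · exact (h₂ (h ▸ hyY _)).elim
        · rw [mem_flatMap_unique hnd.2.1 hf' hf h hx])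
      (by
        rintro _ ⟨f, hf, rfl⟩ -
        have hc := hcalls f hf
        obtain ⟨u, hu₁, hu₂⟩ := exists_outs (M := leastModel P) f.fn (f.params.map PVar.tm)
          (PVar.tm ((S.args k).get f.idx, y f.idx)) f.outs v
          ((List.nodup_flatMap.1 hnd.2.1).1 f hf) hc.2.2.2
          (by
            intro x hx hx'
            rw [listVars_cons] at hx'
            obtain ⟨h₁, h₂, -⟩ := hout f hf x hx
            rcases hx' with h | h
            · obtain rfl : x = _ := h
              exact h₂ (hyY _)
            · exact h₁ (hc.1 (by simpa using h)))
          (by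
            obtain ⟨os, h₁, h₂⟩ := ih f.idx f.fn hc.2.2.1 ((f.params.map PVar.tm).map (STerm.eval v))
              (by rw [map_fst_eval, map_fst_tm, hc.2.1])
            refine ⟨os, h₁, ?_⟩
            rwa [PVar.eval_tm, hvy])
        exact ⟨u, fun x hx => hu₁ x fun hx' => hx (by simpa [Call.atom, Atom.outs] using hx'), hu₂⟩)
    have hv₁' : ∀ x ∈ X ++ Y, v₁ x.1 x.2 = v x.1 x.2 := by
      intro x hx
      refine hv₁ x ?_
      rintro _ ⟨f, hf, rfl⟩ - hx'
      simp only [Call.atom, Atom.outs, listVars_tm] at hx'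
      obtain ⟨h₁, h₂, -⟩ := hout f hf x hx'
      rcases List.mem_append.1 hx with h | h <;> contradiction
    obtain ⟨v₂, hv₂, hsat⟩ := hg v₁
    obtain ⟨_, ⟨⟩, hM⟩ := leastModel_isModel hP.head_ne_none _ hCP v₂ hsat (by
      intro B hB
      obtain ⟨f, hf, rfl⟩ := List.mem_map.1 hB
      convert hcall _ ⟨f, hf, rfl⟩ using 1
      refine Atom.eval_congr _ fun x hx => hv₂ x ?_
      simp only [List.mem_append, List.mem_flatMap]
      rcases Call.mem_listVars.1 hx with h | h | h
      · exact .inl (.inl ((hcalls f hf).1 h))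
      · exact .inl (.inr (h ▸ hyY _))
      · exact .inr ⟨f, hf, h⟩)
    refine ⟨(Res.map PVar.tm).map (STerm.eval v₂), by rw [map_fst_eval, map_fst_tm, hRes], ?_⟩
    have hXY₂ : ∀ x ∈ X ++ Y, v₂ x.1 x.2 = v x.1 x.2 := fun x hx =>
      (hv₂ x (List.mem_append_left _ hx)).trans (hv₁' x hx)
    have e₁ : (X.map PVar.tm).map (STerm.eval v₂) = ps := by
      rw [map_tm_eval_eq_iff.2 fun x hx => hXY₂ x (List.mem_append_left _ hx), List.map_map]
      exact hvX
    have e₂ : ∀ i, v₂ ((S.args k).get i) (y i) = vs i := fun i =>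
      (hXY₂ _ (List.mem_append_right _ (hyY i))).trans (hvy i)
    simp only [Atom.eval, e₁] at hM
    convert hM using 2
    simp only [STerm.eval, Term.eval, Sigma.mk.injEq, heq_eq_eq, true_and, Val.con.injEq]
    funext i
    exact (e₂ i).symm

/-- The outermost constructor of a value. -/
def Val.root : ∀ {s : S.Sort'}, Val S s → Option S.Con
  | _, .con k _ => some k
  | _, _ => none

/-- A ground catamorphism atom of the least model comes from the clause for the constructor
of its ADT argument. -/
theorem cata_inversion {P : Set (Clause S)} (hP : IsProgram P) {h : S.Cat} {ps os : List (SVal S)}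
    {t : SVal S} (ha : GAtom.cata h ps t os ∈ leastModel P) :
    ∃ k, ∃ C ∈ P, IsCataClause h k C ∧ ∃ v : Valn S, ∃ A, C.head = some A ∧
      A.eval v = GAtom.cata h ps t os ∧ Sat v C.constr ∧ ∀ B ∈ C.body, B.eval v ∈ leastModel P := by
  obtain ⟨C, hC, v, A, hA, hv, hsat, hb⟩ := leastModel_inversion hP.head_ne_none ha
  rcases hP.clauses C hC with ⟨⟨p, ts, hh, _⟩, _⟩ | ⟨h', k, hk⟩
  · rw [hh] at hA
    cases hA
    simp [Atom.eval] at hv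
  · have : h' = h := by
      obtain ⟨_, X, y, Res, calls, g, _, _, _, _, _, rfl⟩ := hk
      cases hA
      simp only [Atom.eval, GAtom.cata.injEq] at hv
      exact hv.1
    subst this
    exact ⟨k, C, hC, hk, v, A, hA, hv, hsat, hb⟩

/-- Catamorphisms are functional, and their outputs have the right sorts. -/
theorem cata_functional {P : Set (Clause S)} (hP : IsProgram P) {s : S.Sort'} (t : Val S s) :
    ∀ (h : S.Cat) (ps os os' : List (SVal S)), GAtom.cata h ps ⟨s, t⟩ os ∈ leastModel P →
      GAtom.cata h ps ⟨s, t⟩ os' ∈ leastModel P →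
      os = os' ∧ os.map Sigma.fst = (S.out h).map Srt.bas := by
  induction t with
  | int z =>
    intro h ps os os' h₁
    obtain ⟨k, _, _, ⟨_, X, y, Res, calls, g, _, _, _, _, _, rfl⟩, v, _, ⟨⟩, hv, _⟩ := cata_inversion hP h₁
    simp [Atom.eval, STerm.eval] at hv
  | bool z =>
    intro h ps os os' h₁
    obtain ⟨k, _, _, ⟨_, X, y, Res, calls, g, _, _, _, _, _, rfl⟩, v, _, ⟨⟩, hv, _⟩ := cata_inversion hP h₁
    simp [Atom.eval, STerm.eval] at hv
  | con k vs ih =>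
    intro h ps os os' h₁ h₂
    have key : ∀ {os : List (SVal S)}, GAtom.cata h ps ⟨_, .con k vs⟩ os ∈ leastModel P →
        ∃ C ∈ P, IsCataClause h k C ∧ ∃ v : Valn S, ∃ A, C.head = some A ∧
          A.eval v = GAtom.cata h ps ⟨_, .con k vs⟩ os ∧ Sat v C.constr ∧
          ∀ B ∈ C.body, B.eval v ∈ leastModel P := by
      intro os ha
      obtain ⟨k', C, hC, hk, H⟩ := cata_inversion hP ha
      have : k' = k := by
        obtain ⟨_, X, y, Res, calls, g, _, _, _, _, _, rfl⟩ := hk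
        obtain ⟨v, _, ⟨⟩, hv, _⟩ := H
        simp only [Atom.eval, GAtom.cata.injEq, STerm.eval, Term.eval] at hv
        have := hv.2.2.1
        have := congrArg (fun x : SVal S => x.2.root) this
        simpa [Val.root] using this
      subst this
      exact ⟨C, hC, hk, H⟩
    obtain ⟨C, hC, hk, v, A, hA, hv, hsat, hb⟩ := key h₁
    obtain ⟨C', hC', hk', v', A', hA', hv', hsat', hb'⟩ := key h₂
    -- There is only one clause per constructor, so both derivations use it, and the two valuations
    -- can be compared variable by variable.
    obtain rfl : C' = C := (hP.catas h k hk.1).unique ⟨hC', hk'⟩ ⟨hC, hk⟩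
    obtain ⟨_, X, y, Res, calls, g, hX, hRes, hcalls, hnd, ⟨-, hg⟩, rfl⟩ := hk
    cases hA
    cases hA'
    simp only [Atom.eval, GAtom.cata.injEq, STerm.eval, Term.eval, true_and] at hv hv'
    obtain ⟨hvX, hvy, rfl⟩ := hv
    obtain ⟨hvX', hvy', rfl⟩ := hv'
    simp only [Sigma.mk.injEq, heq_eq_eq, true_and, Val.con.injEq] at hvy hvy'
    have eX := map_tm_eval_eq_iff.1 (hvX.trans hvX'.symm)
    have ey : ∀ i, v ((S.args k).get i) (y i) = v' ((S.args k).get i) (y i) := fun i =>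
      (congrFun hvy i).trans (congrFun hvy' i).symm
    have eR : ∀ f ∈ calls, ∀ x ∈ f.outs, v x.1 x.2 = v' x.1 x.2 := by
      intro f hf
      have m := hb (f.atom y) (List.mem_map.2 ⟨f, hf, rfl⟩)
      have m' := hb' (f.atom y) (List.mem_map.2 ⟨f, hf, rfl⟩)
      simp only [Call.atom, Atom.eval, PVar.eval_tm] at m m'
      rw [show v ((S.args k).get f.idx) (y f.idx) = vs f.idx from congrFun hvy _] at m
      rw [show v' ((S.args k).get f.idx) (y f.idx) = vs f.idx from congrFun hvy' _,
        ← map_tm_eval_eq_iff.2 fun x hx => eX x ((hcalls f hf).1 hx)] at m'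
      exact map_tm_eval_eq_iff.1 (ih f.idx f.fn _ _ _ m m').1
    refine ⟨map_tm_eval_eq_iff.2 (hg v v' ?_ hsat hsat'), by rw [map_fst_eval, map_fst_tm, hRes]⟩
    intro x hx
    simp only [List.mem_append, List.mem_ofFn, List.mem_flatMap] at hx
    rcases hx with (hx | ⟨i, rfl⟩) | ⟨f, hf, hx⟩
    · exact eX x hx
    · exact ey i
    · exact eR f hf x hx

/-- Two catamorphism atoms of the least model with the same inputs satisfy the equality constraint
of their outputs. -/
theorem sat_eqTuple {v : Valn S} {bs : List BSort} {Y Z : List (STerm S)}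
    (hs : Y.map Sigma.fst = bs.map Srt.bas)
    (h : Y.map (STerm.eval v) = Z.map (STerm.eval v)) : Sat v (eqTuple Y Z) := by
  induction bs generalizing Y Z with
  | nil =>
    simp only [List.map_nil, List.map_eq_nil_iff] at hs
    subst hs
    simp only [List.map_nil, List.nil_eq, List.map_eq_nil_iff] at h
    subst h
    rfl
  | cons b bs ih =>
    match Y, Z, hs, h with
    | [], _, hs, _ => simp at hs
    | _ :: _, [], _, h => simp at h
    | ⟨s, t⟩ :: Y, ⟨s', t'⟩ :: Z, hs, h =>
      simp only [List.map_cons, List.cons.injEq, STerm.eval, Sigma.mk.injEq] at hs h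
      obtain ⟨rfl, hs⟩ := hs
      obtain ⟨⟨rfl, e⟩, h⟩ := h
      simp only [heq_eq_eq] at e
      rw [eqTuple, sat_and]
      refine ⟨?_, ih hs h⟩
      cases b <;> simp [eqTerm, Sat, Term.eval, Val.toBool, e]

/-! ### Well-formed bodies and their renaming -/

/-- Program atoms have distinct variables as arguments; catamorphism atoms are well sorted, and
their outputs are distinct variables that are not among their inputs. -/
def Atom.WF : Atom S → Prop
  | .prog p ts => ∃ xs : List (PVar S), ts = xs.map PVar.tm ∧ xs.Nodup ∧
      xs.map Prod.fst = S.arity p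
  | .cata h params t outs => params.map Sigma.fst = (S.par h).map Srt.bas ∧
      t.1 = .adt (S.dom h) ∧ ∃ ys : List (PVar S), outs = ys.map PVar.tm ∧ ys.Nodup ∧
        ys.map Prod.fst = (S.out h).map Srt.bas ∧ ∀ y ∈ ys, y ∉ listVars (t :: params)
  | .new _ _ => False

/-- A set of well-formed atoms in which an output variable of a catamorphism atom occurs in no
other atom. -/
structure BodyOK (G : Set (Atom S)) : Prop where
  wf : ∀ A ∈ G, A.WF
  sep : ∀ F ∈ G, ∀ y ∈ listVars F.outs, ∀ A ∈ G, y ∈ A.vars → A = F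

theorem BodyOK.mono {G G' : Set (Atom S)} (h : BodyOK G) (hG : G' ⊆ G) : BodyOK G' :=
  ⟨fun A hA => h.wf A (hG hA), fun F hF y hy A hA => h.sep F (hG hF) y hy A (hG hA)⟩

/-- `θ` renames the variables in `W` injectively. -/
structure RenOn (θ : Subst S) (W : Set (PVar S)) : Prop where
  var : ∀ x ∈ W, ∃ n, θ x.1 x.2 = .var x.1 n
  inj : ∀ x ∈ W, ∀ x' ∈ W, ∀ z ∈ (θ x.1 x.2).vars, z ∈ (θ x'.1 x'.2).vars → x = x'

theorem Ren.app_injective (ρ : Ren S) : Function.Injective ρ.app := by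
  rintro ⟨s, n⟩ ⟨s', n'⟩ h
  simp only [Ren.app, Prod.mk.injEq] at h
  obtain ⟨rfl, h⟩ := h
  rw [(ρ s).injective h]

theorem Ren.vars_subst (ρ : Ren S) (x : PVar S) : (ρ.subst x.1 x.2).vars = {ρ.app x} := rfl

theorem Ren.renOn (ρ : Ren S) (W : Set (PVar S)) : RenOn ρ.subst W where
  var x _ := ⟨_, rfl⟩
  inj x _ x' _ z hz hz' := by
    rw [Ren.vars_subst, Set.mem_singleton_iff] at hz hz'
    exact ρ.app_injective (hz.symm.trans hz')

theorem Ren.map_subst_tm (ρ : Ren S) (xs : List (PVar S)) :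
    (xs.map PVar.tm).map (STerm.subst ρ.subst) = (xs.map ρ.app).map PVar.tm := by
  simp only [List.map_map]
  rfl

theorem RenOn.map_tm {θ : Subst S} {W : Set (PVar S)} (h : RenOn θ W) {xs : List (PVar S)}
    (hx : xs.Nodup) (hW : ∀ x ∈ xs, x ∈ W) :
    ∃ xs' : List (PVar S), (xs.map PVar.tm).map (STerm.subst θ) = xs'.map PVar.tm ∧ xs'.Nodup ∧
      xs'.map Prod.fst = xs.map Prod.fst ∧ ∀ z ∈ xs', ∃ x ∈ xs, z ∈ (θ x.1 x.2).vars := by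
  choose! r hr using h.var
  refine ⟨xs.map fun x => (x.1, r x), ?_, ?_, by simp, ?_⟩
  · simp only [List.map_map]
    refine List.map_congr_left fun x hx => ?_
    simp [PVar.tm, STerm.subst, Term.subst, hr x (hW x hx)]
  · refine List.Nodup.map_on (fun x hx x' hx' e => h.inj x (hW x hx) x' (hW x' hx') (x.1, r x) ?_ ?_) hx
    · rw [hr x (hW x hx)]; rfl
    · rw [hr x' (hW x' hx'), e]; rfl
  · intro z hz
    obtain ⟨x, hx, rfl⟩ := List.mem_map.1 hz
    exact ⟨x, hx, by rw [hr x (hW x hx)]; rfl⟩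

theorem Atom.outs_subst (θ : Subst S) (F : Atom S) :
    (F.subst θ).outs = F.outs.map (STerm.subst θ) := by
  cases F <;> rfl

theorem Atom.WF.ren {A : Atom S} (hA : A.WF) {θ : Subst S} {W : Set (PVar S)} (hW : A.vars ⊆ W)
    (h : RenOn θ W) : (A.subst θ).WF := by
  cases A with
  | new n ts => exact hA.elim
  | prog p ts =>
    obtain ⟨xs, rfl, hn, hs⟩ := hA
    obtain ⟨xs', e, hn', hs', -⟩ := h.map_tm hn fun x hx => hW (by
      simpa [Atom.vars, Atom.args] using hx)
    exact ⟨xs', e, hn', hs'.trans hs⟩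
  | cata f ps t os =>
    obtain ⟨hp, ht, ys, rfl, hn, hs, hd⟩ := hA
    have hv : ∀ x, x ∈ listVars (t :: ps) ∨ x ∈ ys → x ∈ W := fun x hx => hW (by
      rw [Atom.mem_vars_cata rfl]
      simpa [Atom.ins, Atom.outs] using hx)
    obtain ⟨ys', e, hn', hs', hy⟩ := h.map_tm hn fun x hx => hv x (.inr hx)
    refine ⟨by rw [map_fst_subst, hp], ht, ys', e, hn', hs'.trans hs, fun z hz hz' => ?_⟩
    rw [← List.map_cons, mem_listVars_subst] at hz'
    obtain ⟨y, hyy, hzy⟩ := hy z hz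
    obtain ⟨x, hx, hzx⟩ := hz'
    exact hd y hyy (h.inj y (hv y (.inr hyy)) x (hv x (.inl hx)) z hzy hzx ▸ hx)

/-- By injectivity, a variable shared by two renamed atoms comes from a variable shared by the
original ones. -/
theorem BodyOK.ren {G : Set (Atom S)} (hG : BodyOK G) {θ : Subst S} {W : Set (PVar S)}
    (hW : ∀ A ∈ G, A.vars ⊆ W) (h : RenOn θ W) : BodyOK (Atom.subst θ '' G) := by
  constructor
  · rintro _ ⟨A, hA, rfl⟩
    exact (hG.wf A hA).ren (hW A hA) h
  · rintro _ ⟨F, hF, rfl⟩ z hz _ ⟨A, hA, rfl⟩ hz'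
    rw [Atom.outs_subst, mem_listVars_subst] at hz
    rw [Atom.mem_vars_subst] at hz'
    obtain ⟨y, hy, hzy⟩ := hz
    obtain ⟨x, hx, hzx⟩ := hz'
    obtain rfl := h.inj y (hW F hF (F.outs_subset_vars hy)) x (hW A hA hx) z hzy hzx
    rw [hG.sep F hF y hy A hA hx]

/-- Completion of a valuation on the outputs of the catamorphism atoms that are not yet true. -/
theorem exists_extension {P : Set (Clause S)} (hP : IsProgram P) (l G : Set (Atom S)) (w : Valn S)
    (hc : ∀ F ∈ l, F.isCata = true)
    (hG : ∀ F ∈ l, F ∈ G → F.eval w ∈ leastModel P)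
    (hwf : ∀ F ∈ l, F ∉ G → F.WF)
    (hsep : ∀ F ∈ l, F ∉ G → ∀ y ∈ listVars F.outs, ∀ F' ∈ l, y ∈ F'.vars → F' = F) :
    ∃ w' : Valn S,
      (∀ x : PVar S, (∀ F ∈ l, F ∉ G → x ∉ listVars F.outs) → w' x.1 x.2 = w x.1 x.2) ∧
      ∀ F ∈ l, F.eval w' ∈ leastModel P := by
  refine exists_merge _ l G (fun F => listVars F.outs) w hG hsep fun F hF hFG => ?_
  have hF' := hwf F hF hFG
  have hc' := hc F hF
  cases F with
  | cata h ps t os =>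
    obtain ⟨hp, ht, ys, rfl, hn, hs, hd⟩ := hF'
    obtain ⟨u, hu, hu'⟩ := exists_outs (M := leastModel P) h ps t ys w hn hs hd
      (cata_total hP w (t.eval w).2 h ht _ (by rw [map_fst_eval, hp]))
    exact ⟨u, fun x hx => hu x (by simpa [Atom.outs] using hx), hu'⟩
  | _ => simp [Atom.isCata] at hc'

/-! ### Unification against atoms with distinct variables -/

/-- `τ` is a most general unifier of `A` and `B` that instantiates only the variables `zs`, by terms
in which these do not occur. -/
structure Matcher (τ : Subst S) (zs : List (PVar S)) (A B : Atom S) : Prop where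
  off : ∀ x : PVar S, x ∉ zs → τ x.1 x.2 = .var x.1 x.2
  unif : A.subst τ = B.subst τ
  mg : ∀ σ : Subst S, A.subst σ = B.subst σ → ∀ s n, σ s n = (τ s n).subst σ
  eval : ∀ v : Valn S, A.eval v = B.eval v → ∀ s n, (τ s n).eval v = v s n
  fresh : ∀ x : PVar S, ∀ z ∈ (τ x.1 x.2).vars, z ∉ zs

/-- Unification amounts to solving the equations `zs = ts`. As no `zs` occurs in `ts`, these are
already in solved form, and the substitution of `ts` for `zs` is an idempotent most general unifier.
`hev` is the same reduction for values. -/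
theorem exists_matcher {A B : Atom S} {zs : List (PVar S)} {ts : List (STerm S)} (hz : zs.Nodup)
    (hs : ts.map Sigma.fst = zs.map Prod.fst) (hd : ∀ z ∈ zs, z ∉ listVars ts)
    (hsub : ∀ σ : Subst S, A.subst σ = B.subst σ ↔
      (zs.map PVar.tm).map (STerm.subst σ) = ts.map (STerm.subst σ))
    (hev : ∀ v : Valn S, A.eval v = B.eval v →
      (zs.map PVar.tm).map (STerm.eval v) = ts.map (STerm.eval v)) :
    ∃ τ : Subst S, Matcher τ zs A B ∧ (zs.map PVar.tm).map (STerm.subst τ) = ts := by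
  obtain ⟨τ, hτ, hτ'⟩ := exists_assign (fun s n => Term.var s n) zs hz ts hs
  have hts : (zs.map PVar.tm).map (STerm.subst τ) = ts := by
    rw [← hτ', List.map_map]; rfl
  have hfix : ts.map (STerm.subst τ) = ts := by
    conv_rhs => rw [← List.map_id ts]
    refine List.map_congr_left fun t ht => ?_
    rw [STerm.subst_congr (η := fun s n => .var s n) t fun x hx => hτ x fun hxz => hd x hxz ⟨t, ht, hx⟩]
    simp [STerm.subst, Term.subst_var]
  refine ⟨τ, ⟨hτ, (hsub τ).2 (hts.trans hfix.symm), fun σ hσ s n => ?_, fun v hv s n => ?_,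
    fun x z hz => ?_⟩, hts⟩
  · by_cases h : (s, n) ∈ zs
    · have e := (hsub σ).1 hσ
      rw [← hts] at e
      simp only [List.map_map] at e
      have := List.map_inj_left.1 e _ h
      simpa [STerm.subst, PVar.tm, Term.subst] using this
    · rw [hτ (s, n) h]; rfl
  · by_cases h : (s, n) ∈ zs
    · have e := hev v hv
      rw [← hts] at e
      simp only [List.map_map] at e
      have := List.map_inj_left.1 e _ h
      simpa [STerm.eval, PVar.tm, Term.eval, STerm.subst, Term.subst] using this.symm
    · rw [hτ (s, n) h]; rfl
  · by_cases h : x ∈ zs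
    · intro hzz
      refine hd z hzz ⟨⟨x.1, τ x.1 x.2⟩, ?_, hz⟩
      rw [← hτ']
      exact List.mem_map.2 ⟨x, h, rfl⟩
    · rw [hτ x h] at hz
      obtain rfl : z = x := hz
      exact h

theorem exists_matcher_prog {p : S.Prog} {xs : List (PVar S)} {ts : List (STerm S)} (hx : xs.Nodup)
    (hs : ts.map Sigma.fst = xs.map Prod.fst) (hd : ∀ z ∈ xs, z ∉ listVars ts) :
    ∃ τ : Subst S, Matcher τ xs (.prog p (xs.map PVar.tm)) (.prog p ts) := by
  obtain ⟨τ, h, -⟩ := exists_matcher (A := .prog p (xs.map PVar.tm)) (B := .prog p ts) hx hs hd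
    (fun σ => by simp [Atom.subst]) (fun v => by simp [Atom.eval])
  exact ⟨τ, h⟩

theorem exists_matcher_cata {h : S.Cat} {k : S.Con} {X Res : List (PVar S)}
    {y : Fin (S.args k).length → ℕ} {ps os : List (STerm S)}
    {args : ∀ i : Fin (S.args k).length, Term S ((S.args k).get i)}
    (hn : (X ++ List.ofFn (fun i => (((S.args k).get i, y i) : PVar S)) ++ Res).Nodup)
    (hX : ps.map Sigma.fst = X.map Prod.fst) (hRes : os.map Sigma.fst = Res.map Prod.fst)
    (hd : ∀ z ∈ X ++ List.ofFn (fun i => (((S.args k).get i, y i) : PVar S)) ++ Res,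
      z ∉ (Atom.cata h ps ⟨_, .con k args⟩ os).vars) :
    ∃ τ : Subst S,
      Matcher τ (X ++ List.ofFn (fun i => (((S.args k).get i, y i) : PVar S)) ++ Res)
        (.cata h ps ⟨_, .con k args⟩ os)
        (.cata h (X.map PVar.tm) ⟨_, .con k fun i => .var _ (y i)⟩ (Res.map PVar.tm)) ∧
      (X.map PVar.tm).map (STerm.subst τ) = ps ∧ (∀ i, τ _ (y i) = args i) ∧
      (Res.map PVar.tm).map (STerm.subst τ) = os := by
  have hlX : X.length = ps.length := by simpa using (congrArg List.length hX).symm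
  have hlR : Res.length = os.length := by simpa using (congrArg List.length hRes).symm
  -- Lets the equations for parameters, constructor arguments and outputs be treated as the equality
  -- of one concatenated tuple.
  have split : ∀ {β : Type} (a a' : List β) (b b' : Fin (S.args k).length → β) (c c' : List β),
      a.length = a'.length → (a ++ List.ofFn b ++ c = a' ++ List.ofFn b' ++ c' ↔
        a = a' ∧ b = b' ∧ c = c') := by
    intro β a a' b b' c c' hl
    constructor
    · intro e
      obtain ⟨e₁, e₂⟩ := List.append_inj e (by simp [hl])
      obtain ⟨e₃, e₄⟩ := List.append_inj e₁ hl
      exact ⟨e₃, List.ofFn_injective e₄, e₂⟩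
    · rintro ⟨rfl, rfl, rfl⟩; rfl
  obtain ⟨τ, hτ, e⟩ := exists_matcher (A := .cata h ps ⟨_, .con k args⟩ os)
    (B := .cata h (X.map PVar.tm) ⟨_, .con k fun i => .var _ (y i)⟩ (Res.map PVar.tm))
    (ts := ps ++ List.ofFn (fun i => (⟨_, args i⟩ : STerm S)) ++ os) hn
    (by simp [hX, hRes, Function.comp_def, List.map_ofFn])
    (by
      rintro z hz ⟨t, ht, hzt⟩
      refine hd z hz ?_
      simp only [List.mem_append, List.mem_ofFn] at ht
      rcases ht with (ht | ⟨i, rfl⟩) | ht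
      · exact ⟨t, by simp [Atom.args, ht], hzt⟩
      · exact ⟨⟨_, .con k args⟩, by simp [Atom.args], Set.mem_iUnion.2 ⟨i, hzt⟩⟩
      · exact ⟨t, by simp [Atom.args, ht], hzt⟩)
    (fun σ => by
      simp only [List.map_append, List.map_ofFn]
      rw [split _ _ _ _ _ _ (by simp [hlX])]
      simp only [Atom.subst, Atom.cata.injEq, STerm.subst, Term.subst, true_and,
        Sigma.mk.injEq, heq_eq_eq, Term.con.injEq, funext_iff, Function.comp, PVar.tm]
      constructor
      · rintro ⟨h₁, h₂, h₃⟩; exact ⟨h₁.symm, fun i => (h₂ i).symm, h₃.symm⟩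
      · rintro ⟨h₁, h₂, h₃⟩; exact ⟨h₁.symm, fun i => (h₂ i).symm, h₃.symm⟩)
    (fun v => by
      simp only [List.map_append, List.map_ofFn]
      rw [split _ _ _ _ _ _ (by simp [hlX])]
      simp only [Atom.eval, GAtom.cata.injEq, STerm.eval, Term.eval, true_and,
        Sigma.mk.injEq, heq_eq_eq, Val.con.injEq, funext_iff, Function.comp, PVar.tm]
      rintro ⟨h₁, h₂, h₃⟩; exact ⟨h₁.symm, fun i => (h₂ i).symm, h₃.symm⟩)
  simp only [List.map_append, List.map_ofFn] at e
  rw [split _ _ _ _ _ _ (by simp [hlX])] at e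
  refine ⟨τ, hτ, e.1, fun i => ?_, e.2.2⟩
  have := congrFun e.2.1 i
  simpa [PVar.tm, STerm.subst, Term.subst] using this

theorem Matcher.isMGU {τ : Subst S} {zs : List (PVar S)} {A B : Atom S} (h : Matcher τ zs A B) :
    IsMGU τ A B :=
  ⟨h.unif, fun σ hσ => ⟨σ, h.mg σ hσ⟩⟩

/-- `τ` factors through any most general unifier `θ` and fixes the variables outside `zs`. Hence `θ`
must send these to variables, and to distinct ones, since the remaining factor recovers them. -/
theorem Matcher.renOn {τ θ : Subst S} {zs : List (PVar S)} {A B : Atom S} (h : Matcher τ zs A B)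
    (hθ : IsMGU θ A B) : RenOn θ {x | x ∉ zs} := by
  obtain ⟨η, hη⟩ := hθ.2 τ h.unif
  have key : ∀ x : PVar S, x ∉ zs → Term.var x.1 x.2 = (θ x.1 x.2).subst η := fun x hx => by
    rw [← hη, h.off x hx]
  have hvar : ∀ x : PVar S, x ∉ zs → ∃ n, θ x.1 x.2 = .var x.1 n := fun x hx =>
    Term.eq_var_of_subst _ (key x hx).symm
  refine ⟨hvar, ?_⟩
  rintro ⟨s, n⟩ hx ⟨s', n'⟩ hx' z hz hz'
  obtain ⟨m, hm⟩ := hvar _ hx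
  obtain ⟨m', hm'⟩ := hvar _ hx'
  have e := key _ hx
  have e' := key _ hx'
  rw [hm] at e hz
  rw [hm'] at e' hz'
  obtain rfl : z = (s, m) := hz
  have hz' : (s, m) = (s', m') := hz'
  simp only [Prod.mk.injEq] at hz'
  obtain ⟨rfl, rfl⟩ := hz'
  have := e.trans e'.symm
  simp only [Term.var.injEq] at this
  simp [this]

theorem Matcher.exists_valn {τ θ : Subst S} {zs : List (PVar S)} {A B : Atom S}
    (h : Matcher τ zs A B) (hθ : IsMGU θ A B) {v : Valn S} (hv : A.eval v = B.eval v) :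
    ∃ u : Valn S, ∀ s n, (θ s n).eval u = v s n := by
  obtain ⟨η, hη⟩ := hθ.2 τ h.unif
  -- `τ` is `θ` followed by `η`, and evaluating `τ` under `v` gives back `v`; so `η` evaluated under
  -- `v` is the required valuation.
  refine ⟨fun s n => (η s n).eval v, fun s n => ?_⟩
  rw [← Term.eval_subst, ← hη, h.eval v hv]

/-- The body of a resolvent is a renaming of the one given by the matcher. -/
theorem Matcher.bodyOK {τ θ : Subst S} {zs : List (PVar S)} {A B : Atom S} (h : Matcher τ zs A B)
    (hθ : IsMGU θ A B) {G : List (Atom S)} (hG : BodyOK {F | ∃ F' ∈ G, F = F'.subst τ}) :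
    BodyOK {F | F ∈ G.map (Atom.subst θ)} := by
  refine (hG.ren (θ := θ) (W := {x | x ∉ zs}) ?_ (h.renOn hθ)).mono ?_
  · rintro _ ⟨F, hF, rfl⟩ x hx
    obtain ⟨y, _, hxy⟩ := (Atom.mem_vars_subst F).1 hx
    exact h.fresh y x hxy
  · intro F hF
    obtain ⟨F', hF', rfl⟩ := List.mem_map.1 hF
    refine ⟨_, ⟨F', hF', rfl⟩, ?_⟩
    rw [Atom.subst_subst]
    -- Every unifier `θ` equals `τ` followed by `θ`, so an atom instantiated by `θ` is the renaming
    -- by `θ` of its instance by `τ`.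
    exact congrArg (fun σ => Atom.subst σ F') (by funext s n; exact (h.mg θ hθ.1 s n).symm)

/-! ### Renaming apart -/

theorem Clause.mem_vars_subst {θ : Subst S} (C : Clause S) {x : PVar S} :
    x ∈ (C.subst θ).vars ↔ ∃ y ∈ C.vars, x ∈ (θ y.1 y.2).vars := by
  have h₁ : x ∈ headVars (C.head.map (Atom.subst θ)) ↔
      ∃ y ∈ headVars C.head, x ∈ (θ y.1 y.2).vars := by
    cases C.head with
    | none => simp [headVars]
    | some A => simp [headVars, Atom.mem_vars_subst]
  have h₂ : x ∈ bodyVars (C.body.map (Atom.subst θ)) ↔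
      ∃ y ∈ bodyVars C.body, x ∈ (θ y.1 y.2).vars := by
    simp only [mem_bodyVars, List.mem_map]
    constructor
    · rintro ⟨_, ⟨A, hA, rfl⟩, hx⟩
      obtain ⟨y, hy, hxy⟩ := (Atom.mem_vars_subst A).1 hx
      exact ⟨y, ⟨A, hA, hy⟩, hxy⟩
    · rintro ⟨y, ⟨A, hA, hy⟩, hxy⟩
      exact ⟨_, ⟨A, hA, rfl⟩, (Atom.mem_vars_subst A).2 ⟨y, hy, hxy⟩⟩
  simp only [Clause.vars, Clause.subst, Set.mem_union, h₁, h₂, Term.mem_vars_subst, or_and_right,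
    exists_or]

theorem Clause.mem_vars_of_mem_body {C : Clause S} {A : Atom S} (hA : A ∈ C.body) {x : PVar S}
    (hx : x ∈ A.vars) : x ∈ C.vars :=
  .inr ⟨A, hA, hx⟩

theorem exists_fresh_ren {V W : Set (PVar S)} (hV : V.Finite) (hW : W.Finite) :
    ∃ ρ : Ren S, ∀ x ∈ W, ρ.app x ∉ V := by
  obtain ⟨N, hN⟩ := ((hV.union hW).image Prod.snd).bddAbove
  have hN' : ∀ x ∈ V ∪ W, x.2 ≤ N := fun x hx => hN ⟨x, hx, rfl⟩
  -- The involution exchanging the blocks `[0, N]` and `[N+1, 2N+1]`, where `N` bounds all indices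
  -- in `V` and `W`.
  let f : ℕ → ℕ := fun n => if n ≤ N then n + (N + 1) else if n ≤ 2 * N + 1 then n - (N + 1) else n
  have hf : Function.Involutive f := by
    intro n
    simp only [f]
    split_ifs <;> omega
  refine ⟨fun _ => hf.toPerm, fun x hx hx' => ?_⟩
  have h₁ := hN' x (.inr hx)
  have h₂ : f x.2 ≤ N := hN' _ (.inl hx')
  simp only [f, if_pos h₁] at h₂
  omega

/-- Valuations of the variables of a clause and of a renamed-apart one can be combined. -/
theorem exists_combined_valn {V : Set (PVar S)} {K : Clause S} {ρ : Ren S}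
    (hd : Disjoint V (K.subst ρ.subst).vars) (v w : Valn S) :
    ∃ u : Valn S, (∀ x ∈ V, u x.1 x.2 = v x.1 x.2) ∧
      ∀ x ∈ K.vars, (ρ.subst x.1 x.2).eval u = w x.1 x.2 := by
  classical
  refine ⟨fun s n => if (s, n) ∈ V then v s n else w s ((ρ s).symm n), fun x hx => if_pos hx,
    fun x hx => ?_⟩
  have : ρ.app x ∉ V := fun h => Set.disjoint_left.1 hd h (K.mem_vars_subst.2 ⟨x, hx, rfl⟩)
  have h' : (x.1, ρ x.1 x.2) ∉ V := this
  simp [Ren.subst, Term.eval, h']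

/-! ### Unfolding -/

/-- Completeness of unfolding: a ground instance of the unfolded clause whose atom `A` is derived
by means of the clause `K` is an instance of a resolvent. -/
theorem IsUnf.exists_instance {P : Set (Clause S)} {H : Option (Atom S)} {c : Constr S}
    {L M : List (Atom S)} {A : Atom S} {Rs : Set (Clause S)} (hU : IsUnf P H c L A M Rs)
    {K : Clause S} (hK : K ∈ P) {v w : Valn S} (hv : Sat v c) (hw : Sat w K.constr) {B₀ : Atom S}
    (hB₀ : K.head = some B₀) (he : B₀.eval w = A.eval v)
    (hm : ∀ (ρ : Ren S) (B : Atom S),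
      Disjoint (Clause.vars ⟨H, c, L ++ A :: M⟩) (K.subst ρ.subst).vars →
      (K.subst ρ.subst).head = some B → ∃ τ zs, Matcher τ zs A B) :
    ∃ R ∈ Rs, ∃ u : Valn S, R.head.map (Atom.eval u) = H.map (Atom.eval v) ∧ Sat u R.constr ∧
      ∀ F ∈ R.body, (∃ F' ∈ L ++ M, F.eval u = F'.eval v) ∨ ∃ F' ∈ K.body, F.eval u = F'.eval w := by
  -- The renaming is kept arbitrary because it is used twice: for the resolvent built below, and for
  -- the one that `Rs` happens to contain.
  have comb : ∀ ρ : Ren S, Disjoint (Clause.vars ⟨H, c, L ++ A :: M⟩) (K.subst ρ.subst).vars →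
      ∃ u : Valn S, (∀ X : Atom S, X.vars ⊆ Clause.vars ⟨H, c, L ++ A :: M⟩ → X.eval u = X.eval v) ∧
        (∀ X : Atom S, X.vars ⊆ K.vars → (X.subst ρ.subst).eval u = X.eval w) ∧
        Sat u (.and c (K.constr.subst ρ.subst)) ∧ A.eval u = (B₀.subst ρ.subst).eval u := by
    intro ρ hd
    obtain ⟨u, hu, hu'⟩ := exists_combined_valn hd v w
    have h₁ : ∀ X : Atom S, X.vars ⊆ Clause.vars ⟨H, c, L ++ A :: M⟩ → X.eval u = X.eval v :=
      fun X hX => X.eval_congr fun x hx => hu x (hX hx)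
    have h₂ : ∀ X : Atom S, X.vars ⊆ K.vars → (X.subst ρ.subst).eval u = X.eval w :=
      fun X hX => by rw [Atom.eval_subst]; exact X.eval_congr fun x hx => hu' x (hX hx)
    refine ⟨u, h₁, h₂, sat_and.2 ⟨?_, ?_⟩, ?_⟩
    · exact hv.congr fun x hx => (hu x (.inl (.inr hx))).symm
    · rw [sat_subst]
      exact hw.congr fun x hx => (hu' x (.inl (.inr hx))).symm
    · rw [h₁ A fun x hx => Clause.mem_vars_of_mem_body (by simp) hx, h₂ B₀, he]
      exact fun x hx => .inl (.inl ⟨B₀, hB₀, hx⟩)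
  -- `IsUnf` promises a resolvent in `Rs` only if one exists at all. A fresh renaming with the
  -- matcher as unifier yields one, and the given ground instance shows that its constraint is
  -- satisfiable.
  have hex : ∃ R, Resolvent H c L A M K R := by
    obtain ⟨ρ, hρ⟩ := exists_fresh_ren (Clause.finite_vars ⟨H, c, L ++ A :: M⟩) K.finite_vars
    have hd : Disjoint (Clause.vars ⟨H, c, L ++ A :: M⟩) (K.subst ρ.subst).vars := by
      rw [Set.disjoint_right]
      intro x hx
      obtain ⟨y, hy, rfl⟩ := K.mem_vars_subst.1 hx
      exact hρ y hy
    have hh : (K.subst ρ.subst).head = some (B₀.subst ρ.subst) := by simp [Clause.subst, hB₀]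
    obtain ⟨τ, zs, hτ⟩ := hm ρ _ hd hh
    obtain ⟨u, -, -, hsat, hu⟩ := comb ρ hd
    obtain ⟨u', hu'⟩ := hτ.exists_valn hτ.isMGU hu
    refine ⟨_, ρ, _, τ, hd, hh, hτ.isMGU, ⟨u', ?_⟩, rfl⟩
    rw [sat_subst]
    simp only [hu']
    exact hsat
  -- The member of `Rs` may come from another renaming and another unifier, so the valuation is
  -- rebuilt for these.
  obtain ⟨R, hR, ρ, B, θ, hd, hh, hθ, -, rfl⟩ := hU.2 K hK hex
  obtain ⟨τ, zs, hτ⟩ := hm ρ B hd hh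
  obtain ⟨u, h₁, h₂, hsat, hu⟩ := comb ρ hd
  obtain rfl : B = B₀.subst ρ.subst := by simpa [Clause.subst, hB₀] using hh.symm
  obtain ⟨u', hu'⟩ := hτ.exists_valn hθ hu
  have key : ∀ X : Atom S, (X.subst θ).eval u' = X.eval u := fun X => by
    rw [Atom.eval_subst]; simp only [hu']
  refine ⟨_, hR, u', ?_, ?_, ?_⟩
  · cases H with
    | none => rfl
    | some X =>
      simp only [Clause.subst, Option.map_some, key, Option.some.injEq]
      exact h₁ X fun x hx => .inl (.inl ⟨X, rfl, hx⟩)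
  · simp only [Clause.subst]
    rw [sat_subst]
    simp only [hu']
    exact hsat
  · intro F hF
    simp only [Clause.subst, List.mem_map, List.mem_append] at hF
    obtain ⟨F, hF, rfl⟩ := hF
    rw [key]
    rcases hF with (hF | ⟨F, hF, rfl⟩) | hF
    · exact .inl ⟨F, by simp [hF], h₁ F fun x hx => Clause.mem_vars_of_mem_body (by simp [hF]) hx⟩
    · exact .inr ⟨F, hF, h₂ F fun x hx => Clause.mem_vars_of_mem_body hF hx⟩
    · exact .inl ⟨F, by simp [hF], h₁ F fun x hx => Clause.mem_vars_of_mem_body (by simp [hF]) hx⟩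

/-! ### Clauses of catamorphisms, up to renaming -/

/-- The syntactic form of the clause of the catamorphism `h` for the constructor `k`. -/
structure CataShape (h : S.Cat) (k : S.Con) (X : List (PVar S)) (y : Fin (S.args k).length → ℕ)
    (Res : List (PVar S)) (calls : List (Call S k)) (C : Clause S) : Prop where
  sortX : X.map Prod.fst = (S.par h).map Srt.bas
  sortRes : Res.map Prod.fst = (S.out h).map Srt.bas
  call : ∀ f ∈ calls, f.params ⊆ X ∧ f.params.map Prod.fst = (S.par f.fn).map Srt.bas ∧
      (S.args k).get f.idx = .adt (S.dom f.fn) ∧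
      f.outs.map Prod.fst = (S.out f.fn).map Srt.bas
  nodup : (X ++ List.ofFn (fun i => ((S.args k).get i, y i)) ++ Res ++
      calls.flatMap Call.outs).Nodup
  head : C.head = some (.cata h (X.map PVar.tm) ⟨.adt (S.res k), .con k (fun i => .var _ (y i))⟩
          (Res.map PVar.tm))
  body : C.body = calls.map (Call.atom y)

def Call.rename {k : S.Con} (ρ : Ren S) (f : Call S k) : Call S k :=
  ⟨f.fn, f.params.map ρ.app, f.idx, f.outs.map ρ.app⟩

/-- The condition that the constraint defines a function is dropped: unfolding needs only the
syntax, for which stability under renaming is immediate. -/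
theorem IsCataClause.shape {h : S.Cat} {k : S.Con} {C : Clause S} (hC : IsCataClause h k C) :
    ∃ X y Res calls, CataShape h k X y Res calls C := by
  obtain ⟨_, X, y, Res, calls, g, h₁, h₂, h₃, h₄, _, rfl⟩ := hC
  exact ⟨X, y, Res, calls, h₁, h₂, h₃, h₄, rfl, rfl⟩

theorem CataShape.rename {h : S.Cat} {k : S.Con} {X : List (PVar S)}
    {y : Fin (S.args k).length → ℕ} {Res : List (PVar S)} {calls : List (Call S k)} {C : Clause S}
    (hC : CataShape h k X y Res calls C) (ρ : Ren S) :
    CataShape h k (X.map ρ.app) (fun i => ρ ((S.args k).get i) (y i)) (Res.map ρ.app)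
      (calls.map (Call.rename ρ)) (C.subst ρ.subst) := by
  have hs : ∀ l : List (PVar S), (l.map ρ.app).map Prod.fst = l.map Prod.fst := fun l => by
    rw [List.map_map]; rfl
  refine ⟨(hs _).trans hC.sortX, (hs _).trans hC.sortRes, ?_, ?_, ?_, ?_⟩
  · intro _ hfm
    obtain ⟨f, hf, rfl⟩ := List.mem_map.1 hfm
    obtain ⟨h₁, h₂, h₃, h₄⟩ := hC.call f hf
    exact ⟨List.map_subset _ h₁, (hs _).trans h₂, h₃, (hs _).trans h₄⟩
  · have := hC.nodup.map ρ.app_injective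
    simp only [List.map_append, List.map_ofFn, List.map_flatMap] at this
    rw [List.flatMap_map]
    exact this
  · simp only [Clause.subst, hC.head, Option.map_some, Atom.subst, Ren.map_subst_tm]
    rfl
  · simp only [Clause.subst, hC.body, List.map_map]
    refine List.map_congr_left fun f _ => ?_
    simp only [Function.comp, Call.atom, Atom.subst, Ren.map_subst_tm]
    rfl

/-! ### Invariants of unfolding -/

/-- All arguments in the head have basic sort. -/
def Clause.HeadBasic (C : Clause S) : Prop := ∀ A ∈ C.head, ∀ t ∈ A.args, t.1.IsBasic

/-- The invariant of the clauses that are derived from definitions. -/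
structure Clause.OK (C : Clause S) : Prop where
  body : BodyOK {A | A ∈ C.body}
  head : C.HeadBasic

theorem Clause.HeadBasic.subst {C : Clause S} (h : C.HeadBasic) (θ : Subst S) :
    (C.subst θ).HeadBasic := by
  intro A hA t ht
  obtain ⟨A', hA', rfl⟩ := Option.map_eq_some_iff.1 hA
  rw [Atom.args_subst] at ht
  obtain ⟨t', ht', rfl⟩ := List.mem_map.1 ht
  exact h A' hA' t' ht'

theorem headBasic_congr {H : Option (Atom S)} {c d : Constr S} {G G' : List (Atom S)}
    (h : Clause.HeadBasic ⟨H, c, G⟩) : Clause.HeadBasic ⟨H, d, G'⟩ := h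

/-- `Cls` has a clause with an instance whose head is `g` and whose body is true in `J`. -/
def Covers (J : Set (GAtom S)) (Cls : Set (Clause S)) (g : GAtom S) : Prop :=
  ∃ C ∈ Cls, ∃ v : Valn S, C.head.map (Atom.eval v) = some g ∧ Sat v C.constr ∧
    ∀ A ∈ C.body, A.eval v ∈ J

theorem Call.mem_vars_atom {k : S.Con} {f : Call S k} {y : Fin (S.args k).length → ℕ} {x : PVar S} :
    x ∈ (f.atom y).vars ↔ x ∈ f.params ∨ x = ((S.args k).get f.idx, y f.idx) ∨ x ∈ f.outs :=
  Call.mem_listVars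

/-! #### Program atoms -/

/-- The program atom has distinct variables as arguments, so it is matched by binding these to the
arguments of the renamed head; the variables of the program clause stay untouched. -/
theorem matcher_prog {P : Set (Clause S)} (hP : IsProgram P) {K : Clause S} (hK : K ∈ P)
    {p : S.Prog} {xs : List (PVar S)} (hx : xs.Nodup) (hs : xs.map Prod.fst = S.arity p)
    {V : Set (PVar S)} (hV : ∀ x ∈ xs, x ∈ V) {ρ : Ren S} (hd : Disjoint V (K.subst ρ.subst).vars)
    {ts₀ : List (STerm S)} (hh : K.head = some (.prog p ts₀)) {B : Atom S}
    (hB : (K.subst ρ.subst).head = some B) :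
    IsProgClause K ∧ ∃ τ, Matcher τ xs (.prog p (xs.map PVar.tm)) B := by
  rcases hP.clauses K hK with hK | ⟨h, k, hk⟩
  · refine ⟨hK, ?_⟩
    obtain ⟨⟨p', ts, hh', hts⟩, -⟩ := hK
    rw [hh] at hh'
    cases hh'
    obtain rfl : B = .prog p (ts₀.map (STerm.subst ρ.subst)) := by
      simpa [Clause.subst, hh, Atom.subst] using hB.symm
    refine exists_matcher_prog hx (by rw [map_fst_subst, hts, hs]) fun z hz hz' => ?_
    exact Set.disjoint_left.1 hd (hV z hz) (.inl (.inl ⟨_, hB, hz'⟩))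
  · obtain ⟨X, y, Res, calls, hk⟩ := hk.shape
    rw [hk.head] at hh
    cases hh

/-- Only the arguments of the program atom are instantiated, by terms over fresh variables.
Separation keeps outputs of catamorphism atoms away from those arguments, so outputs remain distinct
variables, while inputs may become constructor terms. -/
theorem resolvent_prog_ok {P : Set (Clause S)} (hP : IsProgram P) {H : Option (Atom S)}
    {c : Constr S} {A : Atom S} {M : List (Atom S)} (hC : Clause.OK ⟨H, c, A :: M⟩)
    (hA : A.isProg = true) (hM : ∀ F ∈ M, F.isCata = true) {K R : Clause S} (hK : K ∈ P)
    (hR : Resolvent H c [] A M K R) : R.OK := by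
  cases A with
  | prog p ts =>
    obtain ⟨xs, rfl, hx, hs⟩ := hC.body.wf (.prog p ts) (by simp)
    obtain ⟨ρ, B, θ, hd, hB, hθ, -, rfl⟩ := hR
    have hV : ∀ x ∈ xs, x ∈ Clause.vars ⟨H, c, [] ++ Atom.prog p (xs.map PVar.tm) :: M⟩ := fun x hx =>
      Clause.mem_vars_of_mem_body (A := .prog p (xs.map PVar.tm)) (by simp)
        (by simpa [Atom.vars, Atom.args] using hx)
    obtain ⟨ts₀, hh⟩ : ∃ ts₀, K.head = some (.prog p ts₀) := by
      simp only [Clause.subst, Option.map_eq_some_iff] at hB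
      obtain ⟨B₀, hB₀, rfl⟩ := hB
      have := hθ.1
      cases B₀ with
      | prog p' ts' =>
        simp only [Atom.subst, Atom.prog.injEq] at this
        exact ⟨ts', by rw [hB₀, this.1]⟩
      | _ => simp [Atom.subst] at this
    obtain ⟨hKP, τ, hτ⟩ := matcher_prog hP hK hx hs hV hd hh hB
    refine ⟨?_, Clause.HeadBasic.subst (C := ⟨H, _, _⟩) (headBasic_congr hC.head) θ⟩
    refine hτ.bodyOK hθ ?_
    have hKb : ∀ F ∈ (K.subst ρ.subst).body, F.WF ∧ F.isProg = true ∧ F.subst τ = F := by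
      intro F hF
      have hτF : F.subst τ = F := F.subst_eq_self fun x hxF => hτ.off x fun hxx =>
        Set.disjoint_left.1 hd (hV x hxx) (Clause.mem_vars_of_mem_body hF hxF)
      obtain ⟨F₀, hF₀, rfl⟩ := List.mem_map.1 hF
      obtain ⟨q, zs, rfl, hz, hzs⟩ := hKP.2 F₀ hF₀
      have hwf : (Atom.prog q (zs.map PVar.tm)).WF := ⟨zs, rfl, hz, hzs⟩
      exact ⟨hwf.ren (Set.subset_univ _) (ρ.renOn _), rfl, hτF⟩
    have hMv : ∀ F ∈ M, ∀ x ∈ F.vars, x ∉ (K.subst ρ.subst).vars := fun F hF x hxF =>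
      Set.disjoint_left.1 hd (Clause.mem_vars_of_mem_body (by simp [hF]) hxF)
    -- output variables are not instantiated
    have hout : ∀ F ∈ M, ∀ y ∈ listVars F.outs, y ∉ xs := by
      intro F hF y hy hyx
      have := hC.body.sep F (by simp [hF]) y hy (.prog p (xs.map PVar.tm)) (by simp)
        (by simpa [Atom.vars, Atom.args] using hyx)
      have hF' := hM F hF
      rw [← this] at hF'
      simp [Atom.isCata] at hF'
    -- What replaces the arguments of the program atom comes from the renamed head, hence contains
    -- no variable of the unfolded clause.
    have hinst : ∀ z ∈ xs, ∀ y ∈ (τ z.1 z.2).vars, y ∈ (K.subst ρ.subst).vars := by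
      intro z hz y hy
      have e := hτ.unif
      obtain rfl : B = .prog p (ts₀.map (STerm.subst ρ.subst)) := by
        simpa [Clause.subst, hh, Atom.subst] using hB.symm
      have hy' : y ∈ ((Atom.prog p (xs.map PVar.tm)).subst τ).vars :=
        (Atom.mem_vars_subst _).2 ⟨z, by simpa [Atom.vars, Atom.args] using hz, hy⟩
      rw [e, Atom.subst_eq_self (θ := τ) _ fun x hxB => hτ.off x fun hxx =>
        Set.disjoint_left.1 hd (hV x hxx) (.inl (.inl ⟨_, hB, hxB⟩))] at hy'
      exact .inl (.inl ⟨_, hB, hy'⟩)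
    have hMvar : ∀ F ∈ M, ∀ y, y ∉ (K.subst ρ.subst).vars → y ∈ (F.subst τ).vars → y ∈ F.vars := by
      intro F hF y hyK hy
      obtain ⟨z, hz, hyz⟩ := (Atom.mem_vars_subst F).1 hy
      by_cases hzx : z ∈ xs
      · exact (hyK (hinst z hzx y hyz)).elim
      · rw [hτ.off z hzx] at hyz
        obtain rfl : y = z := hyz
        exact hz
    have houts : ∀ F ∈ M, (F.subst τ).outs = F.outs := by
      intro F hF
      rw [Atom.outs_subst]
      conv_rhs => rw [← List.map_id F.outs]
      refine List.map_congr_left fun t ht => ?_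
      rw [STerm.subst_congr (η := fun s n => .var s n) t fun x hx =>
        hτ.off x (hout F hF x ⟨t, ht, hx⟩)]
      simp [STerm.subst, Term.subst_var]
    constructor
    · rintro _ ⟨F, hF, rfl⟩
      simp only [List.nil_append, List.mem_append] at hF
      rcases hF with hF | hF
      · rw [(hKb F hF).2.2]; exact (hKb F hF).1
      · have hwf := hC.body.wf F (by simp [hF])
        have ho := houts F hF
        have hov := hMv F hF
        have hlv := hout F hF
        have hc := hM F hF
        have hins : ∀ y ∈ listVars F.outs, y ∉ listVars (F.subst τ).ins := by
          intro y hy hyi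
          have e : (F.subst τ).ins = F.ins.map (STerm.subst τ) := by cases F <;> rfl
          rw [e, mem_listVars_subst] at hyi
          obtain ⟨z, hz, hyz⟩ := hyi
          by_cases hzx : z ∈ xs
          · exact hov y (F.outs_subset_vars hy) (hinst z hzx y hyz)
          · rw [hτ.off z hzx] at hyz
            obtain rfl : y = z := hyz
            cases F with
            | cata h ps t os =>
              obtain ⟨_, _, ys, rfl, _, _, hd⟩ := hwf
              exact hd y (by simpa [Atom.outs] using hy) hz
            | _ => simp [Atom.isCata] at hc
        cases F with
        | cata h ps t os =>
          obtain ⟨h₁, h₂, ys, rfl, h₃, h₄, -⟩ := hwf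
          refine ⟨by rw [map_fst_subst, h₁], h₂, ys, ho, h₃, h₄, fun y hy => ?_⟩
          exact hins y (by simpa [Atom.outs] using hy)
        | _ => simp [Atom.isCata] at hc
    · rintro _ ⟨F, hF, rfl⟩ y hy _ ⟨F', hF', rfl⟩ hy'
      simp only [List.nil_append, List.mem_append] at hF hF'
      rcases hF with hF | hF
      · obtain ⟨-, h₁, h₂⟩ := hKb F hF
        rw [h₂] at hy
        cases F <;> simp [Atom.isProg, Atom.outs, listVars] at h₁ hy
      · rw [houts F hF] at hy
        have hyv := F.outs_subset_vars hy
        rcases hF' with hF' | hF'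
        · rw [(hKb F' hF').2.2] at hy'
          exact (hMv F hF y hyv (Clause.mem_vars_of_mem_body hF' hy')).elim
        · rw [hC.body.sep F (by simp [hF]) y hy F' (by simp [hF'])
            (hMvar F' hF' y (hMv F hF y hyv) hy')]
  | _ => simp [Atom.isProg] at hA

theorem covers_unfold_prog {P : Set (Clause S)} (hP : IsProgram P) {J : Set (GAtom S)}
    {H : Option (Atom S)} {c : Constr S} {p : S.Prog} {xs : List (PVar S)} {M : List (Atom S)}
    (hx : xs.Nodup) (hs : xs.map Prod.fst = S.arity p) {Rs : Set (Clause S)}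
    (hU : IsUnf P H c [] (.prog p (xs.map PVar.tm)) M Rs)
    {v : Valn S} (hv : Sat v c) (hM : ∀ F ∈ M, F.eval v ∈ J) {K : Clause S} (hK : K ∈ P)
    {w : Valn S} (hw : Sat w K.constr) (hb : ∀ F ∈ K.body, F.eval w ∈ J) {B₀ : Atom S}
    (hB₀ : K.head = some B₀) (he : B₀.eval w = (Atom.prog p (xs.map PVar.tm)).eval v)
    {g : GAtom S} (hg : H.map (Atom.eval v) = some g) : Covers J Rs g := by
  obtain ⟨ts₀, rfl⟩ : ∃ ts₀, B₀ = .prog p ts₀ := by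
    cases B₀ with
    | prog p' ts' =>
      simp only [Atom.eval, GAtom.prog.injEq] at he
      exact ⟨ts', by rw [he.1]⟩
    | _ => simp [Atom.eval] at he
  obtain ⟨R, hR, u, h₁, h₂, h₃⟩ := hU.exists_instance hK hv hw hB₀ he (by
    intro ρ B hd hB
    obtain ⟨-, τ, hτ⟩ := matcher_prog hP hK hx hs (fun x hx =>
      Clause.mem_vars_of_mem_body (A := .prog p (xs.map PVar.tm)) (by simp)
        (by simpa [Atom.vars, Atom.args] using hx)) hd hB₀ hB
    exact ⟨τ, xs, hτ⟩)
  refine ⟨R, hR, u, h₁.trans hg, h₂, fun F hF => ?_⟩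
  rcases h₃ F hF with ⟨F', hF', e⟩ | ⟨F', hF', e⟩
  · rw [e]; exact hM F' (by simpa using hF')
  · rw [e]; exact hb F' hF'

/-! #### Catamorphism atoms -/

/-- The outermost constructor of a term. -/
def Term.root : ∀ {s : S.Sort'}, Term S s → Option S.Con
  | _, .con k _ => some k
  | _, _ => none

theorem Term.exists_con_of_adt {a : S.Adt} (t : Term S (.adt a)) (ht : ∀ n, t ≠ .var _ n) :
    ∃ k args, S.res k = a ∧ (⟨_, t⟩ : STerm S) = ⟨_, .con k args⟩ := by
  cases t with
  | var _ n => exact (ht n rfl).elim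
  | con k ts => exact ⟨k, ts, rfl, rfl⟩

theorem STerm.exists_con {a : S.Adt} {t : STerm S} (hs : t.1 = .adt a)
    (ht : ¬ ∃ x : PVar S, t = x.tm) : ∃ k args, t = ⟨_, .con k args⟩ := by
  obtain ⟨s, t⟩ := t
  obtain rfl : s = .adt a := hs
  obtain ⟨k, args, _, e⟩ := t.exists_con_of_adt fun n hn => ht ⟨(_, n), by rw [hn]; rfl⟩
  exact ⟨k, args, e⟩

/-- In contrast with program atoms, here the head variables of the catamorphism clause are bound to
the arguments of the unfolded atom, and the variables of the unfolded clause are kept. -/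
theorem matcher_cata {h : S.Cat} {k : S.Con} {X Res : List (PVar S)}
    {y : Fin (S.args k).length → ℕ} {calls : List (Call S k)} {K : Clause S}
    (hK : CataShape h k X y Res calls K) {ps : List (STerm S)} {ys : List (PVar S)}
    {args : ∀ i : Fin (S.args k).length, Term S ((S.args k).get i)}
    (hp : ps.map Sigma.fst = (S.par h).map Srt.bas) (hys : ys.map Prod.fst = (S.out h).map Srt.bas)
    (hd : Disjoint (Atom.cata h ps ⟨_, .con k args⟩ (ys.map PVar.tm)).vars K.vars)
    {B : Atom S} (hB : K.head = some B) :
    ∃ τ, Matcher τ (X ++ List.ofFn (fun i => (((S.args k).get i, y i) : PVar S)) ++ Res)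
        (.cata h ps ⟨_, .con k args⟩ (ys.map PVar.tm)) B ∧
      (X.map PVar.tm).map (STerm.subst τ) = ps ∧ (∀ i, τ _ (y i) = args i) ∧
      ∀ z ∈ X ++ List.ofFn (fun i => (((S.args k).get i, y i) : PVar S)) ++ Res, z ∈ K.vars := by
  have hz : ∀ z ∈ X ++ List.ofFn (fun i => (((S.args k).get i, y i) : PVar S)) ++ Res,
      z ∈ K.vars := by
    intro z hz
    refine .inl (.inl ⟨_, hK.head, ?_⟩)
    simp only [List.mem_append, List.mem_ofFn] at hz
    rw [Atom.mem_vars_cata rfl]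
    simp only [Atom.ins, Atom.outs, listVars_cons, listVars_tm, Term.vars]
    rcases hz with (hz | ⟨i, rfl⟩) | hz
    · exact .inl (.inr hz)
    · exact .inl (.inl (Set.mem_iUnion.2 ⟨i, rfl⟩))
    · exact .inr hz
  obtain rfl : B = _ := Option.some.inj (hB.symm.trans hK.head)
  obtain ⟨τ, hτ, h₁, h₂, -⟩ := exists_matcher_cata (h := h) (ps := ps) (args := args)
    (os := ys.map PVar.tm) (List.nodup_append.1 hK.nodup).1 (hp.trans hK.sortX.symm)
    (by rw [map_fst_tm, hys, hK.sortRes]) fun z hz' hzA => Set.disjoint_left.1 hd hzA (hz z hz')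
  exact ⟨τ, hτ, h₁, h₂, hz⟩

/-- The other body atoms do not change. In the new calls the outputs are fresh, and every variable
of the inputs already occurs in the inputs of the unfolded atom. -/
theorem resolvent_cata_ok {P : Set (Clause S)} (hP : IsProgram P) {H : Option (Atom S)}
    {c : Constr S} {h : S.Cat} {ps : List (STerm S)} {t : STerm S} {os : List (STerm S)}
    {L M : List (Atom S)} (hC : Clause.OK ⟨H, c, L ++ .cata h ps t os :: M⟩)
    (ht : ¬ ∃ x : PVar S, t = x.tm) {K R : Clause S} (hK : K ∈ P)
    (hR : Resolvent H c L (.cata h ps t os) M K R) : R.OK := by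
  obtain ⟨hp, hts, ys, rfl, hys, hyss, hyi⟩ := hC.body.wf (.cata h ps t os) (by simp)
  obtain ⟨k, args, rfl⟩ := STerm.exists_con hts ht
  obtain ⟨ρ, B, θ, hd, hB, hθ, -, rfl⟩ := hR
  -- Unifiability of the heads forces `K` to be a clause for `h` and for the constructor `k` of the
  -- ADT argument.
  obtain ⟨X₀, y₀, Res₀, calls₀, hK₀⟩ : ∃ X y Res calls, CataShape h k X y Res calls K := by
    rcases hP.clauses K hK with hK | ⟨h', k', hk⟩
    · obtain ⟨⟨p', ts, hh', -⟩, -⟩ := hK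
      simp only [Clause.subst, hh', Option.map_some, Option.some.injEq] at hB
      have := hθ.1
      simp [← hB, Atom.subst] at this
    · obtain ⟨X, y, Res, calls, hk⟩ := hk.shape
      simp only [Clause.subst, hk.head, Option.map_some, Option.some.injEq] at hB
      have := hθ.1
      simp only [← hB, Atom.subst, Atom.cata.injEq, STerm.subst, Term.subst] at this
      obtain ⟨rfl, -, this, -⟩ := this
      have : k = k' := by
        have := congrArg (fun x : STerm S => x.2.root) this
        simpa [Term.root] using this
      subst this
      exact ⟨X, y, Res, calls, hk⟩
  have hK' := hK₀.rename ρ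
  set K' := K.subst ρ.subst with hKdef
  set X := X₀.map ρ.app
  set Res := Res₀.map ρ.app
  set calls := calls₀.map (Call.rename ρ)
  set A : Atom S := .cata h ps ⟨_, .con k args⟩ (ys.map PVar.tm) with hA
  obtain ⟨τ, hτ, hτX, hτy, hz⟩ := matcher_cata (args := args) hK' hp hyss
    (hd.mono_left fun x hx => Clause.mem_vars_of_mem_body (by simp [hA]) hx) hB
  set y : Fin (S.args k).length → ℕ := fun i => ρ _ (y₀ i)
  refine ⟨?_, Clause.HeadBasic.subst (C := ⟨H, _, _⟩) (headBasic_congr hC.head) θ⟩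
  refine hτ.bodyOK hθ ?_
  have hLM : ∀ F, F ∈ L ∨ F ∈ M → F ∈ {F | F ∈ L ++ A :: M} ∧ F.subst τ = F ∧
      ∀ x ∈ F.vars, x ∉ K'.vars := by
    intro F hF
    have hF' : F ∈ L ++ A :: M := by
      simp only [List.mem_append, List.mem_cons]; tauto
    have hv : ∀ x ∈ F.vars, x ∉ K'.vars := fun x hx =>
      Set.disjoint_left.1 hd (Clause.mem_vars_of_mem_body hF' hx)
    exact ⟨hF', F.subst_eq_self fun x hx => hτ.off x fun hxz => hv x hx (hz x hxz), hv⟩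
  have hAv : ∀ x ∈ listVars A.ins, x ∉ K'.vars := fun x hx =>
    Set.disjoint_left.1 hd (Clause.mem_vars_of_mem_body (A := A) (by simp)
      ((Atom.mem_vars_cata rfl).2 (.inl hx)))
  have hnd := List.nodup_append.1 hK'.nodup
  have hcall : ∀ f ∈ calls, (∀ x ∈ f.outs, x ∈ K'.vars) ∧
      (f.atom y).subst τ = .cata f.fn ((f.params.map PVar.tm).map (STerm.subst τ))
        ⟨(S.args k).get f.idx, args f.idx⟩ (f.outs.map PVar.tm) ∧
      ∀ x ∈ listVars ((f.atom y).subst τ).ins, x ∈ listVars A.ins := by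
    intro f hf
    have e : (f.atom y).subst τ = .cata f.fn ((f.params.map PVar.tm).map (STerm.subst τ))
        ⟨(S.args k).get f.idx, args f.idx⟩ (f.outs.map PVar.tm) := by
      simp only [Call.atom, Atom.subst, PVar.subst_tm, Atom.cata.injEq, true_and]
      refine ⟨by rw [hτy], ?_⟩
      rw [List.map_map]
      refine List.map_congr_left fun x hx => ?_
      have : x ∉ X ++ List.ofFn (fun i => (((S.args k).get i, y i) : PVar S)) ++ Res := fun hx' =>
        hnd.2.2 x hx' x (List.mem_flatMap.2 ⟨f, hf, hx⟩) rfl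
      simp only [Function.comp, PVar.subst_tm, hτ.off x this]
      rfl
    refine ⟨fun x hx => Clause.mem_vars_of_mem_body (A := f.atom y) ?_
      (Call.mem_vars_atom.2 (.inr (.inr hx))), e, ?_⟩
    · rw [hK'.body]; exact List.mem_map.2 ⟨f, hf, rfl⟩
    · intro x hx
      rw [e] at hx
      simp only [Atom.ins, listVars_cons, hA, Set.mem_union] at hx ⊢
      rcases hx with hx | hx
      · exact .inl (Set.mem_iUnion.2 ⟨f.idx, hx⟩)
      · refine .inr ?_
        rw [← hτX]
        rw [mem_listVars_subst] at hx ⊢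
        obtain ⟨z, hz, hxz⟩ := hx
        refine ⟨z, ?_, hxz⟩
        rw [listVars_tm] at hz ⊢
        exact (hK'.call f hf).1 hz
  have hmem : ∀ F ∈ L ++ K'.body ++ M, (F ∈ L ∨ F ∈ M) ∨ ∃ f ∈ calls, F = f.atom y := by
    intro F hF
    rw [hK'.body] at hF
    simp only [List.mem_append, List.mem_map] at hF
    rcases hF with (hF | ⟨f, hf, rfl⟩) | hF
    · exact .inl (.inl hF)
    · exact .inr ⟨f, hf, rfl⟩
    · exact .inl (.inr hF)
  constructor
  · rintro _ ⟨F, hF, rfl⟩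
    rcases hmem F hF with hF | ⟨f, hf, rfl⟩
    · rw [(hLM F hF).2.1]; exact hC.body.wf F (hLM F hF).1
    · obtain ⟨h₁, h₂, h₃⟩ := hcall f hf
      have hc := hK'.call f hf
      rw [h₂] at h₃ ⊢
      refine ⟨by rw [map_fst_subst, map_fst_tm, hc.2.1], hc.2.2.1, f.outs, rfl,
        (List.nodup_flatMap.1 hnd.2.1).1 f hf, hc.2.2.2, fun x hx hx' => ?_⟩
      exact hAv x (h₃ x hx') (h₁ x hx)
  · rintro _ ⟨F, hF, rfl⟩ x hx _ ⟨F', hF', rfl⟩ hx'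
    rcases hmem F hF with hF | ⟨f, hf, rfl⟩
    · obtain ⟨hFC, e, hv⟩ := hLM F hF
      rw [e] at hx ⊢
      have hxK := hv x (F.outs_subset_vars hx)
      rcases hmem F' hF' with hF' | ⟨f', hf', rfl⟩
      · obtain ⟨hFC', e', -⟩ := hLM F' hF'
        rw [e'] at hx' ⊢
        exact hC.body.sep F hFC x hx F' hFC' hx'
      · obtain ⟨h₁, h₂, h₃⟩ := hcall f' hf'
        -- An output `x` of an old atom `F` that occurs in a new call occurs among the inputs of the
        -- unfolded atom `A`. Separation then gives `A = F`, although no output of `A` is one of its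
        -- inputs.
        have hiA : x ∈ listVars A.ins := by
          refine h₃ x ?_
          rw [h₂] at hx' ⊢
          rcases (Atom.mem_vars_cata rfl).1 hx' with hx' | hx'
          · exact hx'
          · exact (hxK (h₁ x (by simpa [Atom.outs] using hx'))).elim
        have : A = F := hC.body.sep F hFC x hx A (by simp) ((Atom.mem_vars_cata rfl).2 (.inl hiA))
        rw [← this] at hx
        exact (hyi x (by simpa [hA, Atom.outs] using hx) hiA).elim
    · obtain ⟨h₁, h₂, h₃⟩ := hcall f hf
      have hxf : x ∈ f.outs := by rw [h₂] at hx; simpa [Atom.outs] using hx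
      rcases hmem F' hF' with hF' | ⟨f', hf', rfl⟩
      · obtain ⟨hFC', e', hv⟩ := hLM F' hF'
        rw [e'] at hx'
        exact (hv x hx' (h₁ x hxf)).elim
      · obtain ⟨h₁', h₂', h₃'⟩ := hcall f' hf'
        have : x ∈ f'.outs := by
          rw [h₂'] at hx' h₃'
          rcases (Atom.mem_vars_cata rfl).1 hx' with hx' | hx'
          · exact (hAv x (h₃' x hx') (h₁ x hxf)).elim
          · simpa [Atom.outs] using hx'
        rw [mem_flatMap_unique hnd.2.1 hf' hf this hxf]

/-- Inversion of the true ground atom supplies the clause to resolve with. Its calls are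
catamorphism atoms of the least model, and `J` contains all of those. -/
theorem covers_unfold_cata {P : Set (Clause S)} (hP : IsProgram P) {J : Set (GAtom S)}
    (hJ : J ⊆ leastModel P) (hJ' : ∀ h ps t os, GAtom.cata h ps t os ∈ leastModel P →
      GAtom.cata h ps t os ∈ J) {H : Option (Atom S)}
    {c : Constr S} {h : S.Cat} {ps : List (STerm S)} {t : STerm S} {os : List (STerm S)}
    {L M : List (Atom S)} (hC : Clause.OK ⟨H, c, L ++ .cata h ps t os :: M⟩)
    (ht : ¬ ∃ x : PVar S, t = x.tm) {Rs : Set (Clause S)}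
    (hU : IsUnf P H c L (.cata h ps t os) M Rs)
    {v : Valn S} (hv : Sat v c) (hb : ∀ F ∈ L ++ .cata h ps t os :: M, F.eval v ∈ J)
    {g : GAtom S} (hg : H.map (Atom.eval v) = some g) : Covers J Rs g := by
  obtain ⟨hp, hts, ys, rfl, hys, hyss, hyi⟩ := hC.body.wf (.cata h ps t os) (by simp)
  obtain ⟨k, args, rfl⟩ := STerm.exists_con hts ht
  obtain ⟨k', K, hK, hk, w, B₀, hB₀, he, hw, hKb⟩ := cata_inversion hP
    (hJ (hb (.cata h ps ⟨_, .con k args⟩ (ys.map PVar.tm)) (by simp)))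
  obtain ⟨X, y, Res, calls, hk⟩ := hk.shape
  obtain rfl : k' = k := by
    have e := hk.head
    rw [hB₀, Option.some.injEq] at e
    rw [e] at he
    simp only [Atom.eval, GAtom.cata.injEq, STerm.eval, Term.eval] at he
    have := congrArg (fun x : SVal S => x.2.root) he.2.2.1
    simpa [Val.root] using this
  obtain ⟨R, hR, u, h₁, h₂, h₃⟩ := hU.exists_instance hK hv hw hB₀ he (by
    intro ρ B hd hB
    obtain ⟨τ, hτ, -⟩ := matcher_cata (args := args) (hk.rename ρ) hp hyss
      (hd.mono_left fun x hx => Clause.mem_vars_of_mem_body (by simp) hx) hB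
    exact ⟨τ, _, hτ⟩)
  refine ⟨R, hR, u, h₁.trans hg, h₂, fun F hF => ?_⟩
  rcases h₃ F hF with ⟨F', hF', e⟩ | ⟨F', hF', e⟩
  · rw [e]
    refine hb F' ?_
    simp only [List.mem_append, List.mem_cons] at hF' ⊢
    tauto
  · rw [e]
    have := hKb F' hF'
    rw [hk.body] at hF'
    obtain ⟨f, hf, rfl⟩ := List.mem_map.1 hF'
    exact hJ' _ _ _ _ this

/-! #### The procedure Unfold -/

theorem unfoldCataStep_ok {P : Set (Clause S)} (hP : IsProgram P) {J : Set (GAtom S)}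
    (hJ : J ⊆ leastModel P) (hJ' : ∀ h ps t os, GAtom.cata h ps t os ∈ leastModel P →
      GAtom.cata h ps t os ∈ J) {Cls Cls' : Set (Clause S)} (hs : UnfoldCataStep P Cls Cls')
    (hok : ∀ C ∈ Cls, C.OK) :
    (∀ C ∈ Cls', C.OK) ∧ ∀ g, Covers J Cls g → Covers J Cls' g := by
  obtain ⟨C, L, M, h, ps, t, os, Rs, hC, hb, ht, hU, rfl⟩ := hs
  have hCok : Clause.OK ⟨C.head, C.constr, L ++ .cata h ps t os :: M⟩ := by
    rw [← hb]; exact hok C hC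
  constructor
  · rintro R (hR | hR)
    · exact hok R hR.1
    · obtain ⟨K, hK, hR⟩ := hU.1 R hR
      exact resolvent_cata_ok hP hCok ht hK hR
  · rintro g ⟨C', hC', v, h₁, h₂, h₃⟩
    by_cases e : C' = C
    · subst e
      obtain ⟨R, hR, H⟩ := covers_unfold_cata hP hJ hJ' hCok ht hU h₂ (by rwa [← hb]) h₁
      exact ⟨R, .inr hR, H⟩
    · exact ⟨C', .inl ⟨hC', e⟩, v, h₁, h₂, h₃⟩

/-- Functionality makes the new equality true in every ground instance whose body is true; deleting
an atom cannot harm `BodyOK`. -/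
theorem functionalityStep_ok {P : Set (Clause S)} (hP : IsProgram P) {J : Set (GAtom S)}
    (hJ : J ⊆ leastModel P) {Cls Cls' : Set (Clause S)} (hs : FunctionalityStep Cls Cls')
    (hok : ∀ C ∈ Cls, C.OK) :
    (∀ C ∈ Cls', C.OK) ∧ ∀ g, Covers J Cls g → Covers J Cls' g := by
  obtain ⟨C, L, M, N, h, ps, t, Y, Z, hC, hb, rfl⟩ := hs
  have hsub : L ++ Atom.cata h ps t Y :: M ++ N ⊆ C.body := by
    rw [hb]
    intro F hF
    simp only [List.mem_append, List.mem_cons] at hF ⊢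
    tauto
  constructor
  · rintro R (hR | rfl)
    · exact hok R hR.1
    · exact ⟨(hok C hC).body.mono hsub, headBasic_congr (hok C hC).head⟩
  · rintro g ⟨C', hC', v, h₁, h₂, h₃⟩
    by_cases e : C' = C
    · subst e
      refine ⟨_, .inr rfl, v, h₁, sat_and.2 ⟨h₂, ?_⟩, fun A hA => h₃ A (hsub hA)⟩
      have m₁ := hJ (h₃ (.cata h ps t Y) (by rw [hb]; simp))
      have m₂ := hJ (h₃ (.cata h ps t Z) (by rw [hb]; simp))
      obtain ⟨e₁, e₂⟩ := cata_functional hP (t.eval v).2 h _ _ _ m₁ m₂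
      rw [map_fst_eval] at e₂
      exact sat_eqTuple e₂ e₁
    · exact ⟨C', .inl ⟨hC', e⟩, v, h₁, h₂, h₃⟩

/-! ### Instances of contracts -/

theorem CataSpec.mem_vars_atom {F : CataSpec S} {x : PVar S} :
    x ∈ F.atom.vars ↔ x ∈ F.X ∨ x = F.T ∨ x ∈ F.Y := by
  simp only [CataSpec.atom, Atom.vars, Atom.args, listVars_append, listVars_cons, listVars_tm,
    PVar.vars_tm]
  rfl

section Instance

variable {K : Contract S} {A : Atom S} {G : List (Atom S)} {used : Set (PVar S)} {σ : Subst S}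

theorem IsInstance.vars_subset (hσ : IsInstance K A G used σ) {x : PVar S} (hx : x ∈ K.Z) :
    (σ x.1 x.2).vars ⊆ A.vars := by
  intro z hz
  rw [hσ.1, Atom.mem_vars_subst]
  exact ⟨x, by simpa [Atom.vars, Atom.args] using hx, hz⟩

/-- A variable of an added catamorphism atom that is not fresh is a variable of the program atom. -/
theorem IsInstance.mem_vars_of_used (hσ : IsInstance K A G used σ) (hK : K.WF) {F : CataSpec S}
    (hF : F ∈ K.catas) (hFG : F.atom.subst σ ∉ G) {x : PVar S} (hx : x ∈ F.atom.vars) {z : PVar S}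
    (hz : z ∈ (σ x.1 x.2).vars) (hzu : z ∈ used) : z ∈ A.vars := by
  obtain ⟨-, M, hM, hfresh, -⟩ := id hσ
  have hFM : F ∉ M := fun h => hFG (hM F hF h)
  have key : (x ∈ F.X ∧ x ∉ K.Z) ∨ x ∈ F.Y → z ∈ A.vars := by
    intro h
    obtain ⟨n, e, hn⟩ := hfresh F hF hFM x h
    rw [e] at hz
    obtain rfl : z = (x.1, n) := hz
    exact (hn hzu).elim
  rcases CataSpec.mem_vars_atom.1 hx with h | rfl | h
  · by_cases hxZ : x ∈ K.Z
    · exact hσ.vars_subset hxZ hz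
    · exact key (.inl ⟨h, hxZ⟩)
  · exact hσ.vars_subset (hK.sortT F hF).1 hz
  · exact key (.inr h)

/-- The same for all variables of a contract: a non-fresh one belongs to the clause body. -/
theorem IsInstance.mem_bodyVars_of_used (hσ : IsInstance K A G used σ) (hK : K.WF) (hA : A ∈ G)
    {x : PVar S} (hx : x ∈ K.Z ∨ ∃ F ∈ K.catas, x ∈ F.atom.vars) {z : PVar S}
    (hz : z ∈ (σ x.1 x.2).vars) (hzu : z ∈ used) : z ∈ bodyVars G := by
  rcases hx with hx | ⟨F, hF, hx⟩
  · exact ⟨A, hA, hσ.vars_subset hx hz⟩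
  · by_cases hFG : F.atom.subst σ ∈ G
    · exact ⟨_, hFG, (Atom.mem_vars_subst _).2 ⟨x, hx, hz⟩⟩
    · exact ⟨A, hA, hσ.mem_vars_of_used hK hF hFG hx hz hzu⟩

theorem Contract.WF.X_ne_Y (hK : K.WF) {F F' : CataSpec S} (hF : F ∈ K.catas) (hF' : F' ∈ K.catas)
    {x : PVar S} (hx : x ∈ F.X) (hx' : x ∈ F'.Y) : False :=
  (List.nodup_append.1 hK.nodupXY).2.2 x (List.mem_flatMap.2 ⟨F, hF, hx⟩) x
    (List.mem_flatMap.2 ⟨F', hF', hx'⟩) rfl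

/-- The outputs of the added catamorphism atoms are fresh, and occur only as such. -/
theorem IsInstance.fresh_outs (hσ : IsInstance K A G used σ) (hK : K.WF) (hA : A ∈ G)
    (hG : bodyVars G ⊆ used) {F : CataSpec S} (hF : F ∈ K.catas) (hFG : F.atom.subst σ ∉ G)
    {y : PVar S} (hy : y ∈ F.Y) :
    ∃ n, σ y.1 y.2 = .var y.1 n ∧ (y.1, n) ∉ used ∧
      (∀ x : PVar S, (x ∈ K.Z ∨ ∃ F' ∈ K.catas, x ∈ F'.X) → (y.1, n) ∉ (σ x.1 x.2).vars) ∧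
      ∀ F' ∈ K.catas, ∀ y' ∈ F'.Y, (y.1, n) ∈ (σ y'.1 y'.2).vars → y' = y := by
  obtain ⟨-, M, hM, hfresh, hdist⟩ := id hσ
  have hFM : F ∉ M := fun h => hFG (hM F hF h)
  obtain ⟨n, e, hn⟩ := hfresh F hF hFM y (.inr hy)
  -- An atom identified with one of `G` has only variables of `G`, which the fresh variable avoids;
  -- among the other atoms fresh variables are assigned injectively.
  have key : ∀ F' ∈ K.catas, ∀ x : PVar S, (x ∈ F'.X ∧ x ∉ K.Z) ∨ x ∈ F'.Y →
      (y.1, n) ∈ (σ x.1 x.2).vars → x = y := by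
    intro F' hF' x hx hz
    by_cases hFM' : F' ∈ M
    · refine (hn (hG ⟨_, hM F' hF' hFM', (Atom.mem_vars_subst _).2 ⟨x, ?_, hz⟩⟩)).elim
      rw [CataSpec.mem_vars_atom]; tauto
    · obtain ⟨m, e', -⟩ := hfresh F' hF' hFM' x hx
      refine hdist F' hF' hFM' F hF hFM x y hx (.inr hy) ?_
      rw [e'] at hz
      have hz : (y.1, n) = (x.1, m) := hz
      obtain ⟨s, a⟩ := x
      obtain ⟨s', b⟩ := y
      simp only [Prod.mk.injEq] at hz
      obtain ⟨rfl, rfl⟩ := hz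
      simp only [PVar.subst_tm, e, e']
  have hZ : ∀ x : PVar S, x ∈ K.Z → (y.1, n) ∉ (σ x.1 x.2).vars := fun x hx hz =>
    hn (hG ⟨A, hA, hσ.vars_subset hx hz⟩)
  refine ⟨n, e, hn, fun x hx hz => ?_, fun F' hF' y' hy' => key F' hF' y' (.inr hy')⟩
  by_cases hxZ : x ∈ K.Z
  · exact hZ x hxZ hz
  · rcases hx with hx | ⟨F', hF', hx⟩
    · exact hxZ hx
    · exact hK.X_ne_Y hF' hF hx (key F' hF' x (.inl ⟨hx, hxZ⟩) hz ▸ hy)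

theorem CataSpec.mem_outs_subst {F : CataSpec S} {z : PVar S} :
    z ∈ listVars (F.atom.subst σ).outs ↔ ∃ y ∈ F.Y, z ∈ (σ y.1 y.2).vars := by
  simp only [CataSpec.atom, Atom.subst, Atom.outs, mem_listVars_subst, listVars_tm]
  rfl

theorem IsInstance.outs_notMem (hσ : IsInstance K A G used σ) (hK : K.WF) (hA : A ∈ G)
    (hG : bodyVars G ⊆ used) {F : CataSpec S} (hF : F ∈ K.catas) (hFG : F.atom.subst σ ∉ G)
    {z : PVar S} (hz : z ∈ listVars (F.atom.subst σ).outs) :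
    z ∉ used ∧ (∀ x : PVar S, (x ∈ K.Z ∨ ∃ F' ∈ K.catas, x ∈ F'.X) → z ∉ (σ x.1 x.2).vars) ∧
      ∀ F' ∈ K.catas, z ∈ (F'.atom.subst σ).vars → F' = F := by
  obtain ⟨y, hy, hz⟩ := CataSpec.mem_outs_subst.1 hz
  obtain ⟨n, e, hn, h₁, h₂⟩ := hσ.fresh_outs hK hA hG hF hFG hy
  rw [e] at hz
  obtain rfl : z = (y.1, n) := hz
  refine ⟨hn, h₁, fun F' hF' hz' => ?_⟩
  obtain ⟨x, hx, hzx⟩ := (Atom.mem_vars_subst _).1 hz'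
  rcases CataSpec.mem_vars_atom.1 hx with hx | rfl | hx
  · exact (h₁ x (.inr ⟨F', hF', hx⟩) hzx).elim
  · exact (h₁ _ (.inl (hK.sortT F' hF').1) hzx).elim
  · exact mem_flatMap_unique (List.nodup_append.1 hK.nodupXY).2.1 hF' hF hx (h₂ F' hF' x hx hzx ▸ hy)

/-- On the outputs of an added atom `σ` is an injective renaming to variables that its inputs cannot
contain. -/
theorem IsInstance.wf (hσ : IsInstance K A G used σ) (hK : K.WF) (hA : A ∈ G)
    (hG : bodyVars G ⊆ used) {F : CataSpec S} (hF : F ∈ K.catas) (hFG : F.atom.subst σ ∉ G) :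
    (F.atom.subst σ).WF := by
  have hren : RenOn σ {y | y ∈ F.Y} := by
    refine ⟨fun y hy => ?_, fun y hy y' hy' z hz hz' => ?_⟩
    · obtain ⟨n, e, -⟩ := hσ.fresh_outs hK hA hG hF hFG hy
      exact ⟨n, e⟩
    · obtain ⟨n, e, -, -, h⟩ := hσ.fresh_outs hK hA hG hF hFG hy'
      rw [e] at hz'
      obtain rfl : z = (y'.1, n) := hz'
      exact h F hF y hy hz
  obtain ⟨ys, e, hn, hs, hy⟩ := hren.map_tm
    ((List.nodup_flatMap.1 (List.nodup_append.1 hK.nodupXY).2.1).1 F hF) fun _ h => h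
  refine ⟨by rw [map_fst_subst, map_fst_tm, hK.sortX F hF], (hK.sortT F hF).2, ys, e, hn,
    hs.trans (hK.sortY F hF), fun z hz hz' => ?_⟩
  obtain ⟨y, hyY, hzy⟩ := hy z hz
  have h := (hσ.outs_notMem hK hA hG hF hFG (CataSpec.mem_outs_subst.2 ⟨y, hyY, hzy⟩)).2.1
  rw [← List.map_cons, mem_listVars_subst] at hz'
  obtain ⟨x, hx, hzx⟩ := hz'
  simp only [listVars_cons, listVars_tm, PVar.vars_tm] at hx
  rcases hx with hx | hx
  · obtain rfl : x = F.T := hx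
    exact h _ (.inl (hK.sortT F hF).1) hzx
  · exact h x (.inr ⟨F, hF, hx⟩) hzx

/-- Completion of a valuation on the fresh outputs of a contract instance. -/
theorem IsInstance.exists_extension {P : Set (Clause S)} (hP : IsProgram P)
    (hσ : IsInstance K A G used σ) (hK : K.WF) (hA : A ∈ G) (hG : bodyVars G ⊆ used)
    {G₀ : List (Atom S)} (hG₀ : G ⊆ G₀) (v : Valn S)
    (hv : ∀ F ∈ K.catas, F.atom.subst σ ∈ G₀ → (F.atom.subst σ).eval v ∈ leastModel P) :
    ∃ u : Valn S, (∀ x : PVar S, (∀ F ∈ K.catas, F.atom.subst σ ∉ G₀ →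
        x ∉ listVars (F.atom.subst σ).outs) → u x.1 x.2 = v x.1 x.2) ∧
      ∀ F ∈ K.catas, (F.atom.subst σ).eval u ∈ leastModel P := by
  obtain ⟨u, hu, hu'⟩ := TCata.exists_extension hP {B | ∃ F ∈ K.catas, B = F.atom.subst σ}
    {B | B ∈ G₀} v (by rintro _ ⟨F, _, rfl⟩; rfl)
    (by rintro _ ⟨F, hF, rfl⟩ h; exact hv F hF h)
    (by rintro _ ⟨F, hF, rfl⟩ h; exact hσ.wf hK hA hG hF fun h' => h (hG₀ h'))
    (by
      rintro _ ⟨F, hF, rfl⟩ h z hz _ ⟨F', hF', rfl⟩ hz'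
      rw [(hσ.outs_notMem hK hA hG hF (fun h' => h (hG₀ h')) hz).2.2 F' hF' hz'])
  refine ⟨u, fun x hx => hu x ?_, fun F hF => hu' _ ⟨F, hF, rfl⟩⟩
  rintro _ ⟨F, hF, rfl⟩ h
  exact hx F hF h

end Instance

/-! ### Catamorphism addition and the application of contracts -/

theorem AddCatas.subset {l G G' : List (Atom S)} (h : AddCatas l G G') :
    G ⊆ G' ∧ ∀ A ∈ G', A ∈ G ∨ A ∈ l := by
  induction h with
  | done G => exact ⟨fun _ h => h, fun A hA => .inl hA⟩
  | present _ _ ih => exact ⟨ih.1, fun A hA => (ih.2 A hA).imp_right (List.mem_cons_of_mem _)⟩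
  | add _ _ ih =>
    refine ⟨fun A hA => ih.1 (List.mem_append_left _ hA), fun A hA => ?_⟩
    rcases ih.2 A hA with h | h
    · rcases List.mem_append.1 h with h | h
      · exact .inl h
      · exact .inr (by rw [List.mem_singleton.1 h]; exact List.mem_cons_self)
    · exact .inr (List.mem_cons_of_mem _ h)

section AddContracts

variable {Cns : Set (Contract S)} {H : Option (Atom S)} {e : Constr S} {As G G' : List (Atom S)}
  {cs ds cs' ds' : List (Constr S)}

theorem AddContracts.subset (h : AddContracts Cns H e As G cs ds G' cs' ds') :
    G ⊆ G' ∧ cs ⊆ cs' ∧ ds ⊆ ds' ∧ ∀ A ∈ G', A ∈ G ∨ A.isCata = true := by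
  induction h with
  | done G => exact ⟨fun _ h => h, fun _ h => h, fun _ h => h, fun A hA => .inl hA⟩
  | step hK hσ hG hl ih =>
    obtain ⟨h₁, h₂, h₃, h₄⟩ := ih
    refine ⟨fun A hA => h₁ (hG.subset.1 hA), fun c hc => h₂ (List.mem_append_left _ hc),
      fun c hc => h₃ (List.mem_append_left _ hc), fun A hA => ?_⟩
    rcases h₄ A hA with h | h
    · rcases hG.subset.2 A h with h | h
      · exact .inl h
      · obtain ⟨F, -, rfl⟩ := List.mem_map.1 h
        exact .inr rfl
    · exact .inr h

theorem AddContracts.bodyOK (hCns : IsContractSet Cns)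
    (h : AddContracts Cns H e As G cs ds G' cs' ds') (hAs : ∀ A ∈ As, A ∈ G ∧ A.isProg = true)
    (hG : BodyOK {A | A ∈ G}) : BodyOK {A | A ∈ G'} := by
  induction h with
  | done G => exact hG
  | @step A As G G₁ G' cs ds cs' ds' K σ hK hσ hadd hl ih =>
    have hWF := hCns.wf K hK
    have hA := hAs A (by simp)
    have hu : bodyVars G ⊆ Clause.vars ⟨H, .and e (.and (conj cs) (conj ds)), G⟩ := fun x hx => .inr hx
    refine ih (fun B hB => ⟨hadd.subset.1 (hAs B (by simp [hB])).1, (hAs B (by simp [hB])).2⟩) ?_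
    have hmem : ∀ B ∈ G₁, B ∈ G ∨ ∃ F ∈ K.catas, F.atom.subst σ ∉ G ∧ B = F.atom.subst σ := by
      intro B hB
      by_cases hBG : B ∈ G
      · exact .inl hBG
      · obtain ⟨F, hF, rfl⟩ := List.mem_map.1 ((hadd.subset.2 B hB).resolve_left hBG)
        exact .inr ⟨F, hF, hBG, rfl⟩
    constructor
    · intro B hB
      rcases hmem B hB with hB | ⟨F, hF, hFG, rfl⟩
      · exact hG.wf B hB
      · exact hσ.wf hWF hA.1 hu hF hFG
    · intro B hB y hy B' hB' hy'
      rcases hmem B hB with hB | ⟨F, hF, hFG, rfl⟩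
      · rcases hmem B' hB' with hB' | ⟨F', hF', hFG', rfl⟩
        · exact hG.sep B hB y hy B' hB' hy'
        -- An old output inside an added atom is not fresh, so it is a variable of the program atom
        -- `A`. Separation would make `A` the atom with that output, but program atoms have no
        -- outputs.
        · obtain ⟨x, hx, hyx⟩ := (Atom.mem_vars_subst _).1 hy'
          have := hG.sep B hB y hy A hA.1 (hσ.mem_vars_of_used hWF hF' hFG' hx hyx
            (hu ⟨B, hB, B.outs_subset_vars hy⟩))
          rw [← this] at hy
          have hp := hA.2
          cases A <;> simp [Atom.isProg, Atom.outs, listVars] at hp hy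
      · obtain ⟨h₁, -, h₃⟩ := hσ.outs_notMem hWF hA.1 hu hF hFG hy
        rcases hmem B' hB' with hB' | ⟨F', hF', hFG', rfl⟩
        · exact (h₁ (hu ⟨B', hB', hy'⟩)).elim
        · rw [h₃ F' hF' hy']

/-- The added catamorphism atoms can be made true. -/
theorem AddContracts.exists_valn {P : Set (Clause S)} (hP : IsProgram P) {J : Set (GAtom S)}
    (hJ : J ⊆ leastModel P) (hJ' : ∀ h ps t os, GAtom.cata h ps t os ∈ leastModel P →
      GAtom.cata h ps t os ∈ J) (hCns : IsContractSet Cns)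
    (h : AddContracts Cns H e As G cs ds G' cs' ds') (hAs : ∀ A ∈ As, A ∈ G) (v : Valn S)
    (hv : ∀ A ∈ G, A.eval v ∈ J) :
    ∃ u : Valn S, (∀ x ∈ Clause.vars ⟨H, e, G⟩, u x.1 x.2 = v x.1 x.2) ∧
      ∀ A ∈ G', A.eval u ∈ J := by
  induction h generalizing v with
  | done G => exact ⟨v, fun _ _ => rfl, hv⟩
  | @step A As G G₁ G' cs ds cs' ds' K σ hK hσ hadd hl ih =>
    have hWF := hCns.wf K hK
    have hA := hAs A (by simp)
    have hu : bodyVars G ⊆ Clause.vars ⟨H, .and e (.and (conj cs) (conj ds)), G⟩ := fun x hx => .inr hx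
    -- Values are assigned to the outputs of all instance atoms outside `G`, even of those that
    -- `AddCatas` skips; such outputs are fresh, so nothing in the clause is affected.
    obtain ⟨u, hu₁, hu₂⟩ := hσ.exists_extension hP hWF hA hu (fun _ h => h) v
      fun F _ hF => hJ (hv _ hF)
    have hu₁' : ∀ x ∈ Clause.vars ⟨H, e, G⟩, u x.1 x.2 = v x.1 x.2 := by
      intro x hx
      refine hu₁ x fun F hF hFG hxF => (hσ.outs_notMem hWF hA hu hF hFG hxF).1 ?_
      rcases hx with (hx | hx) | hx
      · exact .inl (.inl hx)
      · exact .inl (.inr (.inl hx))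
      · exact .inr hx
    obtain ⟨u', h₁, h₂⟩ := ih (fun B hB => hadd.subset.1 (hAs B (by simp [hB]))) u (by
      intro B hB
      rcases hadd.subset.2 B hB with hB | hB
      · rw [B.eval_congr fun x hx => hu₁' x (.inr ⟨B, hB, hx⟩)]
        exact hv B hB
      · obtain ⟨F, hF, rfl⟩ := List.mem_map.1 hB
        exact hJ' _ _ _ _ (hu₂ F hF))
    refine ⟨u', fun x hx => (h₁ x ?_).trans (hu₁' x hx), h₂⟩
    rcases hx with hx | ⟨B, hB, hx⟩
    · exact .inl hx
    · exact .inr ⟨B, hadd.subset.1 hB, hx⟩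

/-- Variables occurring only in postconditions are not used again. -/
theorem AddContracts.notMem_vars (hCns : IsContractSet Cns)
    (h : AddContracts Cns H e As G cs ds G' cs' ds') (hAs : ∀ A ∈ As, A ∈ G) {x : PVar S}
    (hx : x ∈ (conj ds).vars) (hxG : x ∉ bodyVars G) (hxc : x ∉ (conj cs).vars) :
    x ∉ bodyVars G' ∧ x ∉ (conj cs').vars := by
  induction h with
  | done G => exact ⟨hxG, hxc⟩
  | @step A As G G₁ G' cs ds cs' ds' K σ hK hσ hadd hl ih =>
    have hWF := hCns.wf K hK
    have hA := hAs A (by simp)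
    -- The variables of the postconditions collected so far count as used, so later instances cannot
    -- introduce them as fresh.
    have hxu : x ∈ Clause.vars ⟨H, .and e (.and (conj cs) (conj ds)), G⟩ :=
      .inl (.inr (.inr (.inr hx)))
    refine ih (fun B hB => hadd.subset.1 (hAs B (by simp [hB]))) ?_ ?_ ?_
    · rw [mem_vars_conj] at hx ⊢
      obtain ⟨c, hc, hx⟩ := hx
      exact ⟨c, List.mem_append_left _ hc, hx⟩
    · rintro ⟨B, hB, hxB⟩
      rcases hadd.subset.2 B hB with hB | hB
      · exact hxG ⟨B, hB, hxB⟩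
      · obtain ⟨F, hF, rfl⟩ := List.mem_map.1 hB
        obtain ⟨z, hz, hxz⟩ := (Atom.mem_vars_subst _).1 hxB
        exact hxG (hσ.mem_bodyVars_of_used hWF hA (.inr ⟨F, hF, hz⟩) hxz hxu)
    · rw [mem_vars_conj]
      rintro ⟨c, hc, hxc'⟩
      rcases List.mem_append.1 hc with hc | hc
      · exact hxc (mem_vars_conj.2 ⟨c, hc, hxc'⟩)
      · obtain rfl : c = _ := by simpa using hc
        obtain ⟨z, hz, hxz⟩ := (Term.mem_vars_subst _).1 hxc'
        refine hxG (hσ.mem_bodyVars_of_used hWF hA ?_ hxz hxu)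
        rcases hWF.varsPre z hz with h | ⟨F, hF, h⟩
        · exact .inl h
        · exact .inr ⟨F, hF, CataSpec.mem_vars_atom.2 (.inl h)⟩

/-- If the added preconditions hold then, up to the values of variables that occur nowhere else,
so do the added postconditions. -/
theorem AddContracts.exists_post {P : Set (Clause S)} (hP : IsProgram P) {J : Set (GAtom S)}
    (hJ : J ⊆ leastModel P) (hCns : IsContractSet Cns)
    (hval : ∀ K ∈ Cns, ∀ v : Valn S, (Atom.prog K.pred (K.Z.map PVar.tm)).eval v ∈ J →
      Sat v K.pre → (∀ F ∈ K.catas, F.atom.eval v ∈ leastModel P) → Sat v K.post)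
    (h : AddContracts Cns H e As G cs ds G' cs' ds') (hAs : ∀ A ∈ As, A ∈ G) (w : Valn S)
    (hw : ∀ A ∈ G', A.eval w ∈ J) (hcs : Sat w (conj cs')) (hds : Sat w (conj ds)) :
    ∃ u : Valn S, (∀ x : PVar S, x ∈ Clause.vars ⟨H, .and e (conj cs'), G'⟩ →
      u x.1 x.2 = w x.1 x.2) ∧ Sat u (conj ds') := by
  classical
  induction h generalizing w with
  | done G => exact ⟨w, fun _ _ => rfl, hds⟩
  | @step A As G G₁ G' cs ds cs' ds' K σ hK hσ hadd hl ih =>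
    have hWF := hCns.wf K hK
    have hA := hAs A (by simp)
    have hAs' : ∀ B ∈ As, B ∈ G₁ := fun B hB => hadd.subset.1 (hAs B (by simp [hB]))
    have hu : bodyVars G ⊆ Clause.vars ⟨H, .and e (.and (conj cs) (conj ds)), G⟩ := fun x hx => .inr hx
    obtain ⟨v, hv₁, hv₂⟩ := hσ.exists_extension hP hWF hA hu hadd.subset.1 w
      fun F _ hF => hJ (hw _ (hl.subset.1 hF))
    -- `v` differs from `w` only on outputs of catamorphism atoms that have not been added
    have hne : ∀ x : PVar S, v x.1 x.2 ≠ w x.1 x.2 → ∃ F ∈ K.catas, F.atom.subst σ ∉ G₁ ∧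
        x ∈ listVars (F.atom.subst σ).outs := by
      intro x hx
      by_contra hcon
      exact hx (hv₁ x fun F hF hFG hxF => hcon ⟨F, hF, hFG, hxF⟩)
    have hfacts : ∀ x : PVar S, v x.1 x.2 ≠ w x.1 x.2 →
        x ∉ Clause.vars ⟨H, .and e (.and (conj cs) (conj ds)), G⟩ ∧ x ∉ bodyVars G₁ ∧
        x ∉ (K.pre.subst σ).vars := by
      intro x hx
      obtain ⟨F, hF, hFG, hxF⟩ := hne x hx
      obtain ⟨h₁, h₂, h₃⟩ := hσ.outs_notMem hWF hA hu hF (fun h => hFG (hadd.subset.1 h)) hxF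
      refine ⟨h₁, ?_, ?_⟩
      · rintro ⟨B, hB, hxB⟩
        rcases hadd.subset.2 B hB with hBG | hBl
        · exact h₁ (hu ⟨B, hBG, hxB⟩)
        · obtain ⟨F', hF', rfl⟩ := List.mem_map.1 hBl
          exact hFG (h₃ F' hF' hxB ▸ hB)
      · intro hxp
        obtain ⟨z, hz, hxz⟩ := (Term.mem_vars_subst _).1 hxp
        exact h₂ z (hWF.varsPre z hz) hxz
    have hpost : Sat v (K.post.subst σ) := by
      rw [sat_subst]
      refine hval K hK _ ?_ ?_ ?_
      · rw [← Atom.eval_subst, ← hσ.1, A.eval_congr (w := w) fun x hx => ?_]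
        · exact hw A (hl.subset.1 (hadd.subset.1 hA))
        · by_contra hxne
          exact (hfacts x hxne).1 (hu ⟨A, hA, hx⟩)
      · rw [← sat_subst]
        have : Sat w (K.pre.subst σ) := sat_conj.1 hcs _ (hl.subset.2.1 (by simp))
        refine this.congr fun x hx => ?_
        by_contra hxne
        exact (hfacts x (Ne.symm hxne)).2.2 hx
      · intro F hF
        rw [← Atom.eval_subst]
        exact hv₂ F hF
    -- `w` is changed to `v` only on the variables of this postcondition. A skipped output that does
    -- not occur in it is not recorded as used, so a later instance might choose the same variable,
    -- and its value must be left alone.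
    let w₁ : Valn S := fun s n => if (s, n) ∈ (K.post.subst σ).vars then v s n else w s n
    have hw₁ : ∀ x : PVar S, w₁ x.1 x.2 ≠ w x.1 x.2 → x ∈ (K.post.subst σ).vars ∧
        v x.1 x.2 ≠ w x.1 x.2 := by
      intro x hx
      by_cases hxp : (x.1, x.2) ∈ (K.post.subst σ).vars
      · simp only [w₁, if_pos hxp] at hx
        exact ⟨hxp, hx⟩
      · simp only [w₁, if_neg hxp] at hx
        exact (hx rfl).elim
    have hfin : ∀ x ∈ Clause.vars ⟨H, .and e (conj cs'), G'⟩, w₁ x.1 x.2 = w x.1 x.2 := by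
      intro x hx
      by_contra hxne
      obtain ⟨hxp, hxv⟩ := hw₁ x hxne
      obtain ⟨h₁, h₂, h₃⟩ := hfacts x hxv
      obtain ⟨h₄, h₅⟩ := hl.notMem_vars hCns hAs'
        (mem_vars_conj.2 ⟨_, List.mem_append_right _ (List.mem_singleton_self _), hxp⟩) h₂ (by
          rw [mem_vars_conj]
          rintro ⟨c, hc, hxc⟩
          rcases List.mem_append.1 hc with hc | hc
          · exact h₁ (.inl (.inr (.inr (.inl (mem_vars_conj.2 ⟨c, hc, hxc⟩)))))
          · obtain rfl : c = _ := by simpa using hc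
            exact h₃ hxc)
      rcases hx with (hx | hx | hx) | hx
      · exact h₁ (.inl (.inl hx))
      · exact h₁ (.inl (.inr (.inl hx)))
      · exact h₅ hx
      · exact h₄ hx
    obtain ⟨u, hu₁, hu₂⟩ := ih hAs' w₁
      (fun B hB => by rw [B.eval_congr fun x hx => hfin x (.inr ⟨B, hB, hx⟩)]; exact hw B hB)
      (hcs.congr fun x hx => (hfin x (.inl (.inr (.inr hx)))).symm)
      (by
        rw [sat_conj]
        intro c hc
        rcases List.mem_append.1 hc with hc | hc
        · refine (sat_conj.1 hds c hc).congr fun x hx => ?_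
          by_contra hxne
          exact (hfacts x (hw₁ x (Ne.symm hxne)).2).1
            (.inl (.inr (.inr (.inr (mem_vars_conj.2 ⟨c, hc, hx⟩)))))
        · obtain rfl : c = _ := by simpa using hc
          exact hpost.congr fun x hx => by simp only [w₁]; rw [if_pos hx])
    exact ⟨u, fun x hx => (hu₁ x hx).trans (hfin x hx), hu₂⟩

end AddContracts

theorem ApplyTo.ok {Cns : Set (Contract S)} (hCns : IsContractSet Cns) {C R : Clause S}
    (h : ApplyTo Cns C R) (hC : C.OK) : R.OK := by
  obtain ⟨G', cs, ds, hadd, h⟩ := h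
  have := hadd.bodyOK hCns (fun A hA => List.mem_filter.1 hA) hC.body
  rcases h with ⟨-, rfl⟩ | ⟨-, rfl⟩
  · exact ⟨this, headBasic_congr hC.head⟩
  · exact ⟨this, headBasic_congr hC.head⟩

/-- Ground instances are preserved by the application of contracts that are valid in `J`. -/
theorem ApplyTo.exists_valn {P : Set (Clause S)} (hP : IsProgram P) {J : Set (GAtom S)}
    (hJ : J ⊆ leastModel P) (hJ' : ∀ h ps t os, GAtom.cata h ps t os ∈ leastModel P →
      GAtom.cata h ps t os ∈ J) {Cns : Set (Contract S)} (hCns : IsContractSet Cns)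
    (hval : ∀ K ∈ Cns, ∀ v : Valn S, (Atom.prog K.pred (K.Z.map PVar.tm)).eval v ∈ J →
      Sat v K.pre → (∀ F ∈ K.catas, F.atom.eval v ∈ leastModel P) → Sat v K.post)
    {C R : Clause S} (h : ApplyTo Cns C R) {v : Valn S} (hc : Sat v C.constr)
    (hb : ∀ A ∈ C.body, A.eval v ∈ J) :
    ∃ u : Valn S, R.head.map (Atom.eval u) = C.head.map (Atom.eval v) ∧ Sat u R.constr ∧
      ∀ A ∈ R.body, A.eval u ∈ J := by
  obtain ⟨G', cs, ds, hadd, h⟩ := h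
  have hAs : ∀ A ∈ C.body.filter Atom.isProg, A ∈ C.body := fun A hA => (List.mem_filter.1 hA).1
  obtain ⟨u, hu₁, hu₂⟩ := hadd.exists_valn hP hJ hJ' hCns hAs v hb
  have hhead : ∀ w : Valn S, (∀ x ∈ headVars C.head, w x.1 x.2 = u x.1 x.2) →
      C.head.map (Atom.eval w) = C.head.map (Atom.eval v) := by
    intro w hw
    cases hh : C.head with
    | none => rfl
    | some A =>
      simp only [Option.map_some, Option.some.injEq]
      refine A.eval_congr fun x hx => ?_
      have hxh : x ∈ headVars C.head := ⟨A, hh, hx⟩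
      exact (hw x hxh).trans (hu₁ x (.inl (.inl hxh)))
  have hcu : Sat u C.constr := hc.congr fun x hx => (hu₁ x (.inl (.inr hx))).symm
  -- Three valuations follow each other: `u` for the added atoms, `w` for the variables of the
  -- preconditions outside the clause, and `w'` for the variables occurring only in postconditions.
  rcases h with ⟨hent, rfl⟩ | ⟨-, rfl⟩
  · obtain ⟨w, hw₁, hw₂⟩ := hent u hcu
    obtain ⟨w', h₁, h₂⟩ := hadd.exists_post hP hJ hCns hval hAs w
      (fun A hA => by rw [A.eval_congr fun x hx => hw₁ x (.inr ⟨A, hA, hx⟩)]; exact hu₂ A hA)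
      hw₂ rfl
    have h₃ : ∀ x ∈ Clause.vars ⟨C.head, C.constr, G'⟩, w' x.1 x.2 = u x.1 x.2 := by
      intro x hx
      refine (h₁ x ?_).trans (hw₁ x hx)
      rcases hx with (hx | hx) | hx
      · exact .inl (.inl hx)
      · exact .inl (.inr (.inl hx))
      · exact .inr hx
    refine ⟨w', hhead w' fun x hx => h₃ x (.inl (.inl hx)), ?_, fun A hA => ?_⟩
    · rw [sat_and, sat_and]
      refine ⟨hcu.congr fun x hx => (h₃ x (.inl (.inr hx))).symm, ?_, h₂⟩
      exact hw₂.congr fun x hx => (h₁ x (.inl (.inr (.inr hx)))).symm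
    · rw [A.eval_congr fun x hx => h₃ x (.inr ⟨A, hA, hx⟩)]
      exact hu₂ A hA
  · exact ⟨u, hhead u fun _ _ => rfl, hcu, hu₂⟩

/-! ### Definitions -/

/-- The invariant of definitions. -/
structure Defn.OK (D : Defn S) : Prop where
  body : BodyOK {A | A ∈ D.A :: D.catas}
  prog : D.A.isProg = true
  cata : ∀ F ∈ D.catas, F.isCata = true
  basic : ∀ x ∈ D.U, x.1.IsBasic

theorem Atom.isProg_subst (θ : Subst S) (A : Atom S) : (A.subst θ).isProg = A.isProg := by
  cases A <;> rfl

theorem Atom.isCata_subst (θ : Subst S) (A : Atom S) : (A.subst θ).isCata = A.isCata := by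
  cases A <;> rfl

theorem Atom.not_isCata_of_isProg {A : Atom S} (h : A.isProg = true) : ¬ A.isCata = true := by
  cases A <;> simp_all [Atom.isProg, Atom.isCata]

theorem Atom.isCata_of_mem_outs {A : Atom S} {y : PVar S} (h : y ∈ listVars A.outs) :
    A.isCata = true := by
  cases A <;> simp_all [Atom.outs, Atom.isCata, listVars]

theorem Defn.OK.variant {D D' : Defn S} (hD : D.OK) (h : Defn.IsVariant D' D) : D'.OK := by
  obtain ⟨ρ, rfl⟩ := h
  refine ⟨?_, ?_, ?_, ?_⟩
  · refine (hD.body.ren (fun A _ => Set.subset_univ _) (ρ.renOn Set.univ)).mono ?_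
    intro A hA
    simp only [Defn.rename, ← List.map_cons] at hA
    obtain ⟨A', hA', rfl⟩ := List.mem_map.1 hA
    exact ⟨A', hA', rfl⟩
  · exact (Atom.isProg_subst _ _).trans hD.prog
  · intro F hF
    obtain ⟨F', hF', rfl⟩ := List.mem_map.1 hF
    exact (Atom.isCata_subst _ _).trans (hD.cata F' hF')
  · intro x hx
    obtain ⟨x', hx', rfl⟩ := List.mem_map.1 hx
    exact hD.basic x' hx'

theorem Defn.mem_vars_of_mem {D : Defn S} {A : Atom S} (hA : A ∈ D.A :: D.catas) {x : PVar S}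
    (hx : x ∈ A.vars) : x ∈ D.toClause.vars :=
  .inr ⟨A, hA, hx⟩

/-- The outputs in an aligned definition are variables of the clause only if the catamorphism atom
is an atom of the clause. -/
theorem Aligned.mem_body_of_mem_outs {C : Clause S} {A : Atom S} {D : Defn S} (h : Aligned C A D)
    (hD : D.OK) {F : Atom S} (hF : F ∈ D.catas) {y : PVar S} (hy : y ∈ listVars F.outs)
    (hyC : y ∈ C.vars) : CatasOf C A F := by
  have hFD : F ∈ {A | A ∈ D.A :: D.catas} := List.mem_cons_of_mem _ hF
  rcases h.2 y (Defn.mem_vars_of_mem hFD (F.outs_subset_vars hy)) hyC with hyA | ⟨F', hF', hFC, hyF⟩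
  · have := hD.body.sep F hFD y hy D.A List.mem_cons_self (h.1 ▸ hyA)
    exact (Atom.not_isCata_of_isProg hD.prog (this ▸ hD.cata F hF)).elim
  · rwa [← hD.body.sep F hFD y hy F' (List.mem_cons_of_mem _ hF') hyF]

/-- Alignment lets the definition and the clause share an output only through a catamorphism atom
common to both, so separation in each of the two bodies carries over to their union. -/
theorem Aligned.bodyOK_union {C : Clause S} {A : Atom S} {D : Defn S} (h : Aligned C A D)
    (hD : D.OK) (hC : BodyOK {B | B ∈ C.body}) (hA : A ∈ C.body) :
    BodyOK {F | F = A ∨ F ∈ D.catas ∨ CatasOf C A F} := by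
  have hDmem : ∀ F, F = A ∨ F ∈ D.catas → F ∈ {A | A ∈ D.A :: D.catas} := by
    intro F hF
    simp only [Set.mem_ofPred_eq, List.mem_cons, h.1]
    exact hF
  have hCmem : ∀ F, F = A ∨ CatasOf C A F → F ∈ {B | B ∈ C.body} := by
    rintro F (rfl | hF)
    · exact hA
    · exact hF.1
  have hprog : ¬ A.isCata = true := Atom.not_isCata_of_isProg (h.1 ▸ hD.prog)
  constructor
  · rintro F (hF | hF | hF)
    · exact hD.body.wf F (hDmem F (.inl hF))
    · exact hD.body.wf F (hDmem F (.inr hF))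
    · exact hC.wf F (hCmem F (.inr hF))
  · intro F hF y hy F' hF' hy'
    have hFc := Atom.isCata_of_mem_outs hy
    have hyv := F.outs_subset_vars hy
    have hFA : F ≠ A := fun e => hprog (e ▸ hFc)
    have hF := hF.resolve_left hFA
    rcases hF with hF | hF
    · have hFD := hDmem F (.inr hF)
      rcases hF' with hF' | hF' | hF'
      · exact hD.body.sep F hFD y hy F' (hDmem F' (.inl hF')) hy'
      · exact hD.body.sep F hFD y hy F' (hDmem F' (.inr hF')) hy'
      · have := h.mem_body_of_mem_outs hD hF hy (Clause.mem_vars_of_mem_body hF'.1 hy')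
        exact hC.sep F this.1 y hy F' hF'.1 hy'
    · rcases hF' with hF' | hF' | hF'
      · exact hC.sep F hF.1 y hy F' (hCmem F' (.inl hF')) hy'
      · rcases h.2 y (Defn.mem_vars_of_mem (hDmem F' (.inr hF')) hy')
          (Clause.mem_vars_of_mem_body hF.1 hyv) with hyA | ⟨F'', hF'', hFC, hyF⟩
        · exact (hFA (hC.sep F hF.1 y hy A hA hyA).symm).elim
        · have e := hC.sep F hF.1 y hy F'' hFC.1 hyF
          subst e
          exact hD.body.sep F'' (hDmem F'' (.inr hF'')) y hy F' (hDmem F' (.inr hF')) hy'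
      · exact hC.sep F hF.1 y hy F' hF'.1 hy'

theorem IsNewDefn.ok {Defs : Set (Defn S)} {g : Constr S} {A : Atom S} {Q : Atom S → Prop}
    {E : Defn S} (h : IsNewDefn Defs g A Q E) (hA : A.isProg = true)
    (hQ : ∀ F, Q F → F.isCata = true) (hB : BodyOK {F | F = A ∨ Q F}) : E.OK := by
  obtain ⟨-, -, rfl, -, hE, hU⟩ := h
  refine ⟨hB.mono fun F hF => ?_, hA, fun F hF => hQ F ((hE F).1 hF), fun x hx => ((hU.2 x).1 hx).1⟩
  rcases List.mem_cons.1 hF with hF | hF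
  · exact .inl hF
  · exact .inr ((hE F).1 hF)

theorem DefineLoop.ok {l : List (Clause S × Atom S)} {Defs New Defs' New' : Set (Defn S)}
    (h : DefineLoop l Defs New Defs' New')
    (hl : ∀ C A, (C, A) ∈ l → C.OK ∧ A ∈ C.body ∧ A.isProg = true)
    (hDefs : ∀ D ∈ Defs, D.OK) (hNew : ∀ D ∈ New, D.OK) :
    (∀ D ∈ Defs', D.OK) ∧ (∀ D ∈ New', D.OK) ∧ New ⊆ New' ∧ ∀ D ∈ Defs', D ∈ Defs ∨ D ∈ New' := by
  have insert_ok : ∀ {s : Set (Defn S)} {E : Defn S}, E.OK → (∀ D ∈ s, D.OK) →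
      ∀ D ∈ insert E s, D.OK := by
    rintro s E hE hs D (rfl | hD)
    · exact hE
    · exact hs D hD
  -- Bookkeeping common to the two cases in which a definition is introduced.
  have main : ∀ {l : List (Clause S × Atom S)} {Defs New Defs' New' : Set (Defn S)} {E : Defn S},
      (E.OK → (∀ D ∈ Defs', D.OK) ∧ (∀ D ∈ New', D.OK) ∧ insert E New ⊆ New' ∧
        ∀ D ∈ Defs', D ∈ insert E Defs ∨ D ∈ New') → E.OK →
      (∀ D ∈ Defs', D.OK) ∧ (∀ D ∈ New', D.OK) ∧ New ⊆ New' ∧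
        ∀ D ∈ Defs', D ∈ Defs ∨ D ∈ New' := by
    intro l Defs New Defs' New' E ih hE
    obtain ⟨h₁, h₂, h₃, h₄⟩ := ih hE
    refine ⟨h₁, h₂, fun D hD => h₃ (.inr hD), fun D hD => ?_⟩
    rcases h₄ D hD with (rfl | h) | h
    · exact .inr (h₃ (.inl rfl))
    · exact .inl h
    · exact .inr h
  induction h with
  | done => exact ⟨hDefs, hNew, fun _ h => h, fun _ h => .inl h⟩
  | skip _ _ ih => exact ih (fun C A h => hl C A (List.mem_cons_of_mem _ h)) hDefs hNew
  | @extend C A l Defs New Defs' New' p D D' E g _ _ hD hD' hal _ hE _ ih =>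
    obtain ⟨hC, hA, hAp⟩ := hl C A List.mem_cons_self
    have hD'ok := (hDefs D hD.1).variant hD'
    have hEok : E.OK := hE.ok hAp
      (fun F hF => hF.elim (hD'ok.cata F) fun h => h.2.1)
      (hal.bodyOK_union hD'ok hC.body hA)
    exact main (l := l) (fun hE => ih (fun C A h => hl C A (List.mem_cons_of_mem _ h))
      (insert_ok hE hDefs) (insert_ok hE hNew)) hEok
  | @project C A l Defs New Defs' New' p E g _ _ _ _ hE _ ih =>
    obtain ⟨hC, hA, hAp⟩ := hl C A List.mem_cons_self
    have hEok : E.OK := hE.ok hAp (fun F hF => hF.2.1)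
      (hC.body.mono (by
        rintro F (rfl | hF)
        · exact hA
        · exact hF.1))
    exact main (l := l) (fun hE => ih (fun C A h => hl C A (List.mem_cons_of_mem _ h))
      (insert_ok hE hDefs) (insert_ok hE hNew)) hEok

/-! ### One iteration of the loop -/

theorem Defn.OK.toClause {D : Defn S} (hD : D.OK) : D.toClause.OK := by
  refine ⟨hD.body, ?_⟩
  rintro A hA t ht
  obtain rfl : A = _ := by simpa [Defn.toClause] using hA.symm
  obtain ⟨x, hx, rfl⟩ := List.mem_map.1 ht
  exact hD.basic x hx

/-- Whenever a clause of `P` derives the program atom of a definition from `J`, some unfolded clause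
has an instance with the corresponding head and a body true in `J`. Any set between the true
catamorphism atoms and the least model is allowed as `J`, which covers both the loop invariant and
the main argument. -/
theorem Unfold.ok {P : Set (Clause S)} (hP : IsProgram P) {NewDefs : Set (Defn S)}
    {UnfCls : Set (Clause S)} (h : Unfold P NewDefs UnfCls) (hN : ∀ D ∈ NewDefs, D.OK)
    {J : Set (GAtom S)} (hJ : J ⊆ leastModel P) (hJ' : ∀ h ps t os,
      GAtom.cata h ps t os ∈ leastModel P → GAtom.cata h ps t os ∈ J) :
    (∀ C ∈ UnfCls, C.OK) ∧ ∀ D ∈ NewDefs, ∀ v : Valn S, Sat v D.c → (∀ F ∈ D.catas, F.eval v ∈ J) →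
      ∀ K ∈ P, ∀ w : Valn S, Sat w K.constr → (∀ F ∈ K.body, F.eval w ∈ J) → ∀ B, K.head = some B →
        B.eval w = D.A.eval v → Covers J UnfCls (.new D.name ((D.U.map PVar.tm).map (STerm.eval v))) := by
  obtain ⟨f, Cls, hf, hcata, -, hfun, -⟩ := h
  have h₀ : ∀ C ∈ ⋃ D ∈ NewDefs, f D, C.OK := by
    intro C hC
    simp only [Set.mem_iUnion] at hC
    obtain ⟨D, hD, hC⟩ := hC
    obtain ⟨K, hK, hR⟩ := (hf D hD).1 C hC
    exact resolvent_prog_ok hP (hN D hD).toClause (hN D hD).prog (hN D hD).cata hK hR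
  have h₁ : (∀ C ∈ Cls, C.OK) ∧ ∀ g, Covers J (⋃ D ∈ NewDefs, f D) g → Covers J Cls g := by
    clear hfun
    induction hcata with
    | refl => exact ⟨h₀, fun _ h => h⟩
    | tail _ hs ih =>
      obtain ⟨a, b⟩ := unfoldCataStep_ok hP hJ hJ' hs ih.1
      exact ⟨a, fun g hg => b g (ih.2 g hg)⟩
  have h₂ : (∀ C ∈ UnfCls, C.OK) ∧ ∀ g, Covers J Cls g → Covers J UnfCls g := by
    induction hfun with
    | refl => exact ⟨h₁.1, fun _ h => h⟩
    | tail _ hs ih =>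
      obtain ⟨a, b⟩ := functionalityStep_ok hP hJ hs ih.1
      exact ⟨a, fun g hg => b g (ih.2 g hg)⟩
  refine ⟨h₂.1, fun D hD v hv hcatas K hK w hw hKb B hB he => h₂.2 _ (h₁.2 _ ?_)⟩
  have hok := hN D hD
  have hwf := hok.body.wf D.A List.mem_cons_self
  have hU := hf D hD
  have hprog := hok.prog
  cases hA : D.A with
  | prog p ts =>
    rw [hA] at hwf hU he
    obtain ⟨xs, rfl, hx, hs⟩ := hwf
    obtain ⟨R, hR, H⟩ := covers_unfold_prog hP hx hs hU hv hcatas hK hw hKb hB he rfl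
    exact ⟨R, Set.mem_iUnion₂.2 ⟨D, hD, hR⟩, H⟩
  | _ => simp [hA, Atom.isProg] at hprog

theorem Contract.goal_ok {K : Contract S} (hK : K.WF) : K.goal.OK := by
  refine ⟨?_, fun A hA => by simp [Contract.goal] at hA⟩
  have hmem : ∀ A ∈ K.goal.body, A = .prog K.pred (K.Z.map PVar.tm) ∨
      ∃ F ∈ K.catas, A = F.atom := by
    intro A hA
    rcases List.mem_cons.1 hA with h | h
    · exact .inl h
    · obtain ⟨F, hF, rfl⟩ := List.mem_map.1 h
      exact .inr ⟨F, hF, rfl⟩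
  constructor
  · intro A hA
    rcases hmem A hA with rfl | ⟨F, hF, rfl⟩
    · exact ⟨K.Z, rfl, hK.nodupZ, hK.sortZ⟩
    · refine ⟨by rw [map_fst_tm, hK.sortX F hF], (hK.sortT F hF).2, F.Y, rfl,
        (List.nodup_flatMap.1 (List.nodup_append.1 hK.nodupXY).2.1).1 F hF, hK.sortY F hF, ?_⟩
      intro y hy hy'
      rw [listVars_cons, listVars_tm] at hy'
      rcases hy' with h | h
      · obtain rfl : y = F.T := h
        exact hK.disjYZ F hF _ hy (hK.sortT F hF).1
      · exact hK.X_ne_Y hF hF h hy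
  · intro A hA y hy B hB hyB
    rcases hmem A hA with rfl | ⟨F, hF, rfl⟩
    · simp [Atom.outs, listVars] at hy
    · have hy : y ∈ F.Y := by simpa [CataSpec.atom, Atom.outs] using hy
      rcases hmem B hB with rfl | ⟨F', hF', rfl⟩
      · exact (hK.disjYZ F hF y hy (by simpa [Atom.vars, Atom.args] using hyB)).elim
      · rcases CataSpec.mem_vars_atom.1 hyB with h | rfl | h
        · exact (hK.X_ne_Y hF' hF h hy).elim
        · exact (hK.disjYZ F hF _ hy (hK.sortT F' hF').1).elim
        · rw [mem_flatMap_unique (List.nodup_append.1 hK.nodupXY).2.1 hF' hF h hy]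

/-- Every definition of the result of the loop has been processed in one of its iterations. -/
theorem Loop.invariant {P : Set (Clause S)} (hP : IsProgram P) {Cns : Set (Contract S)}
    (hCns : IsContractSet Cns) {InCls OutCls OutCls' : Set (Clause S)} {Defs Defs' : Set (Defn S)}
    (h : Loop P Cns InCls Defs OutCls Defs' OutCls') (hIn : ∀ C ∈ InCls, C.OK)
    (hDefs : ∀ D ∈ Defs, D.OK) (hOut : ∀ C ∈ OutCls, C.HeadBasic) :
    (∀ D ∈ Defs', D.OK) ∧ (∀ C ∈ OutCls', C.HeadBasic) ∧ OutCls ⊆ OutCls' ∧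
      ∀ D ∈ Defs', D ∈ Defs ∨ ∃ NewDefs UnfCls RCls, D ∈ NewDefs ∧ (∀ D ∈ NewDefs, D.OK) ∧
        Unfold P NewDefs UnfCls ∧ ApplyContracts Cns UnfCls RCls ∧ RCls ⊆ OutCls' := by
  induction h with
  | done => exact ⟨hDefs, hOut, fun _ h => h, fun _ h => .inl h⟩
  | @iter InCls UnfCls RCls OutCls OutCls' Defs Defs₁ NewDefs Defs' _ hdef hunf happ _ ih =>
    obtain ⟨l, hl, hloop⟩ := hdef
    obtain ⟨h₁, h₂, -, h₃⟩ := hloop.ok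
      (fun C A h => ⟨hIn C ((hl C A).1 h).1, ((hl C A).1 h).2⟩) hDefs (by simp)
    -- Only the syntactic half is needed here, so any admissible `J` would do.
    have hU := (hunf.ok hP h₂ (J := leastModel P) (fun _ h => h) fun _ _ _ _ h => h).1
    have hR : ∀ R ∈ RCls, R.OK := by
      intro R hR
      obtain ⟨C, hC, hCR⟩ := happ.2 R hR
      exact hCR.ok hCns (hU C hC)
    obtain ⟨i₁, i₂, i₃, i₄⟩ := ih (fun C hC => hR C hC.1) h₁
      (fun C hC => hC.elim (hOut C) fun h => (hR C h).head)
    refine ⟨i₁, i₂, fun C hC => i₃ (.inl hC), fun D hD => ?_⟩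
    rcases i₄ D hD with h | h
    · rcases h₃ D h with h | h
      · exact .inl h
      · exact .inr ⟨NewDefs, UnfCls, RCls, h, h₂, hunf, happ, fun C hC => i₃ (.inr hC)⟩
    · exact .inr h

/-! ### Folding -/

theorem FoldBody.isBasic {MDefs : Set (Defn S)} (hM : ∀ D ∈ MDefs, D.OK) {C : Clause S}
    {used : Set (PVar S)} {l l' : List (Atom S)} (h : FoldBody MDefs C used l l') :
    ∀ A ∈ l', ∀ t ∈ A.args, t.1.IsBasic := by
  induction h with
  | done => simp
  | cata _ _ ih => exact ih
  | prog _ hD hD' _ _ _ ih =>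
    intro A hA t ht
    rcases List.mem_cons.1 hA with rfl | hA
    · obtain ⟨x, hx, rfl⟩ := List.mem_map.1 ht
      exact ((hM _ hD).variant hD').basic x hx
    · exact ih A hA t ht

theorem Clause.isBasic_of_args {C : Clause S} (h₁ : C.HeadBasic)
    (h₂ : ∀ A ∈ C.body, ∀ t ∈ A.args, t.1.IsBasic) : C.IsBasic := by
  refine ⟨h₁, h₂, ?_⟩
  rintro x ((⟨A, hA, t, ht, hx⟩ | hx) | ⟨A, hA, t, ht, hx⟩)
  · exact t.2.isBasic_vars (h₁ A hA t ht) x hx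
  · exact C.constr.isBasic_vars trivial x hx
  · exact t.2.isBasic_vars (h₂ A hA t ht) x hx

/-- The definition `D` is sound in `I` for the ground program atom `a`. -/
def Defn.HoldsAt (P : Set (Clause S)) (I : Set (GAtom S)) (D : Defn S) (a : GAtom S) : Prop :=
  ∀ v : Valn S, D.A.eval v = a → Sat v D.c → (∀ F ∈ D.catas, F.eval v ∈ leastModel P) →
    GAtom.new D.name ((D.U.map PVar.tm).map (STerm.eval v)) ∈ I

theorem Defn.HoldsAt.variant {P : Set (Clause S)} {I : Set (GAtom S)} {D D' : Defn S} {a : GAtom S}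
    (h : D.HoldsAt P I a) (hD : Defn.IsVariant D' D) : D'.HoldsAt P I a := by
  obtain ⟨ρ, rfl⟩ := hD
  intro v hA hc hF
  have e : ((D.U.map ρ.app).map PVar.tm).map (STerm.eval v) =
      (D.U.map PVar.tm).map (STerm.eval fun s n => (ρ.subst s n).eval v) := by
    rw [← Ren.map_subst_tm, List.map_map]
    exact List.map_congr_left fun t _ => STerm.eval_subst _ _ t
  change GAtom.new D.name (((D.U.map ρ.app).map PVar.tm).map (STerm.eval v)) ∈ I
  rw [e]
  refine h _ ?_ (sat_subst.1 hc) fun F hF' => ?_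
  · rw [← Atom.eval_subst]; exact hA
  · rw [← Atom.eval_subst]; exact hF _ (List.mem_map.2 ⟨F, hF', rfl⟩)

/-- Completeness of folding for ground instances. -/
theorem FoldBody.exists_valn {P : Set (Clause S)} (hP : IsProgram P) {I : Set (GAtom S)}
    {MDefs : Set (Defn S)} (hM : ∀ D ∈ MDefs, D.OK) {C : Clause S} {used : Set (PVar S)}
    {l l' : List (Atom S)} (h : FoldBody MDefs C used l l') (hl : l ⊆ C.body) (v : Valn S)
    (hc : Sat v C.constr) (hcata : ∀ F ∈ C.body, F.isCata = true → F.eval v ∈ leastModel P)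
    (hI : ∀ A ∈ C.body, A.isProg = true → ∀ D ∈ MDefs, D.HoldsAt P I (A.eval v)) :
    ∃ w : Valn S, (∀ x : PVar S, x ∈ C.vars ∨ x ∈ used → w x.1 x.2 = v x.1 x.2) ∧
      ∀ A ∈ l', A.eval w ∈ I := by
  induction h generalizing v with
  | done => exact ⟨v, fun _ _ => rfl, by simp⟩
  | cata _ _ ih => exact ih (fun A hA => hl (List.mem_cons_of_mem _ hA)) v hc hcata hI
  | @prog used A l l' D D' hA hD hD' hf hu _ ih =>
    have hok := (hM D hD).variant hD'
    obtain ⟨hal, hsub, hent⟩ := hf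
    have hmem : ∀ F ∈ D'.catas, F ∈ {A | A ∈ D'.A :: D'.catas} :=
      fun F hF => List.mem_cons_of_mem _ hF
    -- A maximal definition may have catamorphism atoms that `C` lacks. They are made true by
    -- totality; by alignment and by `hu`, their outputs are neither variables of `C` nor of the
    -- definitions used before.
    obtain ⟨u, hu₁, hu₂⟩ := exists_extension hP {F | F ∈ D'.catas} {F | F ∈ C.body} v
      (fun F hF => hok.cata F hF) (fun F hF hFC => hcata F hFC (hok.cata F hF))
      (fun F hF _ => hok.body.wf F (hmem F hF))
      (fun F hF _ y hy F' hF' => hok.body.sep F (hmem F hF) y hy F' (hmem F' hF'))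
    have hout : ∀ F ∈ D'.catas, F ∉ C.body → ∀ y ∈ listVars F.outs, y ∉ C.vars :=
      fun F hF hFC y hy hyC => hFC (hal.mem_body_of_mem_outs hok hF hy hyC).1
    have huC : ∀ x ∈ C.vars, u x.1 x.2 = v x.1 x.2 := fun x hx =>
      hu₁ x fun F hF hFC hxF => hout F hF hFC x hxF hx
    have huU : ∀ x ∈ used, u x.1 x.2 = v x.1 x.2 := fun x hx =>
      hu₁ x fun F hF hFC hxF => hout F hF hFC x hxF
        (hu x (Defn.mem_vars_of_mem (hmem F hF) (F.outs_subset_vars hxF)) hx)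
    have hcu : Sat u C.constr := hc.congr fun x hx => (huC x (.inl (.inr hx))).symm
    have hev : ∀ B ∈ C.body, B.eval u = B.eval v := fun B hB =>
      B.eval_congr fun x hx => huC x (Clause.mem_vars_of_mem_body hB hx)
    have hAC : A ∈ C.body := hl List.mem_cons_self
    have hnew := (hI A hAC hA D hD).variant hD' u (by rw [hal.1, hev A hAC]) (hent u hcu) hu₂
    obtain ⟨w, hw₁, hw₂⟩ := ih (fun B hB => hl (List.mem_cons_of_mem _ hB)) u hcu
      (fun F hF h => by rw [hev F hF]; exact hcata F hF h)
      (fun B hB h => by rw [hev B hB]; exact hI B hB h)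
    refine ⟨w, fun x hx => ?_, fun B hB => ?_⟩
    · rcases hx with hx | hx
      · exact (hw₁ x (.inl hx)).trans (huC x hx)
      · exact (hw₁ x (.inr (.inl hx))).trans (huU x hx)
    · rcases List.mem_cons.1 hB with rfl | hB
      · convert hnew using 1
        have hU : ∀ x ∈ D'.U, w x.1 x.2 = u x.1 x.2 := fun x hx =>
          hw₁ x (.inr (.inr (.inl (.inl ⟨.new D'.name (D'.U.map PVar.tm), rfl, by
            simpa [Atom.vars, Atom.args] using hx⟩))))
        simp only [Atom.eval, map_tm_eval_eq_iff.2 hU]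
      · exact hw₂ B hB

theorem FoldsTo.exists_head {P : Set (Clause S)} (hP : IsProgram P) {I : Set (GAtom S)}
    {MDefs : Set (Defn S)} (hM : ∀ D ∈ MDefs, D.OK) {C R : Clause S} (h : FoldsTo MDefs C R)
    (hR : R.TrueIn I) {v : Valn S}
    (hc : Sat v C.constr) (hcata : ∀ F ∈ C.body, F.isCata = true → F.eval v ∈ leastModel P)
    (hI : ∀ A ∈ C.body, A.isProg = true → ∀ D ∈ MDefs, D.HoldsAt P I (A.eval v)) :
    ∃ A ∈ C.head, A.eval v ∈ I := by
  obtain ⟨G, hG, rfl⟩ := h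
  obtain ⟨w, hw₁, hw₂⟩ := hG.exists_valn hP hM (fun _ h => h) v hc hcata hI
  obtain ⟨A, hA, hAI⟩ := hR w (hc.congr fun x hx => (hw₁ x (.inl (.inl (.inr hx)))).symm) hw₂
  refine ⟨A, hA, ?_⟩
  rwa [A.eval_congr fun x hx => hw₁ x (.inl (.inl (.inl ⟨A, hA, hx⟩)))] at hAI

/-- The contract `K` holds for the ground program atom `a`. -/
def Contract.HoldsAt (P : Set (Clause S)) (K : Contract S) (a : GAtom S) : Prop :=
  ∀ v : Valn S, (Atom.prog K.pred (K.Z.map PVar.tm)).eval v = a → Sat v K.pre →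
    (∀ F ∈ K.catas, F.atom.eval v ∈ leastModel P) → Sat v K.post

/-! ### The two claims: basic sort and validity of the contracts -/

theorem Tcata.isBasic {P : Set (Clause S)} {Cns : Set (Contract S)} (hP : IsProgram P)
    (hCns : IsContractSet Cns) {TransfCls : Set (Clause S)} (hT : Tcata P Cns TransfCls) :
    ∀ C ∈ TransfCls, C.IsBasic := by
  obtain ⟨Defs, OutCls, hloop, hfold⟩ := hT
  obtain ⟨hok, hhead, -, -⟩ := hloop.invariant hP hCns
    (by rintro _ ⟨K, hK, rfl⟩; exact Contract.goal_ok (hCns.wf K hK)) (by simp)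
    (by rintro _ ⟨K, hK, rfl⟩; exact (Contract.goal_ok (hCns.wf K hK)).head)
  intro R hR
  obtain ⟨C, hC, G, hG, rfl⟩ := hfold.2 R hR
  exact Clause.isBasic_of_args (headBasic_congr (hhead C hC.1))
    (hG.isBasic fun D hD => hok D hD.choose_spec.1)

theorem Tcata.valid {P : Set (Clause S)} {Cns : Set (Contract S)} (hP : IsProgram P)
    (hCns : IsContractSet Cns) {TransfCls : Set (Clause S)} (hT : Tcata P Cns TransfCls)
    (hsat : Satisfiable TransfCls) : ∀ K ∈ Cns, K.Valid P := by
  obtain ⟨Defs, OutCls, hloop, hfold⟩ := hT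
  obtain ⟨I, hI⟩ := hsat
  obtain ⟨hok, -, hgoal, hdef⟩ := hloop.invariant hP hCns
    (by rintro _ ⟨K, hK, rfl⟩; exact Contract.goal_ok (hCns.wf K hK)) (by simp)
    (by rintro _ ⟨K, hK, rfl⟩; exact (Contract.goal_ok (hCns.wf K hK)).head)
  have hMok : ∀ D ∈ maxDefs Defs, D.OK := fun D ⟨p, hD⟩ => hok D hD.1
  -- The induction hypothesis as a set of atoms. It asks for soundness of definitions and of
  -- contracts together, since each is needed for the other, and puts no condition on catamorphism
  -- atoms.
  let J : Set (GAtom S) := {a | a ∈ leastModel P ∧ ∀ p vs, a = .prog p vs →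
    (∀ D ∈ maxDefs Defs, D.HoldsAt P I a) ∧ ∀ K ∈ Cns, K.HoldsAt P a}
  have hJ : J ⊆ leastModel P := fun a ha => ha.1
  have hJ' : ∀ h ps t os, GAtom.cata h ps t os ∈ leastModel P → GAtom.cata h ps t os ∈ J :=
    fun h ps t os ha => ⟨ha, fun p vs e => by cases e⟩
  have hJval : ∀ K ∈ Cns, ∀ v : Valn S, (Atom.prog K.pred (K.Z.map PVar.tm)).eval v ∈ J →
      Sat v K.pre → (∀ F ∈ K.catas, F.atom.eval v ∈ leastModel P) → Sat v K.post :=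
    fun K hK v hv => (hv.2 _ _ rfl).2 K hK v rfl
  have hJdef : ∀ (A : Atom S) (v : Valn S), A.isProg = true → A.eval v ∈ J →
      ∀ D ∈ maxDefs Defs, D.HoldsAt P I (A.eval v) := by
    intro A v hA hv
    cases A with
    | prog p ts => exact (hv.2 _ _ rfl).1
    | _ => simp [Atom.isProg] at hA
  have hfolds : ∀ C ∈ toBeFolded OutCls Defs, ∀ v : Valn S, Sat v C.constr →
      (∀ F ∈ C.body, F.isCata = true → F.eval v ∈ leastModel P) →
      (∀ A ∈ C.body, A.isProg = true → ∀ D ∈ maxDefs Defs, D.HoldsAt P I (A.eval v)) →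
      ∃ A ∈ C.head, A.eval v ∈ I := by
    intro C hC v h₁ h₂ h₃
    obtain ⟨R, hR, hCR⟩ := hfold.1 C hC
    exact hCR.exists_head hP hMok (hI R hR) h₁ h₂ h₃
  have hmodel : IsModel P J := by
    intro C hC v hc hb
    obtain ⟨A, hA, hAM⟩ := leastModel_isModel hP.head_ne_none C hC v hc fun B hB => hJ (hb B hB)
    refine ⟨A, hA, hAM, fun p vs e => ?_⟩
    have hdefs : ∀ D ∈ maxDefs Defs, D.HoldsAt P I (A.eval v) := by
      rintro D ⟨q, hD⟩ w hw hcw hF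
      obtain ⟨NewDefs, UnfCls, RCls, hDN, hN, hunf, happ, hsub⟩ :=
        -- The loop starts without definitions, so `D` was introduced, unfolded and processed with
        -- contracts in some iteration.
        (hdef D hD.1).resolve_left (Set.notMem_empty D)
      obtain ⟨C₁, hC₁, u, h₁, h₂, h₃⟩ := (hunf.ok hP hN hJ hJ').2 D hDN w hcw
        (fun F hF' => by
          have hFM := hF F hF'
          have hFc := (hok D hD.1).cata F hF'
          cases F with
          | cata h ps t os => exact hJ' _ _ _ _ hFM
          | _ => simp [Atom.isCata] at hFc)
        C hC v hc hb A hA hw.symm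
      obtain ⟨R, hR, hCR⟩ := happ.1 C₁ hC₁
      obtain ⟨u', h₁', h₂', h₃'⟩ := hCR.exists_valn hP hJ hJ' hCns hJval h₂ h₃
      rw [h₁] at h₁'
      obtain ⟨B, hB, hBe⟩ := Option.map_eq_some_iff.1 h₁'
      -- The head of `R` has the predicate of the maximal definition `D`, so `R` is among the
      -- clauses that are folded, and its folding is true in `I`.
      obtain ⟨B', hB', hBI⟩ := hfolds R ⟨hsub hR, .inr ⟨D, ⟨q, hD⟩, by
          cases B with
          | new n ts =>
            simp only [Atom.eval, GAtom.new.injEq] at hBe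
            exact ⟨ts, by rw [hB, hBe.1]⟩
          | _ => simp [Atom.eval] at hBe⟩⟩ u' h₂'
        (fun F hF _ => hJ (h₃' F hF)) (fun B hB hBp => hJdef B u' hBp (h₃' B hB))
      rw [hB, Option.mem_some_iff] at hB'
      rwa [← hB', hBe] at hBI
    refine ⟨hdefs, fun K hK w hw hpre hcatas => ?_⟩
    -- The program atom of the goal is the head atom itself, not an atom of the clause body; this is
    -- why soundness of the definitions at that atom had to come first. Folding the goal then yields
    -- an atom in the head `false`.
    by_contra hpost
    obtain ⟨B, hB, -⟩ := hfolds K.goal ⟨hgoal ⟨K, hK, rfl⟩, .inl rfl⟩ w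
      (sat_and.2 ⟨sat_neg.2 hpost, hpre⟩)
      (fun F hF hFc => by
        rcases List.mem_cons.1 hF with rfl | hF
        · simp [Atom.isCata] at hFc
        · obtain ⟨F', hF', rfl⟩ := List.mem_map.1 hF
          exact hcatas F' hF')
      (fun B hB hBp => by
        rcases List.mem_cons.1 hB with rfl | hB
        · rw [hw]; exact hdefs
        · obtain ⟨F', hF', rfl⟩ := List.mem_map.1 hB
          simp [CataSpec.atom, Atom.isProg] at hBp)
    simp [Contract.goal] at hB
  intro K hK v hv hpre hcatas
  exact hJval K hK v (leastModel_subset hmodel hv) hpre hcatas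

end TCata

theorem theorem3 {S : TCata.Sig} (P : Set (TCata.Clause S)) (Cns : Set (TCata.Contract S))
    (hP : TCata.IsProgram P) (hCns : TCata.IsContractSet Cns)
    (TransfCls : Set (TCata.Clause S)) (hT : TCata.Tcata P Cns TransfCls) :
    (∀ C ∈ TransfCls, C.IsBasic) ∧
      (TCata.Satisfiable TransfCls → ∀ K ∈ Cns, K.Valid P) :=
  ⟨hT.isBasic hP hCns, hT.valid hP hCns⟩
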